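/- Let $M$ be a closed smooth manifold (compact, Hausdorff, without boundary) of dimension $n \ge 0$. Let $\mathcal G = \mathcal G_M^t := (M\times M\times(0,1]) \sqcup TM$ and $\mathcal G^{(0)} := M\times[0,1]$, with range, source, units, inverse and composition $$r(x,y,t)=(x,t),\quad s(x,y,t)=(y,t),\quad r(x,v)=s(x,v)=(x,0),$$ $$u(x,t)=(x,x,t)\ (t>0),\quad u(x,0)=(x,0_x),\quad (x,y,t)^{-1}=(y,x,t),\quad (x,v)^{-1}=(x,-v),$$ $$(x,y,t)\circ(y,z,t)=(x,z,t),\qquad (x,v)\circ(x,w)=(x,v+w).$$ Fix any Riemannian metric on $M$, let $\exp$ be its exponential map, and define $\Phi\colon TM\times[0,1]\to\mathcal G$ by $$\Phi(x,v,t)=\bigl(\exp_x(\tfrac{tv}{2}),\,\exp_x(-\tfrac{tv}{2}),\,t\bigr)\ (t>0),\qquad \Phi(x,v,0)=(x,v).$$ Then there is one and only one structure of a smooth manifold with boundary on $\mathcal G$ (modelled on a $(2n+1)$-dimensional half-space) such that 1. the inclusion of $M\times M\times(0,1]$, with its product structure, is a diffeomorphism onto an open subset of $\mathcal G$, and 2.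 for some open set $U$ with $TM\times\{0\}\subseteq U\subseteq TM\times[0,1]$, the restriction $\Phi|_U$ is a diffeomorphism onto an open subset of $\mathcal G$. With this structure $\mathcal G$ is Hausdorff and second countable, and $\mathcal G\rightrightarrows M\times[0,1]$ is a Lie groupoid: it satisfies the groupoid axioms, $r,s,u$ and the inversion are smooth, $r$ and $s$ are submersions, the set $\mathcal G^{(2)}=\{(a,b) : s(a)=r(b)\}$ of composable pairs is an embedded submanifold of $\mathcal G\times\mathcal G$, and the composition $\mathcal G^{(2)}\to\mathcal G$ is smooth. -/

import Mathlib

open Set (Icc Ioo InjOn)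
open Manifold (IsSubmersion IsSmoothEmbedding)
open scoped Manifold ContDiff Topology

noncomputable section

/-! ### Groupoids and Lie groupoids -/

/-- The structure maps of a groupoid with objects `G₀` and arrows `G₁`: range, source, units,
inversion, and composition of the pairs `(a, b)` with `s a = r b`. The laws are stated separately,
in `GroupoidData.IsGroupoid`. -/
structure GroupoidData (G₀ G₁ : Type*) where
  r : G₁ → G₀
  s : G₁ → G₀
  u : G₀ → G₁
  i : G₁ → G₁
  m : {p : G₁ × G₁ // s p.1 = r p.2} → G₁

namespace GroupoidData

/-- The set of composable pairs of arrows, the fibre product of `s` and `r`. -/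
abbrev Composable {G₀ G₁ : Type*} (𝒢 : GroupoidData G₀ G₁) : Type _ :=
  {p : G₁ × G₁ // 𝒢.s p.1 = 𝒢.r p.2}

/-- The composition `a ∘ b` of two composable arrows. -/
abbrev comp {G₀ G₁ : Type*} (𝒢 : GroupoidData G₀ G₁) (a b : G₁) (h : 𝒢.s a = 𝒢.r b) : G₁ :=
  𝒢.m ⟨(a, b), h⟩

/-- The groupoid axioms. -/
structure IsGroupoid {G₀ G₁ : Type*} (𝒢 : GroupoidData G₀ G₁) : Prop where
  r_unit : ∀ x, 𝒢.r (𝒢.u x) = x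
  s_unit : ∀ x, 𝒢.s (𝒢.u x) = x
  unit_comp : ∀ a, 𝒢.comp (𝒢.u (𝒢.r a)) a (s_unit _) = a
  comp_unit : ∀ a, 𝒢.comp a (𝒢.u (𝒢.s a)) (r_unit _).symm = a
  r_comp : ∀ a b h, 𝒢.r (𝒢.comp a b h) = 𝒢.r a
  s_comp : ∀ a b h, 𝒢.s (𝒢.comp a b h) = 𝒢.s b
  assoc : ∀ a b c (hab : 𝒢.s a = 𝒢.r b) (hbc : 𝒢.s b = 𝒢.r c),
    𝒢.comp (𝒢.comp a b hab) c ((s_comp a b hab).trans hbc) =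
      𝒢.comp a (𝒢.comp b c hbc) (hab.trans (r_comp b c hbc).symm)
  s_inv : ∀ a, 𝒢.s (𝒢.i a) = 𝒢.r a
  r_inv : ∀ a, 𝒢.r (𝒢.i a) = 𝒢.s a
  inv_comp : ∀ a, 𝒢.comp (𝒢.i a) a (s_inv a) = 𝒢.u (𝒢.s a)
  comp_inv : ∀ a, 𝒢.comp a (𝒢.i a) (r_inv a).symm = 𝒢.u (𝒢.r a)

/-- A Lie groupoid: objects and arrows are (second countable) smooth manifolds, possibly with
boundary or corners, all structure maps are smooth, and source and range are submersions.
The set of composable pairs, with the subspace topology, is an embedded submanifold of `G₁ × G₁`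
(modelled on `J₂`), and the composition is smooth on it. -/
structure IsLieGroupoid {E₀ H₀ E₁ H₁ E₂ H₂ : Type*}
    [NormedAddCommGroup E₀] [NormedSpace ℝ E₀] [TopologicalSpace H₀]
    [NormedAddCommGroup E₁] [NormedSpace ℝ E₁] [TopologicalSpace H₁]
    [NormedAddCommGroup E₂] [NormedSpace ℝ E₂] [TopologicalSpace H₂]
    (J₀ : ModelWithCorners ℝ E₀ H₀) (J₁ : ModelWithCorners ℝ E₁ H₁)
    (J₂ : ModelWithCorners ℝ E₂ H₂)
    {G₀ G₁ : Type*} [TopologicalSpace G₀] [ChartedSpace H₀ G₀]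
    [TopologicalSpace G₁] [ChartedSpace H₁ G₁]
    (𝒢 : GroupoidData G₀ G₁) : Prop where
  isGroupoid : 𝒢.IsGroupoid
  isManifold_obj : IsManifold J₀ ∞ G₀
  isManifold_arr : IsManifold J₁ ∞ G₁
  secondCountable_obj : SecondCountableTopology G₀
  secondCountable_arr : SecondCountableTopology G₁
  smooth_r : ContMDiff J₁ J₀ ∞ 𝒢.r
  smooth_s : ContMDiff J₁ J₀ ∞ 𝒢.s
  smooth_u : ContMDiff J₀ J₁ ∞ 𝒢.u
  smooth_i : ContMDiff J₁ J₁ ∞ 𝒢.i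
  submersion_r : IsSubmersion J₁ J₀ ∞ 𝒢.r
  submersion_s : IsSubmersion J₁ J₀ ∞ 𝒢.s
  smooth_m : ∃ _ : ChartedSpace H₂ 𝒢.Composable, IsManifold J₂ ∞ 𝒢.Composable ∧
    IsSmoothEmbedding J₂ (J₁.prod J₁) ∞ (Subtype.val : 𝒢.Composable → G₁ × G₁) ∧
    ContMDiff J₂ J₁ ∞ 𝒢.m

end GroupoidData

/-- A smooth structure on a set `X`: a topology together with an atlas, modelled on `J`, whose
coordinate changes are smooth. -/
structure SmoothStructure {E H : Type*} [NormedAddCommGroup E] [NormedSpace ℝ E]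
    [TopologicalSpace H] (J : ModelWithCorners ℝ E H) (X : Type*) where
  top : TopologicalSpace X
  charted : ChartedSpace H X
  isManifold : IsManifold J ∞ X

/-- Two smooth structures on the same set agree: the identity is smooth in both directions. -/
def SmoothStructure.Same {E H : Type*} [NormedAddCommGroup E] [NormedSpace ℝ E]
    [TopologicalSpace H] {J : ModelWithCorners ℝ E H} {X : Type*}
    (S T : SmoothStructure J X) : Prop :=
  @ContMDiff ℝ _ E _ _ H _ J X S.top S.charted E _ _ H _ J X T.top T.charted ∞ id ∧
  @ContMDiff ℝ _ E _ _ H _ J X T.top T.charted E _ _ H _ J X S.top S.charted ∞ id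

/-! ### The Riemannian exponential map -/

section Exponential

variable {n : ℕ} {M : Type*} [TopologicalSpace M] [ChartedSpace (EuclideanSpace ℝ (Fin n)) M]
  [IsManifold (𝓡 n) ∞ M]

/-- A smooth Riemannian metric on `M`. -/
abbrev SmoothMetric (n : ℕ) (M : Type*) [TopologicalSpace M]
    [ChartedSpace (EuclideanSpace ℝ (Fin n)) M] [IsManifold (𝓡 n) ∞ M] : Type _ :=
  Bundle.ContMDiffRiemannianMetric (𝓡 n) ∞ (EuclideanSpace ℝ (Fin n))
    (fun x : M => TangentSpace (𝓡 n) x)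

/-- The coordinate frame of the chart `φ` around `p`: the derivative of `φ⁻¹` at a point `y` of the
image of the chart. -/
def chartFrame (p : M) (y : EuclideanSpace ℝ (Fin n)) :
    EuclideanSpace ℝ (Fin n) →L[ℝ] TangentSpace (𝓡 n) ((extChartAt (𝓡 n) p).symm y) :=
  mfderiv 𝓘(ℝ, EuclideanSpace ℝ (Fin n)) (𝓡 n) (extChartAt (𝓡 n) p).symm y

/-- The metric in the chart around `p`: the bilinear form `(a, b) ↦ ∑ g_ij(y) a_i b_j` at a point
`y` of the image of the chart. -/
def chartMetric (g : SmoothMetric n M) (p : M) (y a b : EuclideanSpace ℝ (Fin n)) : ℝ :=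
  g.inner ((extChartAt (𝓡 n) p).symm y) (chartFrame p y a) (chartFrame p y b)

/-- The Christoffel symbols of the first kind in the chart around `p`, as the trilinear form
`(a, b, c) ↦ ∑ ½ (∂_i g_jk + ∂_j g_ik - ∂_k g_ij) a_i b_j c_k`. -/
def chartChristoffel (g : SmoothMetric n M) (p : M) (y a b c : EuclideanSpace ℝ (Fin n)) : ℝ :=
  (fderiv ℝ (fun z => chartMetric g p z b c) y a
    + fderiv ℝ (fun z => chartMetric g p z a c) y b
    - fderiv ℝ (fun z => chartMetric g p z a b) y c) / 2

/-- `γ` is a geodesic of `g` on the open set `J ⊆ ℝ`: it is `C²` there and in every chart it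
satisfies the geodesic equation `∑ g_kl u_k'' + ∑ Γ_{ij,l} u_i' u_j' = 0` for all `l`
(the index being lowered by `g`). -/
def IsGeodesicOn (g : SmoothMetric n M) (γ : ℝ → M) (J : Set ℝ) : Prop :=
  ContMDiffOn 𝓘(ℝ, ℝ) (𝓡 n) 2 γ J ∧
  ∀ p : M, ∀ τ ∈ J, γ τ ∈ (extChartAt (𝓡 n) p).source →
    let u : ℝ → EuclideanSpace ℝ (Fin n) := fun σ => extChartAt (𝓡 n) p (γ σ)
    ∀ c : EuclideanSpace ℝ (Fin n),
      chartMetric g p (u τ) (deriv (deriv u) τ) c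
        + chartChristoffel g p (u τ) (deriv u τ) (deriv u τ) c = 0

/-- `γ` is a geodesic, on an open interval containing `[0, 1]`, whose initial point and initial
velocity are given by the tangent vector `w`. -/
def IsGeodesicFrom (g : SmoothMetric n M) (w : TangentBundle (𝓡 n) M) (γ : ℝ → M) : Prop :=
  (∃ ε > 0, IsGeodesicOn g γ (Ioo (-ε) (1 + ε))) ∧
  (⟨γ 0, mfderiv 𝓘(ℝ, ℝ) (𝓡 n) γ 0 (1 : ℝ)⟩ : TangentBundle (𝓡 n) M) = w

open Classical in
/-- The exponential map of `g`: `exp_x(v) = γ(1)` for the geodesic `γ` with `γ(0) = x` and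
`γ'(0) = v`. (On a closed manifold, this geodesic always exists; outside of the domain of the
exponential map, the value is the base point.) -/
def riemannianExp (g : SmoothMetric n M) (w : TangentBundle (𝓡 n) M) : M :=
  if h : ∃ γ : ℝ → M, IsGeodesicFrom g w γ then h.choose 1 else w.proj

end Exponential

/-! ### The tangent groupoid -/

/-- The half-open interval `(0, 1]`, as an open subset of the manifold with boundary `[0, 1]`. -/
def unitIoc : TopologicalSpace.Opens (Icc (0 : ℝ) 1) :=
  ⟨{t | 0 < (t : ℝ)}, isOpen_lt continuous_const continuous_subtype_val⟩

/-- The set of arrows `(M × M × (0, 1]) ∪ TM` of the tangent groupoid. -/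
inductive TangentGroupoid (n : ℕ) (M : Type*) [TopologicalSpace M]
    [ChartedSpace (EuclideanSpace ℝ (Fin n)) M]
  | pair (x y : M) (t : unitIoc)
  | tangent (x : M) (v : TangentSpace (𝓡 n) x)

theorem TangentGroupoid.not_composable {M : Type*} {x y : M} {t : unitIoc} (h : (x, t.1) = (y, (0 : Icc (0 : ℝ) 1))) : False := by
  have h0 : (0 : ℝ) < (t.1 : ℝ) := t.2
  have h1 : t.1 = (0 : Icc (0 : ℝ) 1) := congrArg Prod.snd h
  rw [h1] at h0
  exact lt_irrefl (0 : ℝ) h0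

namespace TangentGroupoid

variable {n : ℕ} {M : Type*} [TopologicalSpace M] [ChartedSpace (EuclideanSpace ℝ (Fin n)) M]

/-- `r(x, y, t) = (x, t)` and `r(x, v) = (x, 0)`. -/
def range : TangentGroupoid n M → M × Icc (0 : ℝ) 1
  | pair x _ t => (x, t.1)
  | tangent x _ => (x, 0)

/-- `s(x, y, t) = (y, t)` and `s(x, v) = (x, 0)`. -/
def source : TangentGroupoid n M → M × Icc (0 : ℝ) 1
  | pair _ y t => (y, t.1)
  | tangent x _ => (x, 0)

open Classical in
/-- `u(x, t) = (x, x, t)` for `t > 0` and `u(x, 0) = (x, 0) ∈ TM`. -/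
def unit (p : M × Icc (0 : ℝ) 1) : TangentGroupoid n M :=
  if h : p.2 ∈ unitIoc then pair p.1 p.1 ⟨p.2, h⟩ else tangent p.1 0

/-- `(x, y, t)⁻¹ = (y, x, t)` and `(x, v)⁻¹ = (x, -v)`. -/
def inv : TangentGroupoid n M → TangentGroupoid n M
  | pair x y t => pair y x t
  | tangent x v => tangent x (-v)

/-- `(x, y, t) ∘ (y, z, t) = (x, z, t)` and `(x, v) ∘ (x, w) = (x, v + w)`. -/
def mul : {p : TangentGroupoid n M × TangentGroupoid n M // source p.1 = range p.2} →
    TangentGroupoid n M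
  | ⟨(pair x _ t, pair _ z _), _⟩ => pair x z t
  | ⟨(pair _ _ _, tangent _ _), h⟩ => (not_composable h).elim
  | ⟨(tangent _ _, pair _ _ _), h⟩ => (not_composable h.symm).elim
  | ⟨(tangent x v, tangent _ w), h⟩ =>
      have e : x = _ := congrArg Prod.fst h
      tangent x (v + e ▸ w)

variable (n M) in
/-- The tangent groupoid of `M`, over `M × [0, 1]`. -/
def groupoid : GroupoidData (M × Icc (0 : ℝ) 1) (TangentGroupoid n M) where
  r := range
  s := source
  u := unit
  i := inv
  m := mul

open Classical in
/-- The gluing map `Φ(x, v, t) = (exp_x(tv/2), exp_x(-tv/2), t)` for `t > 0` and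
`Φ(x, v, 0) = (x, v)`. -/
def glue [IsManifold (𝓡 n) ∞ M] (g : SmoothMetric n M)
    (q : TangentBundle (𝓡 n) M × Icc (0 : ℝ) 1) : TangentGroupoid n M :=
  if h : q.2 ∈ unitIoc then
    pair (riemannianExp g ⟨q.1.proj, ((q.2 : ℝ) / 2) • q.1.snd⟩)
      (riemannianExp g ⟨q.1.proj, (-((q.2 : ℝ) / 2)) • q.1.snd⟩) ⟨q.2, h⟩
  else tangent q.1.proj q.1.snd

/-- The model of `TM × [0, 1]`: a half-space of dimension `2n + 1`. -/
abbrev arrowModel (n : ℕ) := (𝓡 n).tangent.prod (𝓡∂ 1)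

/-- The model of the space of composable pairs: a half-space of dimension `3n + 1`. -/
abbrev composableModel (n : ℕ) := ((𝓡 n).prod ((𝓡 n).prod (𝓡 n))).prod (𝓡∂ 1)

/-- A smooth structure on `(M × M × (0, 1]) ∪ TM` is glued by `Φ` if
* `M × M × (0, 1]` (with its product structure) is an open submanifold, and
* there is an open set `U` with `TM × {0} ⊆ U ⊆ TM × [0, 1]` such that `Φ` restricts to a
  diffeomorphism of `U` onto an open subset (that is, `Φ` is an injective local diffeomorphism
  on `U`). -/
def IsGlued [IsManifold (𝓡 n) ∞ M] (g : SmoothMetric n M)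
    (S : SmoothStructure (arrowModel n) (TangentGroupoid n M)) : Prop :=
  letI := S.top
  letI := S.charted
  IsLocalDiffeomorph ((𝓡 n).prod ((𝓡 n).prod (𝓡∂ 1))) (arrowModel n) ∞
    (fun p : M × M × unitIoc => pair (n := n) p.1 p.2.1 p.2.2) ∧
  ∃ U : Set (TangentBundle (𝓡 n) M × Icc (0 : ℝ) 1), IsOpen U ∧
    (∀ w : TangentBundle (𝓡 n) M, (w, (0 : Icc (0 : ℝ) 1)) ∈ U) ∧
    InjOn (glue g) U ∧
    IsLocalDiffeomorphOn ((𝓡 n).tangent.prod (𝓡∂ 1)) (arrowModel n) ∞ (glue g) U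

end TangentGroupoid

end

/-!
# The tangent groupoid of a closed manifold

The smooth structure is first constructed without reference to the exponential map, as a deformation
to the normal cone of the diagonal. Two charts `φ`, `ψ` of `M` give a parametrization
`(x, v, t) ↦ (φ⁻¹ x, ψ⁻¹ (x - t v), t)` for `t > 0`, and if `φ = ψ` it is continued to `t = 0` by
`(x, v, 0) ↦ dφ⁻¹(x) v` (`TangentGroupoid.param`). For `φ = ψ` the transitions are difference
quotients `(f (x + t v) - f x) / t` of coordinate changes `f`, which are smooth up to `t = 0` by
Hadamard's formula (`contDiffAt_diffQuot`, `TangentGroupoid.contMDiffOn_coords_param`). So the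
parametrizations define a manifold with boundary.

In these coordinates the structure maps are polynomial: range and source are
`(x, v, t) ↦ (x, t)` and `(x - t v, t)`, the inversion is `(x, v, t) ↦ (x - t v, -v, t)`, and
composable pairs are given by the points `(x, v, w, t)`, with the composition `(x, v + w, t)`
(`TangentGroupoid.mul_compParam`). The shear that replaces the range of the second arrow by its
difference from the source of the first makes the composable pairs a linear subspace of the pairs of
arrows (`TangentGroupoid.isSmoothEmbedding_composable`). Hence the groupoid is a Lie groupoid
(`TangentGroupoid.isLieGroupoid`).

For the gluing map, the exponential map has to be smooth near the zero vectors, with the derivative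
`(x, v) ↦ x + v` in a chart. Geodesics solve `u'' = A(u, u')`, where `A` is quadratic in the
velocity, so that constant curves are equilibria with the linearization `u'' = 0`. The inverse
function theorem in the Banach space of continuous accelerations on `[-1, 2]` gives solutions
depending smoothly on their initial values (`exists_local_flow`); by the transformation law of the
Christoffel symbols and uniqueness of geodesics, these compute the exponential map
(`exists_exp_eq`). In the coordinates above the gluing map then becomes
`(x, v, t) ↦ (e(x, tv/2), (e(x, tv/2) - e(x, -tv/2)) / t, t)`, where `e` is the exponential map in
the chart; this is again a difference quotient, it is the identity at `t = 0`, and for `t > 0` it is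
conjugate by a rescaling to `v ↦ (exp(v/2), exp(-v/2))`, which is a local diffeomorphism near the
zero section (`isLocalDiffeomorphAt_glueCoords`). Compactness of `M` makes the latter map injective
near the zero section, and this gives injectivity of the gluing map
(`TangentGroupoid.exists_glue_domain`).

Uniqueness holds because the inclusion of `M × M × (0, 1]` and the gluing map are local
diffeomorphisms for both structures, and every arrow is in the image of one of them
(`TangentGroupoid.IsGlued.contMDiff_id`).
-/


noncomputable section

/-! ### Smoothness of superposition operators -/

section Superposition

universe u

variable {K : Type*} [TopologicalSpace K] [CompactSpace K]
  {E F : Type u} [NormedAddCommGroup E] [NormedSpace ℝ E] [NormedAddCommGroup F] [NormedSpace ℝ F]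

variable (K E F) in
/-- Pointwise application of a continuous family of operators to a continuous family of vectors, as
a bounded bilinear map. -/
def pointwiseApply : C(K, E →L[ℝ] F) →L[ℝ] C(K, E) →L[ℝ] C(K, F) :=
  LinearMap.mkContinuous₂
    (LinearMap.mk₂ ℝ (fun (A : C(K, E →L[ℝ] F)) (γ : C(K, E)) =>
        (⟨fun s => A s (γ s), by fun_prop⟩ : C(K, F)))
      (fun _ _ _ => by ext; simp) (fun _ _ _ => by ext; simp)
      (fun _ _ _ => by ext; simp) (fun _ _ _ => by ext; simp)) 1
    (fun A γ => by
      rw [one_mul]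
      refine (ContinuousMap.norm_le _ (by positivity)).2 fun s => ?_
      exact ((A s).le_opNorm (γ s)).trans
        (mul_le_mul (A.norm_coe_le_norm s) (γ.norm_coe_le_norm s) (norm_nonneg _) (by positivity)))

@[simp] theorem pointwiseApply_apply (A : C(K, E →L[ℝ] F)) (γ : C(K, E)) (s : K) :
    pointwiseApply K E F A γ s = A s (γ s) := rfl

theorem hasFDerivAt_postcomp {f : E → F} (hf : Differentiable ℝ f)
    (hf' : Continuous (fderiv ℝ f)) (γ : C(K, E)) :
    HasFDerivAt (fun η : C(K, E) => (⟨f, hf.continuous⟩ : C(E, F)).comp η)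
      (pointwiseApply K E F ((⟨fderiv ℝ f, hf'⟩ : C(E, E →L[ℝ] F)).comp γ)) γ := by
  rw [hasFDerivAt_iff_isLittleO, Asymptotics.isLittleO_iff]
  intro c hc
  -- `fderiv ℝ f` is uniformly continuous near the compact image of `γ`
  have hK : IsCompact (Set.range γ) := isCompact_range γ.continuous
  have hu := hK.uniformContinuousAt_of_continuousAt (fderiv ℝ f)
    (fun a _ => hf'.continuousAt) (Metric.dist_mem_uniformity hc)
  obtain ⟨δ, hδ, hδ'⟩ := Metric.mem_uniformity_dist.1 hu
  filter_upwards [Metric.ball_mem_nhds γ hδ] with η hη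
  refine (ContinuousMap.norm_le _ (by positivity)).2 fun s => ?_
  have h1 : η s ∈ Metric.ball (γ s) δ :=
    lt_of_le_of_lt (ContinuousMap.dist_apply_le_dist s) hη
  have h2 := (convex_ball (γ s) δ).norm_image_sub_le_of_norm_fderiv_le' (𝕜 := ℝ) (f := f)
    (φ := fderiv ℝ f (γ s)) (C := c) (x := γ s) (y := η s) (fun x _ => hf x)
    (fun x hx => by
      have := hδ' (a := γ s) (b := x) (by rw [dist_comm]; exact hx) ⟨s, rfl⟩
      rw [← dist_eq_norm, dist_comm]; exact this.le)
    (Metric.mem_ball_self hδ) h1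
  refine h2.trans (mul_le_mul_of_nonneg_left ?_ hc.le)
  exact (η - γ).norm_coe_le_norm s

/-- Composition with a smooth function is a smooth map between spaces of continuous paths. -/
theorem contDiff_postcomp {f : E → F} (hf : ContDiff ℝ ∞ f) :
    ContDiff ℝ ∞ (fun η : C(K, E) => (⟨f, hf.continuous⟩ : C(E, F)).comp η) := by
  rw [contDiff_infty]
  intro k
  induction k generalizing F with
  | zero =>
    rw [Nat.cast_zero, contDiff_zero]
    exact ContinuousMap.continuous_postcomp _
  | succ k ih =>
    have hd := contDiff_infty_iff_fderiv.1 hf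
    rw [Nat.cast_succ, contDiff_succ_iff_hasFDerivAt]
    refine ⟨_, ?_, fun γ => hasFDerivAt_postcomp hd.1 hd.2.continuous γ⟩
    exact (pointwiseApply K E F).contDiff.comp (ih hd.2)

end Superposition

/-! ### Difference quotients -/

section Slope

variable {E F : Type} [NormedAddCommGroup E] [NormedSpace ℝ E] [NormedAddCommGroup F]
  [NormedSpace ℝ F]

/-- A smooth germ on a finite-dimensional space extends to a globally defined smooth function. -/
theorem exists_contDiff_eventuallyEq [FiniteDimensional ℝ E] {f : E → F} {s : Set E} {x : E}
    (hs : s ∈ 𝓝 x) (hf : ContDiffOn ℝ ∞ f s) : ∃ g : E → F, ContDiff ℝ ∞ g ∧ g =ᶠ[𝓝 x] f := by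
  obtain ⟨r, hr, hrs⟩ := Metric.nhds_basis_closedBall.mem_iff.1 (interior_mem_nhds.2 hs)
  let χ : ContDiffBump x := ⟨r / 2, r, by positivity, by linarith⟩
  refine ⟨fun y => χ y • f y, ?_, ?_⟩
  · rw [contDiff_iff_contDiffAt]
    intro y
    by_cases hy : y ∈ Metric.closedBall x r
    · exact χ.contDiff.contDiffAt.smul (hf.contDiffAt (mem_interior_iff_mem_nhds.1 (hrs hy)))
    · have : (fun y => χ y • f y) =ᶠ[𝓝 y] fun _ => 0 := by
        filter_upwards [Metric.isClosed_closedBall.isOpen_compl.mem_nhds hy] with z hz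
        rw [χ.zero_of_le_dist (le_of_lt (by simpa using hz)), zero_smul]
      exact contDiffAt_const.congr_of_eventuallyEq this
  · filter_upwards [χ.eventuallyEq_one] with y hy
    simp [hy]

open Classical in
/-- The difference quotient `(f (x + t v) - f x) / t`, continued by the directional derivative of
`f` at `t = 0`. -/
def diffQuot (f : E → F) (x v : E) (t : ℝ) : F :=
  if t = 0 then fderiv ℝ f x v else t⁻¹ • (f (x + t • v) - f x)

theorem diffQuot_zero (f : E → F) (x v : E) : diffQuot f x v 0 = fderiv ℝ f x v := if_pos rfl

theorem diffQuot_of_ne (f : E → F) (x v : E) {t : ℝ} (ht : t ≠ 0) :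
    diffQuot f x v t = t⁻¹ • (f (x + t • v) - f x) := if_neg ht

/-- Hadamard's formula, which is what makes the difference quotient smooth at `t = 0`. -/
theorem diffQuot_eq_integral [CompleteSpace F] {f : E → F} (hf : ContDiff ℝ ∞ f) (x v : E)
    (t : ℝ) : diffQuot f x v t = ∫ s in (0 : ℝ)..1, fderiv ℝ f (x + s • t • v) v := by
  have hd := contDiff_infty_iff_fderiv.1 hf
  by_cases ht : t = 0
  · simp [ht, diffQuot_zero]
  rw [diffQuot_of_ne _ _ _ ht]
  have h1 : ∀ s : ℝ, HasDerivAt (fun s : ℝ => t⁻¹ • f (x + s • t • v))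
      (fderiv ℝ f (x + s • t • v) v) s := by
    intro s
    have h2 : HasDerivAt (fun s : ℝ => x + s • t • v) (t • v) s := by
      simpa using ((hasDerivAt_id s).smul_const (t • v)).const_add x
    have h3 := ((hd.1 (x + s • t • v)).hasFDerivAt.comp_hasDerivAt s h2).const_smul t⁻¹
    simpa [smul_smul, inv_mul_cancel₀ ht, Function.comp_def, Pi.smul_def] using h3
  rw [intervalIntegral.integral_eq_sub_of_hasDerivAt (fun s _ => h1 s)]
  · simp [smul_sub]
  · have := hd.2.continuous
    exact Continuous.intervalIntegrable (by fun_prop) _ _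

variable (F) in
/-- Integration over `[0, 1]` as a bounded operator on continuous paths. -/
def pathIntegral : C(Icc (0 : ℝ) 1, F) →L[ℝ] F :=
  LinearMap.mkContinuous
    { toFun := fun γ => ∫ s in (0 : ℝ)..1, Set.IccExtend zero_le_one γ s
      map_add' := fun γ η => by
        rw [← intervalIntegral.integral_add]
        · rfl
        · exact (γ.continuous.Icc_extend' (h := zero_le_one)).intervalIntegrable _ _
        · exact (η.continuous.Icc_extend' (h := zero_le_one)).intervalIntegrable _ _
      map_smul' := fun c γ => by
        rw [RingHom.id_apply, ← intervalIntegral.integral_smul]; rfl } 1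
    (fun γ => by
      have := intervalIntegral.norm_integral_le_of_norm_le_const (a := 0) (b := 1)
        (f := Set.IccExtend zero_le_one γ) (C := ‖γ‖) (fun s _ => γ.norm_coe_le_norm _)
      simpa using this)

/-- By Hadamard's formula the difference quotient is a composition of bounded operators with the
superposition operator of the derivative of `f`. -/
theorem contDiff_diffQuot [CompleteSpace F] {f : E → F} (hf : ContDiff ℝ ∞ f) :
    ContDiff ℝ ∞ (fun q : (E × E) × ℝ => diffQuot f q.1.1 q.1.2 q.2) := by
  have hd := contDiff_infty_iff_fderiv.1 hf
  let cst : E →L[ℝ] C(Icc (0 : ℝ) 1, E) := ContinuousLinearMap.const ℝ (Icc (0 : ℝ) 1)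
  -- the segment from `x` to `x + t v`, as a path depending polynomially on `((x, v), t)`
  let path : (E × E) × ℝ → C(Icc (0 : ℝ) 1, E) := fun q => cst q.1.1 +
    (pointwiseApply (Icc (0 : ℝ) 1) E E
      ⟨fun s => (s : ℝ) • ContinuousLinearMap.id ℝ E, by fun_prop⟩)
      (cst (q.2 • q.1.2))
  have hpath : ContDiff ℝ ∞ path := by
    refine (cst.contDiff.comp (by fun_prop)).add ?_
    exact (ContinuousLinearMap.contDiff _).comp (cst.contDiff.comp (by fun_prop))
  have key : (fun q : (E × E) × ℝ => diffQuot f q.1.1 q.1.2 q.2) = fun q =>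
      pathIntegral (E →L[ℝ] F) ((⟨fderiv ℝ f, hd.2.continuous⟩ : C(E, E →L[ℝ] F)).comp (path q))
        q.1.2 := by
    funext q
    rw [diffQuot_eq_integral hf]
    change _ = (∫ s in (0 : ℝ)..1, Set.IccExtend zero_le_one
      (((⟨fderiv ℝ f, hd.2.continuous⟩ : C(E, E →L[ℝ] F)).comp (path q))) s) q.1.2
    rw [ContinuousLinearMap.intervalIntegral_apply]
    · refine intervalIntegral.integral_congr fun s hs => ?_
      rw [Set.uIcc_of_le zero_le_one] at hs
      simp only [Set.IccExtend_of_mem _ _ hs]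
      simp [path, cst, smul_comm s q.2]
    · exact (ContinuousMap.continuous _).Icc_extend'.intervalIntegrable _ _
  rw [key]
  refine ContDiff.clm_apply ?_ (by fun_prop)
  exact (pathIntegral _).contDiff.comp ((contDiff_postcomp hd.2).comp hpath)

/-- The difference quotient of a smooth function is smooth in all variables, also at `t = 0`. -/
theorem contDiffAt_diffQuot [FiniteDimensional ℝ E] [CompleteSpace F] {f : E → F} {s : Set E}
    (hs : IsOpen s) (hf : ContDiffOn ℝ ∞ f s) {x v : E} {t : ℝ} (hx : x ∈ s)
    (hxt : x + t • v ∈ s) :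
    ContDiffAt ℝ ∞ (fun q : (E × E) × ℝ => diffQuot f q.1.1 q.1.2 q.2) ((x, v), t) := by
  by_cases ht : t = 0
  · -- near `t = 0` only the germ of `f` at `x` matters, so that `f` may be assumed to be global
    subst ht
    obtain ⟨g, hg, hgf⟩ := exists_contDiff_eventuallyEq (hs.mem_nhds hx) hf
    refine (contDiff_diffQuot hg).contDiffAt.congr_of_eventuallyEq ?_
    have hgf' := hgf.eventuallyEq_nhds
    have c1 : ContinuousAt (fun q : (E × E) × ℝ => q.1.1) ((x, v), 0) := by fun_prop
    have c2 : ContinuousAt (fun q : (E × E) × ℝ => q.1.1 + q.2 • q.1.2) ((x, v), 0) := by fun_prop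
    have e1 := c1.eventually hgf'
    have e2 : ∀ᶠ q : (E × E) × ℝ in 𝓝 ((x, v), 0), g =ᶠ[𝓝 (q.1.1 + q.2 • q.1.2)] f := by
      refine c2.eventually (p := fun y => g =ᶠ[𝓝 y] f) ?_
      simp only [zero_smul, add_zero]
      exact hgf'
    filter_upwards [e1, e2] with q h1 h2
    unfold diffQuot
    rw [h1.fderiv_eq, h1.eq_of_nhds, h2.eq_of_nhds]
  · have hne : ∀ᶠ q : (E × E) × ℝ in 𝓝 ((x, v), t), q.2 ≠ 0 :=
      continuousAt_snd.eventually_ne ht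
    have : ContDiffAt ℝ ∞ (fun q : (E × E) × ℝ => q.2⁻¹ • (f (q.1.1 + q.2 • q.1.2) - f q.1.1))
        ((x, v), t) := by
      have h1 := (hf.contDiffAt (hs.mem_nhds hx)).comp ((x, v), t)
        (g := f) (f := fun q : (E × E) × ℝ => q.1.1) (by fun_prop)
      have h2 := ContDiffAt.comp ((x, v), t) (g := f)
        (f := fun q : (E × E) × ℝ => q.1.1 + q.2 • q.1.2)
        (hf.contDiffAt (hs.mem_nhds hxt)) (by fun_prop)
      exact (contDiffAt_snd.inv ht).smul (h2.sub h1)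
    refine this.congr_of_eventuallyEq ?_
    filter_upwards [hne] with q hq
    exact diffQuot_of_ne _ _ _ hq

end Slope

/-! ### Inverse functions depending on a parameter in `[0, 1]` -/

section ParametricInverse

variable {E : Type} [NormedAddCommGroup E] [NormedSpace ℝ E]

variable (E) in
/-- The model of the coordinate space `(E × E) × [0, 1]`. -/
abbrev slabModel := (𝓘(ℝ, E).prod 𝓘(ℝ, E)).prod (𝓡∂ 1)

/-- The inclusion of `(E × E) × [0, 1]` in `(E × E) × ℝ`. -/
def slabIncl (q : (E × E) × Icc (0 : ℝ) 1) : (E × E) × ℝ := (q.1, (q.2 : ℝ))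

theorem contMDiff_slabIncl :
    ContMDiff (slabModel E) 𝓘(ℝ, (E × E) × ℝ) ∞ (slabIncl (E := E)) := by
  have h1 : ContMDiff (slabModel E) 𝓘(ℝ, E) ∞
    (fun q : (E × E) × Icc (0 : ℝ) 1 => q.1.1) := contMDiff_fst.comp contMDiff_fst
  have h2 : ContMDiff (slabModel E) 𝓘(ℝ, E) ∞
    (fun q : (E × E) × Icc (0 : ℝ) 1 => q.1.2) := contMDiff_snd.comp contMDiff_fst
  have h3 : ContMDiff (slabModel E) 𝓘(ℝ, ℝ) ∞
    (fun q : (E × E) × Icc (0 : ℝ) 1 => (q.2 : ℝ)) := contMDiff_subtypeVal_Icc.comp contMDiff_snd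
  exact (h1.prodMk_space h2).prodMk_space h3

theorem continuous_slabIncl : Continuous (slabIncl (E := E)) := contMDiff_slabIncl.continuous

theorem ContDiffAt.contMDiffAt_slab {G : Type*} [NormedAddCommGroup G] [NormedSpace ℝ G]
    {f : (E × E) × ℝ → G} {q : (E × E) × Icc (0 : ℝ) 1} (hf : ContDiffAt ℝ ∞ f (slabIncl q)) :
    ContMDiffAt (slabModel E) 𝓘(ℝ, G) ∞ (fun q : (E × E) × Icc (0 : ℝ) 1 => f (slabIncl q)) q :=
  ContMDiffAt.comp (I' := 𝓘(ℝ, (E × E) × ℝ)) q hf.contMDiffAt contMDiff_slabIncl.contMDiffAt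

theorem ContMDiffAt.slab_mk {H' E' X : Type*} [NormedAddCommGroup E'] [NormedSpace ℝ E']
    [TopologicalSpace H'] {I' : ModelWithCorners ℝ E' H'} [TopologicalSpace X] [ChartedSpace H' X]
    {f : X → E × E} {g : X → Icc (0 : ℝ) 1} {x : X}
    (hf : ContMDiffAt I' 𝓘(ℝ, E × E) ∞ f x) (hg : ContMDiffAt I' (𝓡∂ 1) ∞ g x) :
    ContMDiffAt I' (slabModel E) ∞ (fun y => (f y, g y)) x := by
  refine ContMDiffAt.prodMk ?_ hg
  have h1 : ContMDiffAt I' 𝓘(ℝ, E) ∞ (fun y => (f y).1) x :=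
    (contDiff_fst.contMDiff (f := fun z : E × E => z.1)).contMDiffAt.comp x hf
  have h2 : ContMDiffAt I' 𝓘(ℝ, E) ∞ (fun y => (f y).2) x :=
    (contDiff_snd.contMDiff (f := fun z : E × E => z.2)).contMDiffAt.comp x hf
  exact h1.prodMk h2

/-- A smooth family of maps, parametrized by `[0, 1]`, whose member at `t₀` has an invertible
derivative, defines a local diffeomorphism preserving the parameter. The boundary causes no
difficulty because the family is defined for parameters outside of `[0, 1]` as well. -/
theorem isLocalDiffeomorphAt_slab [CompleteSpace E] {k : (E × E) × ℝ → E × E}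
    {s : Set ((E × E) × ℝ)} (hs : IsOpen s) (hk : ContDiffOn ℝ ∞ k s)
    {q₀ : (E × E) × Icc (0 : ℝ) 1} (hq₀ : slabIncl q₀ ∈ s) (A : (E × E) ≃L[ℝ] (E × E))
    (hA : HasFDerivAt (fun z => k (z, (q₀.2 : ℝ))) (A : (E × E) →L[ℝ] (E × E)) q₀.1) :
    IsLocalDiffeomorphAt (slabModel E) (slabModel E) ∞
      (fun q : (E × E) × Icc (0 : ℝ) 1 => (k (slabIncl q), q.2)) q₀ := by
  let κ : (E × E) × ℝ → (E × E) × ℝ := fun p => (k p, p.2)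
  have hκ : ContDiffOn ℝ ∞ κ s := hk.prodMk contDiffOn_snd
  have hk0 : ContDiffAt ℝ ∞ k (slabIncl q₀) := hk.contDiffAt (hs.mem_nhds hq₀)
  have hkd : HasFDerivAt k (fderiv ℝ k (slabIncl q₀)) (slabIncl q₀) :=
    (hk0.differentiableAt (by simp)).hasFDerivAt
  set D := fderiv ℝ k (slabIncl q₀) with hD
  have hDA : ∀ a, D (a, 0) = A a := by
    intro a
    have h1 : HasFDerivAt (fun z : E × E => (z, (q₀.2 : ℝ)))
      (ContinuousLinearMap.inl ℝ (E × E) ℝ) q₀.1 := hasFDerivAt_prodMk_left _ _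
    have h2 := HasFDerivAt.comp (g := k) q₀.1 hkd h1
    have h3 := h2.unique hA
    exact congrArg (fun L => L a) h3
  have hD' : ∀ a τ, D (a, τ) = A a + D (0, τ) := by
    intro a τ
    rw [← hDA, ← map_add]
    simp
  -- the derivative of `κ` is block triangular with diagonal blocks `A` and `1`
  let B : ((E × E) × ℝ) ≃L[ℝ] ((E × E) × ℝ) := ContinuousLinearEquiv.equivOfInverse
    (D.prod (ContinuousLinearMap.snd ℝ (E × E) ℝ))
    (((A.symm : (E × E) →L[ℝ] (E × E)).comp (ContinuousLinearMap.fst ℝ (E × E) ℝ -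
      D.comp ((ContinuousLinearMap.inr ℝ (E × E) ℝ).comp
        (ContinuousLinearMap.snd ℝ (E × E) ℝ)))).prod (ContinuousLinearMap.snd ℝ (E × E) ℝ))
    (fun p => by
      refine Prod.ext ?_ rfl
      change A.symm (D (p.1, p.2) - D (0, p.2)) = p.1
      rw [hD', add_sub_cancel_right, A.symm_apply_apply])
    (fun p => by
      refine Prod.ext ?_ rfl
      change D (A.symm (p.1 - D (0, p.2)), p.2) = p.1
      rw [hD', A.apply_symm_apply, sub_add_cancel])
  have hκ0 : ContDiffAt ℝ ∞ κ (slabIncl q₀) := hκ.contDiffAt (hs.mem_nhds hq₀)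
  have hκd : HasFDerivAt κ (B : ((E × E) × ℝ) →L[ℝ] ((E × E) × ℝ)) (slabIncl q₀) :=
    hkd.prodMk hasFDerivAt_snd
  let Ψ := hκ0.toOpenPartialHomeomorph κ hκd (by simp)
  have hΨ : ∀ p, Ψ p = κ p := fun p => rfl
  have hΨ0 : slabIncl q₀ ∈ Ψ.source := hκ0.mem_toOpenPartialHomeomorph_source hκd (by simp)
  have hinv : ∀ᶠ p in 𝓝 (slabIncl q₀),
      fderiv ℝ κ p ∈ Set.range ((↑) : (((E × E) × ℝ) ≃L[ℝ] ((E × E) × ℝ)) → _) := by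
    have hc : ContinuousAt (fderiv ℝ κ) (slabIncl q₀) :=
      (hκ0.fderiv_right (m := 0) (by simp)).continuousAt
    have := hc.tendsto
    rw [hκd.fderiv] at this
    exact this.eventually (ContinuousLinearEquiv.nhds B)
  -- the inverse of `κ` is smooth at the images of the points with invertible derivative
  obtain ⟨O, hO, hOo, hO0⟩ := eventually_nhds_iff.1
    (hinv.and ((hs.eventually_mem hq₀).and (Ψ.open_source.eventually_mem hΨ0)))
  have hT : IsOpen (Ψ '' O) :=
    Ψ.isOpen_image_of_subset_source hOo (fun p hp => (hO p hp).2.2)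
  have hsymm : ∀ p ∈ Ψ '' O, ContDiffAt ℝ ∞ Ψ.symm p := by
    rintro _ ⟨p, hp, rfl⟩
    obtain ⟨⟨e, he⟩, hps, hpΨ⟩ := hO p hp
    have h1 : ContDiffAt ℝ ∞ κ p := hκ.contDiffAt (hs.mem_nhds hps)
    refine Ψ.contDiffAt_symm (f₀' := e) (Ψ.map_source hpΨ) ?_ ?_
    · rw [Ψ.left_inv hpΨ, he]
      exact (h1.differentiableAt (by simp)).hasFDerivAt
    · rw [Ψ.left_inv hpΨ]
      exact h1
  have hsnd : ∀ p ∈ Ψ '' O, (Ψ.symm p).2 = p.2 := by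
    rintro _ ⟨p, hp, rfl⟩
    rw [Ψ.left_inv (hO p hp).2.2]
    rfl
  have hmem : ∀ p ∈ Ψ '' O, Ψ.symm p ∈ O := by
    rintro _ ⟨p, hp, rfl⟩
    rwa [Ψ.left_inv (hO p hp).2.2]
  refine ⟨{ toFun := fun q => (k (slabIncl q), q.2)
            invFun := fun q => ((Ψ.symm (slabIncl q)).1, q.2)
            source := slabIncl ⁻¹' O
            target := slabIncl ⁻¹' (Ψ '' O)
            map_source' := fun q hq => ⟨slabIncl q, hq, rfl⟩
            map_target' := fun q hq => ?_
            left_inv' := fun q hq => ?_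
            right_inv' := fun q hq => ?_
            open_source := hOo.preimage continuous_slabIncl
            open_target := hT.preimage continuous_slabIncl
            contMDiffOn_toFun := fun q hq => ?_
            contMDiffOn_invFun := fun q hq => ?_ }, hO0, fun q _ => rfl⟩
  · have h1 : slabIncl ((Ψ.symm (slabIncl q)).1, q.2) = Ψ.symm (slabIncl q) :=
      Prod.ext rfl (hsnd _ hq).symm
    change slabIncl ((Ψ.symm (slabIncl q)).1, q.2) ∈ O
    rw [h1]
    exact hmem _ hq
  · refine Prod.ext ?_ rfl
    change (Ψ.symm (Ψ (slabIncl q))).1 = q.1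
    rw [Ψ.left_inv (hO _ hq).2.2]
    rfl
  · refine Prod.ext ?_ rfl
    have h1 : slabIncl ((Ψ.symm (slabIncl q)).1, q.2) = Ψ.symm (slabIncl q) :=
      Prod.ext rfl (hsnd _ hq).symm
    change (Ψ (slabIncl ((Ψ.symm (slabIncl q)).1, q.2))).1 = q.1
    obtain ⟨p, hp, hpq⟩ := hq
    rw [h1, Ψ.right_inv (by rw [← hpq]; exact Ψ.map_source (hO p hp).2.2)]
    rfl
  · refine (ContMDiffAt.slab_mk ?_ contMDiffAt_snd).contMDiffWithinAt
    exact (hk.contDiffAt (hs.mem_nhds (hO _ hq).2.1)).contMDiffAt_slab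
  · refine (ContMDiffAt.slab_mk ?_ contMDiffAt_snd).contMDiffWithinAt
    exact ((hsymm _ hq).fst).contMDiffAt_slab

end ParametricInverse

/-! ### Gluing manifolds -/

section Gluing

variable {E H : Type*} [NormedAddCommGroup E] [NormedSpace ℝ E] [TopologicalSpace H]
  (J : ModelWithCorners ℝ E H) {N X ι : Type*} [TopologicalSpace N] [ChartedSpace H N]

/-- The topology on `X` in which `U` is open when all its preimages under the parametrizations
`g i`, defined on open subsets of `N`, are open. -/
@[reducible] def gluedTopology (g : ι → PartialEquiv N X) (hs : ∀ i, IsOpen (g i).source) :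
    TopologicalSpace X where
  IsOpen U := ∀ i, IsOpen ((g i).source ∩ g i ⁻¹' U)
  isOpen_univ i := by simpa using hs i
  isOpen_inter U V hU hV i := by
    have : (g i).source ∩ g i ⁻¹' (U ∩ V) =
        ((g i).source ∩ g i ⁻¹' U) ∩ ((g i).source ∩ g i ⁻¹' V) := by ext; simp; tauto
    rw [this]
    exact (hU i).inter (hV i)
  isOpen_sUnion S hS i := by
    have : (g i).source ∩ g i ⁻¹' (⋃₀ S) = ⋃ U ∈ S, (g i).source ∩ g i ⁻¹' U := by
      ext; simp
    rw [this]
    exact isOpen_biUnion fun U hU => hS U hU i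

/-- With continuous transitions, the parametrizations are homeomorphisms onto open subsets for the
glued topology. -/
def gluedHomeomorph (g : ι → PartialEquiv N X) (hs : ∀ i, IsOpen (g i).source)
    (ho : ∀ i j, IsOpen ((g i).source ∩ g i ⁻¹' (g j).target))
    (hc : ∀ i j, ContinuousOn (fun a => (g j).symm (g i a))
      ((g i).source ∩ g i ⁻¹' (g j).target)) (i : ι) :
    @OpenPartialHomeomorph N X _ (gluedTopology g hs) :=
  letI := gluedTopology g hs
  { toPartialEquiv := g i
    open_source := hs i
    open_target := fun j => ho j i
    continuousOn_toFun := (continuousOn_open_iff (hs i)).2 fun U hU => hU i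
    continuousOn_invFun := by
      have ht : IsOpen (g i).target := fun j => ho j i
      refine (continuousOn_open_iff ht).2 fun U hU j => ?_
      have := (continuousOn_open_iff (ho j i)).1 (hc j i) U hU
      convert this using 1
      ext a
      simp [and_assoc] }

variable {J}

section Charts

variable [TopologicalSpace X] (f : ι → OpenPartialHomeomorph N X) (idx : X → ι)
  (hidx : ∀ x, x ∈ (f (idx x)).target)

/-- The charts of `X` obtained from the charts of `N` through a covering family of
parametrizations. -/
@[reducible] def chartedSpaceOfCover : ChartedSpace H X where
  atlas := {e | ∃ i z, e = (f i).symm.trans (chartAt H z)}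
  chartAt x := (f (idx x)).symm.trans (chartAt H ((f (idx x)).symm x))
  mem_chart_source x := by simp [hidx]
  chart_mem_atlas x := ⟨_, _, rfl⟩

variable [IsManifold J ∞ N]

theorem mem_contDiffGroupoid_of_contMDiffOn {e : OpenPartialHomeomorph H H}
    (h1 : ContMDiffOn J J ∞ e e.source) (h2 : ContMDiffOn J J ∞ e.symm e.target) :
    e ∈ contDiffGroupoid ∞ J := by
  have h := e.mem_maximalAtlas_of_contMDiffOn h1 h2
  have h0 := (contDiffGroupoid ∞ J).id_mem_maximalAtlas
  have := (contDiffGroupoid ∞ J).compatible_of_mem_maximalAtlas h0 h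
  simpa using this

/-- If the transitions between the parametrizations are smooth, then so are the coordinate
changes. -/
theorem isManifold_of_cover
    (hf : ∀ i j, ContMDiffOn J J ∞ (fun a => (f j).symm (f i a))
      ((f i).source ∩ f i ⁻¹' (f j).target)) :
    letI := chartedSpaceOfCover (H := H) f idx hidx
    IsManifold J ∞ X := by
  let _ := chartedSpaceOfCover (H := H) f idx hidx
  have key : ∀ i j (z w : N), ContMDiffOn J J ∞
      (((f i).symm.trans (chartAt H z)).symm.trans ((f j).symm.trans (chartAt H w)))
      (((f i).symm.trans (chartAt H z)).symm.trans ((f j).symm.trans (chartAt H w))).source := by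
    intro i j z w
    have h1 : ContMDiffOn J J ∞ (chartAt H z).symm (chartAt H z).target := contMDiffOn_chart_symm
    have h2 : ContMDiffOn J J ∞ (chartAt H w) (chartAt H w).source := contMDiffOn_chart
    have h3 := h2.comp' ((hf i j).comp' h1)
    refine h3.mono fun a ha => ?_
    simp only [OpenPartialHomeomorph.trans_source, OpenPartialHomeomorph.symm_source,
      OpenPartialHomeomorph.trans_target, Set.mem_inter_iff, Set.mem_preimage] at ha ⊢
    simp at ha ⊢
    tauto
  refine { compatible := ?_ }
  rintro _ _ ⟨i, z, rfl⟩ ⟨j, w, rfl⟩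
  refine mem_contDiffGroupoid_of_contMDiffOn (key i j z w) ?_
  have := key j i w z
  simpa using this

variable (hf : ∀ i j, ContMDiffOn J J ∞ (fun a => (f j).symm (f i a))
      ((f i).source ∩ f i ⁻¹' (f j).target))

/-- The parametrizations are diffeomorphisms onto open subsets for the glued smooth structure. -/
def coverDiffeomorph (i : ι) :
    letI := chartedSpaceOfCover (H := H) f idx hidx
    PartialDiffeomorph J J N X ∞ :=
  letI := chartedSpaceOfCover (H := H) f idx hidx
  haveI : IsManifold J ∞ X := isManifold_of_cover f idx hidx hf
  have hmem : ∀ z : N, (f i).symm.trans (chartAt H z) ∈ IsManifold.maximalAtlas J ∞ X :=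
    fun z => IsManifold.subset_maximalAtlas ⟨i, z, rfl⟩
  { toPartialEquiv := (f i).toPartialEquiv
    open_source := (f i).open_source
    open_target := (f i).open_target
    contMDiffOn_toFun := by
      intro a ha
      have h1 := contMDiffAt_of_mem_maximalAtlas
        (IsManifold.chart_mem_maximalAtlas (I := J) (n := ∞) a) (mem_chart_source H a)
      have h2 : ContMDiffAt J J ∞ ((f i).symm.trans (chartAt H a)).symm (chartAt H a a) :=
        contMDiffAt_symm_of_mem_maximalAtlas (hmem a) (by simp [ha])
      refine ((h2.comp a h1).congr_of_eventuallyEq ?_).contMDiffWithinAt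
      filter_upwards [(chartAt H a).open_source.mem_nhds (mem_chart_source H a)] with b hb
      simp [(chartAt H a).left_inv hb]
    contMDiffOn_invFun := by
      intro x hx
      set a := (f i).symm x with ha
      have hx' : x ∈ ((f i).symm.trans (chartAt H a)).source := by
        simpa [← ha] using hx
      have h1 := contMDiffAt_of_mem_maximalAtlas (hmem a) hx'
      have h2 : ContMDiffAt J J ∞ (chartAt H a).symm (((f i).symm.trans (chartAt H a)) x) :=
        contMDiffAt_symm_of_mem_maximalAtlas (IsManifold.chart_mem_maximalAtlas a)
          (by simp [← ha])
      refine ((h2.comp x h1).congr_of_eventuallyEq ?_).contMDiffWithinAt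
      filter_upwards [((f i).symm.trans (chartAt H a)).open_source.mem_nhds hx'] with y hy
      simp only [OpenPartialHomeomorph.trans_source, OpenPartialHomeomorph.symm_source,
        Set.mem_inter_iff, Set.mem_preimage] at hy
      simp [(chartAt H a).left_inv hy.2] }

end Charts

end Gluing

/-! ### Local diffeomorphisms -/

section LocalDiffeo

variable {E₁ H₁ E₂ H₂ E₃ H₃ : Type*}
  [NormedAddCommGroup E₁] [NormedSpace ℝ E₁] [TopologicalSpace H₁]
  [NormedAddCommGroup E₂] [NormedSpace ℝ E₂] [TopologicalSpace H₂]
  [NormedAddCommGroup E₃] [NormedSpace ℝ E₃] [TopologicalSpace H₃]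
  {I₁ : ModelWithCorners ℝ E₁ H₁} {I₂ : ModelWithCorners ℝ E₂ H₂} {I₃ : ModelWithCorners ℝ E₃ H₃}
  {M₁ M₂ M₃ : Type*} [TopologicalSpace M₁] [ChartedSpace H₁ M₁] [TopologicalSpace M₂]
  [ChartedSpace H₂ M₂] [TopologicalSpace M₃] [ChartedSpace H₃ M₃]

/-- Smoothness can be tested after precomposition with a local diffeomorphism. -/
theorem IsLocalDiffeomorphAt.contMDiffAt_of_comp {f : M₁ → M₂} {g : M₂ → M₃} {a : M₁}
    (hf : IsLocalDiffeomorphAt I₁ I₂ ∞ f a) (hg : ContMDiffAt I₁ I₃ ∞ (g ∘ f) a) :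
    ContMDiffAt I₂ I₃ ∞ g (f a) := by
  obtain ⟨Φ, ha, hΦ⟩ := hf
  have hfa : f a = Φ a := hΦ ha
  have h1 : ContMDiffAt I₂ I₁ ∞ Φ.symm (Φ a) :=
    Φ.contMDiffOn_invFun.contMDiffAt (Φ.open_target.mem_nhds (Φ.map_source' ha))
  have h0 : Φ.symm (Φ a) = a := Φ.left_inv' ha
  rw [hfa]
  refine (ContMDiffAt.comp (Φ a) (g := g ∘ f) (by rw [h0]; exact hg) h1).congr_of_eventuallyEq ?_
  filter_upwards [Φ.open_target.mem_nhds (Φ.map_source' ha)] with y hy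
  have h2 : f (Φ.symm y) = y := (hΦ (Φ.map_target' hy)).trans (Φ.right_inv' hy)
  exact congrArg g h2.symm

theorem IsLocalDiffeomorphAt.congr_of_eventuallyEq {f g : M₁ → M₂} {a : M₁}
    (hf : IsLocalDiffeomorphAt I₁ I₂ ∞ f a) (h : g =ᶠ[𝓝 a] f) :
    IsLocalDiffeomorphAt I₁ I₂ ∞ g a := by
  obtain ⟨Φ, ha, hΦ⟩ := hf
  obtain ⟨O, hO, hOo, haO⟩ := eventually_nhds_iff.1 h
  let e := Φ.toOpenPartialHomeomorph.restrOpen O hOo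
  refine ⟨{ toPartialEquiv := e.toPartialEquiv
            open_source := e.open_source
            open_target := e.open_target
            contMDiffOn_toFun := Φ.contMDiffOn_toFun.mono fun x hx => hx.1
            contMDiffOn_invFun := Φ.contMDiffOn_invFun.mono fun x hx => hx.1 }, ⟨ha, haO⟩, ?_⟩
  intro x hx
  rw [hO x hx.2]
  exact hΦ hx.1

/-- If `f` and `g ∘ f` are local diffeomorphisms, then so is `g`. -/
theorem IsLocalDiffeomorphAt.of_comp {f : M₁ → M₂} {g : M₂ → M₃} {a : M₁}
    (hf : IsLocalDiffeomorphAt I₁ I₂ ∞ f a) (hg : IsLocalDiffeomorphAt I₁ I₃ ∞ (g ∘ f) a) :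
    IsLocalDiffeomorphAt I₂ I₃ ∞ g (f a) := by
  obtain ⟨Φ, ha, hΦ⟩ := hf
  have hfa : f a = Φ a := hΦ ha
  have h1 : IsLocalDiffeomorphAt I₂ I₁ ∞ Φ.symm (Φ a) :=
    ⟨Φ.symm, Φ.map_source' ha, fun _ _ => rfl⟩
  have h0 : Φ.symm (Φ a) = a := Φ.left_inv' ha
  rw [hfa]
  refine (IsLocalDiffeomorphAt.comp I₃ M₃ h1 (g := g ∘ f)
    (by rw [h0]; exact hg)).congr_of_eventuallyEq ?_
  filter_upwards [Φ.open_target.mem_nhds (Φ.map_source' ha)] with y hy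
  have h2 : f (Φ.symm y) = y := (hΦ (Φ.map_target' hy)).trans (Φ.right_inv' hy)
  exact congrArg g h2.symm

end LocalDiffeo

/-! ### Coordinate frames -/

section Frames

variable {n : ℕ} {M : Type*} [TopologicalSpace M] [ChartedSpace (EuclideanSpace ℝ (Fin n)) M]

/-- The part of the image of the chart around `p` which lies in the domain of the chart
around `q`. -/
def overlap (n : ℕ) {M : Type*} [TopologicalSpace M] [ChartedSpace (EuclideanSpace ℝ (Fin n)) M]
    (p q : M) : Set (EuclideanSpace ℝ (Fin n)) :=
  (extChartAt (𝓡 n) p).target ∩ (extChartAt (𝓡 n) p).symm ⁻¹' (extChartAt (𝓡 n) q).source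

/-- The coordinate change from the chart around `p` to the chart around `q`. -/
def coordChange (n : ℕ) {M : Type*} [TopologicalSpace M] [ChartedSpace (EuclideanSpace ℝ (Fin n)) M]
    (p q : M) (x : EuclideanSpace ℝ (Fin n)) : EuclideanSpace ℝ (Fin n) :=
  extChartAt (𝓡 n) q ((extChartAt (𝓡 n) p).symm x)

theorem isOpen_overlap (p q : M) : IsOpen (overlap n p q) :=
  (continuousOn_extChartAt_symm p).isOpen_inter_preimage (isOpen_extChartAt_target p)
    (isOpen_extChartAt_source q)

theorem coordChange_mem_target {p q : M} {x : EuclideanSpace ℝ (Fin n)} (hx : x ∈ overlap n p q) :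
    coordChange n p q x ∈ (extChartAt (𝓡 n) q).target :=
  (extChartAt (𝓡 n) q).map_source hx.2

theorem symm_coordChange {p q : M} {x : EuclideanSpace ℝ (Fin n)} (hx : x ∈ overlap n p q) :
    (extChartAt (𝓡 n) q).symm (coordChange n p q x) = (extChartAt (𝓡 n) p).symm x :=
  (extChartAt (𝓡 n) q).left_inv hx.2

variable [IsManifold (𝓡 n) ∞ M]

theorem contDiffOn_coordChange (p q : M) : ContDiffOn ℝ ∞ (coordChange n p q) (overlap n p q) := by
  rw [← contMDiffOn_iff_contDiffOn]
  exact (contMDiffOn_extChartAt (n := ∞)).comp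
    ((contMDiffOn_extChartAt_symm p).mono Set.inter_subset_left)
    (fun x hx => by simpa using hx.2)

/-- The coordinates of tangent vectors in the chart around `p`: the derivative of the chart. -/
def chartCoframe (p x : M) : TangentSpace (𝓡 n) x →L[ℝ] EuclideanSpace ℝ (Fin n) :=
  mfderiv (𝓡 n) 𝓘(ℝ, EuclideanSpace ℝ (Fin n)) (extChartAt (𝓡 n) p) x

theorem mdifferentiableAt_extChartAt_symm' {p : M} {y : EuclideanSpace ℝ (Fin n)}
    (hy : y ∈ (extChartAt (𝓡 n) p).target) :
    MDifferentiableAt 𝓘(ℝ, EuclideanSpace ℝ (Fin n)) (𝓡 n) (extChartAt (𝓡 n) p).symm y :=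
  (((contMDiffOn_extChartAt_symm (n := ∞) p).contMDiffAt
    ((isOpen_extChartAt_target p).mem_nhds hy)).mdifferentiableAt (by simp))

theorem mdifferentiableAt_extChartAt' {p x : M} (hx : x ∈ (extChartAt (𝓡 n) p).source) :
    MDifferentiableAt (𝓡 n) 𝓘(ℝ, EuclideanSpace ℝ (Fin n)) (extChartAt (𝓡 n) p) x :=
  mdifferentiableAt_extChartAt (by simpa using hx)

theorem chartCoframe_chartFrame {p q : M} {x : EuclideanSpace ℝ (Fin n)} (hx : x ∈ overlap n p q)
    (v : EuclideanSpace ℝ (Fin n)) :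
    chartCoframe q _ (chartFrame p x v) = fderiv ℝ (coordChange n p q) x v := by
  have h := mfderiv_comp x (mdifferentiableAt_extChartAt' hx.2)
    (mdifferentiableAt_extChartAt_symm' hx.1)
  have h' := congrArg (fun L : EuclideanSpace ℝ (Fin n) →L[ℝ] EuclideanSpace ℝ (Fin n) => L v) h
  rw [← mfderiv_eq_fderiv]
  exact h'.symm

theorem chartCoframe_chartFrame_self {p : M} {x : EuclideanSpace ℝ (Fin n)}
    (hx : x ∈ (extChartAt (𝓡 n) p).target) (v : EuclideanSpace ℝ (Fin n)) :
    chartCoframe p _ (chartFrame p x v) = v := by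
  have hx' : x ∈ overlap n p p := ⟨hx, (extChartAt (𝓡 n) p).map_target hx⟩
  rw [chartCoframe_chartFrame hx']
  have : coordChange n p p =ᶠ[𝓝 x] id := by
    filter_upwards [(isOpen_extChartAt_target p).mem_nhds hx] with y hy
    exact (extChartAt (𝓡 n) p).right_inv hy
  rw [this.fderiv_eq, fderiv_id]
  rfl

theorem chartFrame_chartCoframe_self {p x : M} (hx : x ∈ (extChartAt (𝓡 n) p).source)
    (w : TangentSpace (𝓡 n) x) :
    (chartFrame p (extChartAt (𝓡 n) p x) (chartCoframe p x w) : EuclideanSpace ℝ (Fin n)) = w := by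
  have h := mfderivWithin_extChartAt_symm_comp_mfderiv_extChartAt' (I := 𝓡 n) (x := p) (y := x) hx
  have h' := congrArg (fun L : EuclideanSpace ℝ (Fin n) →L[ℝ] EuclideanSpace ℝ (Fin n) => L w) h
  simp only [ModelWithCorners.range_eq_univ, mfderivWithin_univ] at h'
  exact h'

/-- Vectors of the coordinate frames of two charts with the same coordinates up to the derivative of
the coordinate change agree. -/
theorem chartFrame_coordChange {p q : M} {x : EuclideanSpace ℝ (Fin n)} (hx : x ∈ overlap n p q)
    (v : EuclideanSpace ℝ (Fin n)) :
    (chartFrame q (coordChange n p q x) (fderiv ℝ (coordChange n p q) x v) :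
      EuclideanSpace ℝ (Fin n)) = chartFrame p x v := by
  rw [← chartCoframe_chartFrame hx]
  exact chartFrame_chartCoframe_self hx.2 _

end Frames

/-! ### Coordinates of the tangent groupoid -/

namespace TangentGroupoid

variable {n : ℕ} {M : Type*} [TopologicalSpace M] [ChartedSpace (EuclideanSpace ℝ (Fin n)) M]

theorem tangent_congr {x y : M} {v : TangentSpace (𝓡 n) x} {w : TangentSpace (𝓡 n) y} (h : x = y)
    (hvw : (v : EuclideanSpace ℝ (Fin n)) = w) :
    (tangent x v : TangentGroupoid n M) = tangent y w := by
  subst h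
  exact congrArg (tangent x) hvw

/-- The coordinate space of the tangent groupoid. -/
abbrev Slab (n : ℕ) : Type :=
  (EuclideanSpace ℝ (Fin n) × EuclideanSpace ℝ (Fin n)) × Icc (0 : ℝ) 1

open Classical in
/-- The parametrization of the tangent groupoid by the charts `φ` around `p` and `ψ` around `q`:
`(x, v, t) ↦ (φ⁻¹ x, ψ⁻¹ (x - t v), t)` for `t > 0` and `(x, v, 0) ↦ dφ⁻¹(x) v`. At `t = 0` it is
used for `p = q` only. -/
def param (p q : M) (z : Slab n) : TangentGroupoid n M :=
  if h : z.2 ∈ unitIoc then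
    pair ((extChartAt (𝓡 n) p).symm z.1.1)
      ((extChartAt (𝓡 n) q).symm (z.1.1 - (z.2 : ℝ) • z.1.2)) ⟨z.2, h⟩
  else tangent ((extChartAt (𝓡 n) p).symm z.1.1) (chartFrame p z.1.1 z.1.2)

/-- The coordinates of an arrow with respect to the charts `φ` around `p` and `ψ` around `q`,
inverse to `param p q`: the arrow `(x, y, t)` has the coordinates `(φ x, (φ x - ψ y) / t, t)`. -/
def coords [IsManifold (𝓡 n) ∞ M] (p q : M) : TangentGroupoid n M → Slab n
  | pair x y t => ((extChartAt (𝓡 n) p x,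
      (t.1 : ℝ)⁻¹ • (extChartAt (𝓡 n) p x - extChartAt (𝓡 n) q y)), t.1)
  | tangent x w => ((extChartAt (𝓡 n) p x, chartCoframe p x w), 0)

/-- The domain of `param p q`. -/
def paramSource (p q : M) : Set (Slab n) :=
  {z | z.1.1 ∈ (extChartAt (𝓡 n) p).target ∧
    z.1.1 - (z.2 : ℝ) • z.1.2 ∈ (extChartAt (𝓡 n) q).target ∧ (0 < (z.2 : ℝ) ∨ p = q)}

/-- The image of `param p q`. -/
def paramTarget (p q : M) : Set (TangentGroupoid n M)
  | pair x y _ => x ∈ (extChartAt (𝓡 n) p).source ∧ y ∈ (extChartAt (𝓡 n) q).source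
  | tangent x _ => x ∈ (extChartAt (𝓡 n) p).source ∧ p = q

theorem param_of_pos (p q : M) {z : Slab n}
    (h : 0 < (z.2 : ℝ)) : param p q z = pair ((extChartAt (𝓡 n) p).symm z.1.1)
      ((extChartAt (𝓡 n) q).symm (z.1.1 - (z.2 : ℝ) • z.1.2)) ⟨z.2, h⟩ := dif_pos _

theorem param_of_eq_zero (p q : M) {z : Slab n}
    (h : (z.2 : ℝ) = 0) :
    param p q z = tangent ((extChartAt (𝓡 n) p).symm z.1.1) (chartFrame p z.1.1 z.1.2) :=
  dif_neg fun h' : 0 < (z.2 : ℝ) => h'.ne' h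

theorem eq_zero_or_pos (t : Icc (0 : ℝ) 1) : (t : ℝ) = 0 ∨ 0 < (t : ℝ) :=
  t.2.1.eq_or_lt.imp_left Eq.symm

theorem isOpen_pos_or (P : Prop) : IsOpen {z : Slab n | 0 < (z.2 : ℝ) ∨ P} := by
  have h : IsOpen {z : Slab n | 0 < (z.2 : ℝ)} := isOpen_lt continuous_const (by fun_prop)
  exact h.union isOpen_const

theorem param_mem_paramTarget_iff {p q p' q' : M} {z : Slab n}
    (hz : z ∈ paramSource p q) : param p q z ∈ paramTarget p' q' ↔
      z.1.1 ∈ overlap n p p' ∧ z.1.1 - (z.2 : ℝ) • z.1.2 ∈ overlap n q q' ∧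
        (0 < (z.2 : ℝ) ∨ p' = q') := by
  obtain ⟨h1, h2, h3⟩ := hz
  rcases eq_zero_or_pos z.2 with h | h
  · obtain rfl := h3.resolve_left (by simp [h])
    rw [param_of_eq_zero p p h]
    simp only [h, lt_irrefl, false_or, zero_smul, sub_zero]
    constructor
    · rintro ⟨h4, rfl⟩
      exact ⟨⟨h1, h4⟩, ⟨h1, h4⟩, rfl⟩
    · rintro ⟨h4, h5, rfl⟩
      exact ⟨h4.2, rfl⟩
  · rw [param_of_pos p q h]
    constructor
    · rintro ⟨h4, h5⟩
      exact ⟨⟨h1, h4⟩, ⟨h2, h5⟩, Or.inl h⟩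
    · rintro ⟨h4, h5, -⟩
      exact ⟨h4.2, h5.2⟩

theorem isOpen_paramSource (p q : M) : IsOpen (paramSource (n := n) p q) := by
  have h1 : IsOpen {z : Slab n | z.1.1 ∈ (extChartAt (𝓡 n) p).target} :=
    (isOpen_extChartAt_target p).preimage (by fun_prop)
  have h2 : IsOpen {z : Slab n |
      z.1.1 - (z.2 : ℝ) • z.1.2 ∈ (extChartAt (𝓡 n) q).target} :=
    (isOpen_extChartAt_target q).preimage (by fun_prop)
  have h3 : IsOpen {z : Slab n | 0 < (z.2 : ℝ) ∨ p = q} := isOpen_pos_or _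
  exact h1.inter (h2.inter h3)

theorem isOpen_paramOverlap (p q p' q' : M) :
    IsOpen (paramSource (n := n) p q ∩ param p q ⁻¹' paramTarget p' q') := by
  have : paramSource (n := n) p q ∩ param p q ⁻¹' paramTarget p' q' = paramSource p q ∩
      ({z | z.1.1 ∈ overlap n p p'} ∩ ({z | z.1.1 - (z.2 : ℝ) • z.1.2 ∈ overlap n q q'} ∩
        {z | 0 < (z.2 : ℝ) ∨ p' = q'})) := by
    ext z
    exact and_congr_right fun hz => param_mem_paramTarget_iff hz
  rw [this]
  refine (isOpen_paramSource p q).inter (IsOpen.inter ?_ (IsOpen.inter ?_ ?_))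
  · exact (isOpen_overlap p p').preimage (by fun_prop)
  · exact (isOpen_overlap q q').preimage (by fun_prop)
  · exact isOpen_pos_or _

variable [IsManifold (𝓡 n) ∞ M]

/-- The parametrization `param p q` as a partial equivalence. -/
def paramEquiv (p q : M) : PartialEquiv (Slab n) (TangentGroupoid n M) where
  toFun := param p q
  invFun := coords p q
  source := paramSource p q
  target := paramTarget p q
  map_source' := by
    rintro z ⟨h1, h2, h3⟩
    rcases eq_zero_or_pos z.2 with h | h
    · rw [param_of_eq_zero p q h]
      exact ⟨(extChartAt (𝓡 n) p).map_target h1, h3.resolve_left (by simp [h])⟩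
    · rw [param_of_pos p q h]
      exact ⟨(extChartAt (𝓡 n) p).map_target h1, (extChartAt (𝓡 n) q).map_target h2⟩
  map_target' := by
    rintro (⟨x, y, t⟩ | ⟨x, w⟩) h
    · have ht : (t.1 : ℝ) ≠ 0 := ne_of_gt t.2
      refine ⟨(extChartAt (𝓡 n) p).map_source h.1, ?_, Or.inl t.2⟩
      simp only [coords, smul_inv_smul₀ ht, sub_sub_cancel]
      exact (extChartAt (𝓡 n) q).map_source h.2
    · refine ⟨(extChartAt (𝓡 n) p).map_source h.1, ?_, Or.inr h.2⟩
      rw [← h.2]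
      simpa [coords] using (extChartAt (𝓡 n) p).map_source h.1
  left_inv' := by
    rintro ⟨⟨x, v⟩, t⟩ ⟨h1, h2, h3⟩
    rcases eq_zero_or_pos t with h | h
    · rw [param_of_eq_zero p q h]
      refine Prod.ext (Prod.ext ((extChartAt (𝓡 n) p).right_inv h1) ?_) (Subtype.ext h.symm)
      exact chartCoframe_chartFrame_self h1 v
    · rw [param_of_pos p q h]
      refine Prod.ext (Prod.ext ((extChartAt (𝓡 n) p).right_inv h1) ?_) rfl
      simp only [coords]
      rw [(extChartAt (𝓡 n) p).right_inv h1, (extChartAt (𝓡 n) q).right_inv h2, sub_sub_cancel,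
        inv_smul_smul₀ h.ne']
  right_inv' := by
    rintro (⟨x, y, t⟩ | ⟨x, w⟩) h
    · have ht : (t.1 : ℝ) ≠ 0 := ne_of_gt t.2
      rw [coords, param_of_pos p q (show 0 < (t.1 : ℝ) from t.2)]
      simp only [smul_inv_smul₀ ht, sub_sub_cancel]
      rw [(extChartAt (𝓡 n) p).left_inv h.1, (extChartAt (𝓡 n) q).left_inv h.2]
    · rw [coords, param_of_eq_zero p q rfl]
      exact tangent_congr ((extChartAt (𝓡 n) p).left_inv h.1) (chartFrame_chartCoframe_self h.1 w)

theorem coords_param_of_pos {p q p' q' : M} {z : Slab n}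
    (h : 0 < (z.2 : ℝ)) : coords p' q' (param p q z) = ((coordChange n p p' z.1.1,
      (z.2 : ℝ)⁻¹ • (coordChange n p p' z.1.1 -
        coordChange n q q' (z.1.1 - (z.2 : ℝ) • z.1.2))), z.2) := by
  rw [param_of_pos p q h]
  rfl

/-- For a single coordinate change, the transition is a difference quotient. -/
theorem coords_param_eq_diffQuot {p p' : M} {z : Slab n}
    (hz : z.1.1 ∈ overlap n p p') : coords p' p' (param p p z) = ((coordChange n p p' z.1.1,
      -diffQuot (coordChange n p p') z.1.1 (-z.1.2) (z.2 : ℝ)), z.2) := by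
  rcases eq_zero_or_pos z.2 with h | h
  · rw [param_of_eq_zero p p h]
    refine Prod.ext (Prod.ext rfl ?_) (Subtype.ext h.symm)
    rw [h, diffQuot_zero, map_neg, neg_neg]
    exact chartCoframe_chartFrame hz _
  · rw [coords_param_of_pos h, diffQuot_of_ne _ _ _ h.ne', ← smul_neg, neg_sub, smul_neg,
      ← sub_eq_add_neg]

/-- The transitions between the parametrizations are smooth. Over `t = 0`, only parametrizations
`param p p` and `param p' p'` with a single chart meet, and there the transition is a difference
quotient of the coordinate change; elsewhere, dividing by `t` is harmless. -/
theorem contMDiffOn_coords_param (p q p' q' : M) :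
    ContMDiffOn (slabModel (EuclideanSpace ℝ (Fin n))) (slabModel (EuclideanSpace ℝ (Fin n))) ∞
      (fun z => coords p' q' (param p q z))
      (paramSource (n := n) p q ∩ param p q ⁻¹' paramTarget p' q') := by
  rintro z ⟨hz, hz'⟩
  obtain ⟨h4, h5, h6⟩ := (param_mem_paramTarget_iff hz).1 hz'
  obtain ⟨h1, h2, h3⟩ := hz
  have ha : ContDiffAt ℝ ∞ (fun p₁ : (EuclideanSpace ℝ (Fin n) × EuclideanSpace ℝ (Fin n)) × ℝ =>
      coordChange n p p' p₁.1.1) (slabIncl z) :=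
    ((contDiffOn_coordChange p p').contDiffAt ((isOpen_overlap p p').mem_nhds h4)).comp
      (slabIncl z) (f := fun p₁ : (EuclideanSpace ℝ (Fin n) × EuclideanSpace ℝ (Fin n)) × ℝ =>
        p₁.1.1) (by fun_prop)
  refine ContMDiffAt.contMDiffWithinAt ?_
  rcases eq_zero_or_pos z.2 with h | h
  · obtain rfl := h3.resolve_left (by simp [h])
    obtain rfl := h6.resolve_left (by simp [h])
    have hd := contDiffAt_diffQuot (isOpen_overlap p p') (contDiffOn_coordChange p p') h4
      (v := -z.1.2) (t := (z.2 : ℝ)) (by simpa [← sub_eq_add_neg] using h5)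
    have hd' : ContDiffAt ℝ ∞
        (fun p₁ : (EuclideanSpace ℝ (Fin n) × EuclideanSpace ℝ (Fin n)) × ℝ =>
          -diffQuot (coordChange n p p') p₁.1.1 (-p₁.1.2) p₁.2) (slabIncl z) :=
      (hd.comp (slabIncl z)
        (f := fun p₁ : (EuclideanSpace ℝ (Fin n) × EuclideanSpace ℝ (Fin n)) × ℝ =>
          ((p₁.1.1, -p₁.1.2), p₁.2)) (by fun_prop)).neg
    refine (ContMDiffAt.slab_mk (ha.prodMk hd').contMDiffAt_slab
      contMDiffAt_snd).congr_of_eventuallyEq ?_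
    have hc : Continuous fun z : Slab n => z.1.1 := by fun_prop
    filter_upwards [hc.continuousAt.preimage_mem_nhds ((isOpen_overlap p p').mem_nhds h4)]
      with y hy
    exact coords_param_eq_diffQuot hy
  · have hb : ContDiffAt ℝ ∞
        (fun p₁ : (EuclideanSpace ℝ (Fin n) × EuclideanSpace ℝ (Fin n)) × ℝ =>
          coordChange n q q' (p₁.1.1 - p₁.2 • p₁.1.2)) (slabIncl z) :=
      ContDiffAt.comp (slabIncl z) (g := coordChange n q q')
        (f := fun p₁ : (EuclideanSpace ℝ (Fin n) × EuclideanSpace ℝ (Fin n)) × ℝ =>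
          p₁.1.1 - p₁.2 • p₁.1.2)
        ((contDiffOn_coordChange q q').contDiffAt ((isOpen_overlap q q').mem_nhds h5))
        (by fun_prop)
    have hd : ContDiffAt ℝ ∞
        (fun p₁ : (EuclideanSpace ℝ (Fin n) × EuclideanSpace ℝ (Fin n)) × ℝ =>
          p₁.2⁻¹ • (coordChange n p p' p₁.1.1 - coordChange n q q' (p₁.1.1 - p₁.2 • p₁.1.2)))
        (slabIncl z) := (contDiffAt_snd.inv h.ne').smul (ha.sub hb)
    refine (ContMDiffAt.slab_mk (ha.prodMk hd).contMDiffAt_slab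
      contMDiffAt_snd).congr_of_eventuallyEq ?_
    have hpos : ∀ᶠ y : Slab n in 𝓝 z, 0 < (y.2 : ℝ) :=
      ContinuousAt.eventually_lt continuousAt_const (by fun_prop) h
    filter_upwards [hpos] with y hy
    exact coords_param_of_pos hy

end TangentGroupoid

/-! ### The smooth structure of the tangent groupoid -/

namespace TangentGroupoid

variable {n : ℕ} {M : Type*} [TopologicalSpace M] [ChartedSpace (EuclideanSpace ℝ (Fin n)) M]

/-- The centres of the charts used around an arrow. -/
def centers : TangentGroupoid n M → M × M
  | pair x y _ => (x, y)
  | tangent x _ => (x, x)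

theorem mem_paramTarget_centers (a : TangentGroupoid n M) :
    a ∈ paramTarget a.centers.1 a.centers.2 := by
  rcases a with ⟨x, y, t⟩ | ⟨x, w⟩
  · exact ⟨mem_extChartAt_source x, mem_extChartAt_source y⟩
  · exact ⟨mem_extChartAt_source x, rfl⟩

theorem range_param {p q : M} (z : Slab n) :
    range (param p q z) = ((extChartAt (𝓡 n) p).symm z.1.1, z.2) := by
  rcases eq_zero_or_pos z.2 with h | h
  · rw [param_of_eq_zero p q h]
    exact Prod.ext rfl (Subtype.ext h.symm)
  · rw [param_of_pos p q h]
    rfl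

theorem source_param {p q : M} {z : Slab n} (hz : z ∈ paramSource p q) :
    source (param p q z) = ((extChartAt (𝓡 n) q).symm (z.1.1 - (z.2 : ℝ) • z.1.2), z.2) := by
  rcases eq_zero_or_pos z.2 with h | h
  · obtain rfl := hz.2.2.resolve_left (by simp [h])
    rw [param_of_eq_zero p p h]
    refine Prod.ext ?_ (Subtype.ext h.symm)
    simp [source, h]
  · rw [param_of_pos p q h]
    rfl

theorem paramSource_mem_nhds {p q : M} {z : Slab n} (hz : z ∈ paramSource p q) :
    paramSource p q ∈ 𝓝 z := (isOpen_paramSource p q).mem_nhds hz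

variable [IsManifold (𝓡 n) ∞ M]

/-- The topology for which the parametrizations are homeomorphisms onto open subsets. -/
instance instTopologicalSpace : TopologicalSpace (TangentGroupoid n M) :=
  gluedTopology (fun i : M × M => paramEquiv i.1 i.2) (fun i => isOpen_paramSource i.1 i.2)

/-- The parametrizations as homeomorphisms onto open subsets. -/
def paramHomeomorph (i : M × M) : OpenPartialHomeomorph (Slab n) (TangentGroupoid n M) :=
  gluedHomeomorph (fun i : M × M => paramEquiv i.1 i.2) (fun i => isOpen_paramSource i.1 i.2)
    (fun i j => isOpen_paramOverlap i.1 i.2 j.1 j.2)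
    (fun i j => (contMDiffOn_coords_param i.1 i.2 j.1 j.2).continuousOn) i

/-- The atlas given by the parametrizations. -/
instance instChartedSpace :
    ChartedSpace (ModelProd (ModelProd (EuclideanSpace ℝ (Fin n)) (EuclideanSpace ℝ (Fin n)))
      (EuclideanHalfSpace 1)) (TangentGroupoid n M) :=
  chartedSpaceOfCover paramHomeomorph centers mem_paramTarget_centers

instance instIsManifold :
    IsManifold (slabModel (EuclideanSpace ℝ (Fin n))) ∞ (TangentGroupoid n M) :=
  isManifold_of_cover paramHomeomorph centers mem_paramTarget_centers
    (fun i j => contMDiffOn_coords_param i.1 i.2 j.1 j.2)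

/-- The parametrizations as diffeomorphisms onto open subsets. -/
def paramDiffeomorph (p q : M) :
    PartialDiffeomorph (slabModel (EuclideanSpace ℝ (Fin n))) (slabModel (EuclideanSpace ℝ (Fin n)))
      (Slab n) (TangentGroupoid n M) ∞ :=
  coverDiffeomorph paramHomeomorph centers mem_paramTarget_centers
    (fun i j => contMDiffOn_coords_param i.1 i.2 j.1 j.2) (p, q)

theorem isLocalDiffeomorphAt_param {p q : M} {z : Slab n} (hz : z ∈ paramSource p q) :
    IsLocalDiffeomorphAt (slabModel (EuclideanSpace ℝ (Fin n)))
      (slabModel (EuclideanSpace ℝ (Fin n))) ∞ (param p q) z :=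
  ⟨paramDiffeomorph p q, hz, fun _ _ => rfl⟩

theorem exists_param (a : TangentGroupoid n M) :
    ∃ p q, ∃ z ∈ paramSource p q, param p q z = a :=
  ⟨_, _, _, (paramEquiv _ _).map_target (mem_paramTarget_centers a),
    (paramEquiv _ _).right_inv (mem_paramTarget_centers a)⟩

theorem contMDiff_range : ContMDiff (slabModel (EuclideanSpace ℝ (Fin n))) ((𝓡 n).prod (𝓡∂ 1)) ∞
    (range : TangentGroupoid n M → M × Icc (0 : ℝ) 1) := by
  intro a
  obtain ⟨p, q, z, hz, rfl⟩ := exists_param a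
  refine (isLocalDiffeomorphAt_param hz).contMDiffAt_of_comp ?_
  have h1 : ContMDiffAt (slabModel (EuclideanSpace ℝ (Fin n))) (𝓡 n) ∞
      (fun z : Slab n => (extChartAt (𝓡 n) p).symm z.1.1) z :=
    ((contMDiffOn_extChartAt_symm p).contMDiffAt
      ((isOpen_extChartAt_target p).mem_nhds hz.1)).comp z
      (f := fun z : Slab n => z.1.1) (contMDiff_fst.comp contMDiff_fst).contMDiffAt
  exact (h1.prodMk contMDiffAt_snd).congr_of_eventuallyEq (.of_forall range_param)

theorem contMDiffAt_source_param {p q : M} {z : Slab n} (hz : z ∈ paramSource p q) :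
    ContMDiffAt (slabModel (EuclideanSpace ℝ (Fin n))) ((𝓡 n).prod (𝓡∂ 1)) ∞
      (fun z : Slab n => ((extChartAt (𝓡 n) q).symm (z.1.1 - (z.2 : ℝ) • z.1.2), z.2)) z := by
  have h1 : ContMDiffAt (slabModel (EuclideanSpace ℝ (Fin n))) 𝓘(ℝ, EuclideanSpace ℝ (Fin n)) ∞
      (fun z : Slab n => z.1.1 - (z.2 : ℝ) • z.1.2) z :=
    ContDiffAt.contMDiffAt_slab
      (f := fun p₁ : (EuclideanSpace ℝ (Fin n) × EuclideanSpace ℝ (Fin n)) × ℝ =>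
        p₁.1.1 - p₁.2 • p₁.1.2) (by fun_prop)
  exact (ContMDiffAt.comp z (g := (extChartAt (𝓡 n) q).symm)
    ((contMDiffOn_extChartAt_symm q).contMDiffAt
      ((isOpen_extChartAt_target q).mem_nhds hz.2.1)) h1).prodMk contMDiffAt_snd

theorem contMDiff_source : ContMDiff (slabModel (EuclideanSpace ℝ (Fin n)))
    ((𝓡 n).prod (𝓡∂ 1)) ∞ (source : TangentGroupoid n M → M × Icc (0 : ℝ) 1) := by
  intro a
  obtain ⟨p, q, z, hz, rfl⟩ := exists_param a
  refine (isLocalDiffeomorphAt_param hz).contMDiffAt_of_comp ?_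
  refine (contMDiffAt_source_param hz).congr_of_eventuallyEq ?_
  filter_upwards [paramSource_mem_nhds hz] with y hy
  exact source_param hy

instance instT2Space [T2Space M] : T2Space (TangentGroupoid n M) := by
  refine ⟨fun a b hab => ?_⟩
  by_cases hr : range a = range b
  swap
  · exact separated_by_continuous contMDiff_range.continuous hr
  by_cases hs : source a = source b
  swap
  · exact separated_by_continuous contMDiff_source.continuous hs
  -- two arrows with the same source and range are different only if they are tangent vectors at
  -- the same point, and then a single parametrization covers both
  obtain ⟨p, ha, hb⟩ : ∃ p, a ∈ paramTarget p p ∧ b ∈ paramTarget p p := by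
    rcases a with ⟨x, y, t⟩ | ⟨x, w⟩ <;> rcases b with ⟨x', y', t'⟩ | ⟨x', w'⟩
    · refine absurd ?_ hab
      have h1 : x = x' := congrArg Prod.fst hr
      have h2 : t = t' := Subtype.ext (congrArg Prod.snd hr)
      have h3 : y = y' := congrArg Prod.fst hs
      rw [h1, h2, h3]
    · exact (not_composable hr).elim
    · exact (not_composable hr.symm).elim
    · have h1 : x = x' := congrArg Prod.fst hr
      subst h1
      exact ⟨x, ⟨mem_extChartAt_source x, rfl⟩, ⟨mem_extChartAt_source x, rfl⟩⟩
  let e := paramHomeomorph (n := n) (p, p)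
  have ha' : a ∈ e.target := ha
  have hb' : b ∈ e.target := hb
  have hne : e.symm a ≠ e.symm b := fun h => hab (e.symm.injOn ha' hb' h)
  obtain ⟨U, V, hU, hV, haU, hbV, hUV⟩ := t2_separation hne
  refine ⟨e.target ∩ e.symm ⁻¹' U, e.target ∩ e.symm ⁻¹' V, e.isOpen_inter_preimage_symm hU,
    e.isOpen_inter_preimage_symm hV, ⟨ha', haU⟩, ⟨hb', hbV⟩, ?_⟩
  exact (hUV.preimage e.symm).mono Set.inter_subset_right Set.inter_subset_right

variable (n M) in
theorem secondCountableTopology [CompactSpace M] :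
    SecondCountableTopology (TangentGroupoid n M) := by
  obtain ⟨s, hs⟩ := CompactSpace.elim_nhds_subcover
    (fun p : M => (extChartAt (𝓡 n) p).source) (fun p => extChartAt_source_mem_nhds p)
  have hs' : ∀ x : M, ∃ p ∈ s, x ∈ (extChartAt (𝓡 n) p).source := fun x => by
    have : x ∈ ⋃ p ∈ s, (extChartAt (𝓡 n) p).source := by rw [hs]; trivial
    simpa using this
  let U : s × s → Set (TangentGroupoid n M) := fun i => (paramHomeomorph (i.1.1, i.2.1)).target
  have : ∀ i, SecondCountableTopology (U i) := fun i =>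
    (paramHomeomorph (n := n) (i.1.1, i.2.1)).symm.secondCountableTopology_source
  refine TopologicalSpace.secondCountableTopology_of_countable_cover (U := U)
    (fun i => (paramHomeomorph (i.1.1, i.2.1)).open_target) ?_
  refine Set.eq_univ_of_forall fun a => Set.mem_iUnion.2 ?_
  rcases a with ⟨x, y, t⟩ | ⟨x, w⟩
  · obtain ⟨p, hp, hx⟩ := hs' x
    obtain ⟨q, hq, hy⟩ := hs' y
    exact ⟨(⟨p, hp⟩, ⟨q, hq⟩), hx, hy⟩
  · obtain ⟨p, hp, hx⟩ := hs' x
    exact ⟨(⟨p, hp⟩, ⟨p, hp⟩), hx, rfl⟩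

/-- The inclusion of the pair groupoids `M × M × (0, 1]` is a diffeomorphism onto an open subset. -/
theorem isLocalDiffeomorph_pair :
    IsLocalDiffeomorph ((𝓡 n).prod ((𝓡 n).prod (𝓡∂ 1))) (slabModel (EuclideanSpace ℝ (Fin n))) ∞
      (fun p : M × M × unitIoc => pair (n := n) p.1 p.2.1 p.2.2) := by
  classical
  -- the parameter `t`, with an arbitrary value on `TM`
  let T : TangentGroupoid n M → unitIoc := fun a =>
    if h : (range a).2 ∈ unitIoc then ⟨(range a).2, h⟩ else ⟨1, one_pos (α := ℝ)⟩
  have hrc : Continuous (range : TangentGroupoid n M → _) := contMDiff_range.continuous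
  have hopen : IsOpen {a : TangentGroupoid n M | (range a).2 ∈ unitIoc} :=
    unitIoc.2.preimage (continuous_snd.comp hrc)
  have hT : ∀ a : TangentGroupoid n M, (range a).2 ∈ unitIoc →
      ContMDiffAt (slabModel (EuclideanSpace ℝ (Fin n))) (𝓡∂ 1) ∞ T a := by
    intro a ha
    have h1 : (fun b => ((T b : unitIoc) : Icc (0 : ℝ) 1)) =ᶠ[𝓝 a] fun b => (range b).2 := by
      filter_upwards [hopen.mem_nhds ha] with b hb
      simp only [T]
      rw [dif_pos (show (range b).2 ∈ unitIoc from hb)]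
    have h2 : ContMDiffAt (slabModel (EuclideanSpace ℝ (Fin n))) (𝓡∂ 1) ∞
        (fun b => ((T b : unitIoc) : Icc (0 : ℝ) 1)) a :=
      (contMDiff_snd.comp contMDiff_range).contMDiffAt.congr_of_eventuallyEq h1
    rw [ContMDiffAt.iff_comp_isImmersionAt (φ := ((↑) : unitIoc → Icc (0 : ℝ) 1))
      ((Manifold.IsImmersion.of_opens unitIoc).isImmersionAt _)]
    exact ⟨Topology.IsInducing.subtypeVal.continuousAt_iff.2 h2.continuousAt, h2⟩
  have hsmooth : ContMDiff ((𝓡 n).prod ((𝓡 n).prod (𝓡∂ 1)))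
      (slabModel (EuclideanSpace ℝ (Fin n))) ∞
      (fun p : M × M × unitIoc => pair (n := n) p.1 p.2.1 p.2.2) := by
    rintro ⟨x, y, t⟩
    have hx : ContMDiffAt ((𝓡 n).prod ((𝓡 n).prod (𝓡∂ 1))) 𝓘(ℝ, EuclideanSpace ℝ (Fin n)) ∞
        (fun p : M × M × unitIoc => extChartAt (𝓡 n) x p.1) (x, y, t) :=
      ContMDiffAt.comp (x, y, t) contMDiffAt_extChartAt contMDiffAt_fst
    have hy : ContMDiffAt ((𝓡 n).prod ((𝓡 n).prod (𝓡∂ 1))) 𝓘(ℝ, EuclideanSpace ℝ (Fin n)) ∞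
        (fun p : M × M × unitIoc => extChartAt (𝓡 n) y p.2.1) (x, y, t) :=
      ContMDiffAt.comp (x, y, t) (g := extChartAt (𝓡 n) y) contMDiffAt_extChartAt
        (contMDiffAt_fst.comp (x, y, t) contMDiffAt_snd)
    have ht : ContMDiffAt ((𝓡 n).prod ((𝓡 n).prod (𝓡∂ 1))) (𝓡∂ 1) ∞
        (fun p : M × M × unitIoc => (p.2.2 : Icc (0 : ℝ) 1)) (x, y, t) :=
      (contMDiff_subtype_val.comp (contMDiff_snd.comp contMDiff_snd)).contMDiffAt
    have ht' : ContMDiffAt ((𝓡 n).prod ((𝓡 n).prod (𝓡∂ 1))) 𝓘(ℝ, ℝ) ∞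
        (fun p : M × M × unitIoc => ((p.2.2 : Icc (0 : ℝ) 1) : ℝ)⁻¹) (x, y, t) :=
      ContMDiffAt.comp (x, y, t) (g := fun s : ℝ => s⁻¹) (I' := 𝓘(ℝ, ℝ))
        (contDiffAt_inv ℝ (ne_of_gt t.2)).contMDiffAt
        (contMDiff_subtypeVal_Icc.contMDiffAt.comp _ ht)
    have hc : ContMDiffAt ((𝓡 n).prod ((𝓡 n).prod (𝓡∂ 1)))
        (slabModel (EuclideanSpace ℝ (Fin n))) ∞
        (fun p : M × M × unitIoc => coords x y (pair (n := n) p.1 p.2.1 p.2.2)) (x, y, t) :=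
      ContMDiffAt.slab_mk (hx.prodMk_space (ht'.smul (hx.sub hy))) ht
    have hmem := mem_paramTarget_centers (pair (n := n) x y t)
    have h2 := (isLocalDiffeomorphAt_param ((paramEquiv x y).map_target hmem)).contMDiffAt
    refine (h2.comp (x, y, t) hc).congr_of_eventuallyEq ?_
    filter_upwards [(continuous_fst.continuousAt (x := (x, y, t))).preimage_mem_nhds
      (extChartAt_source_mem_nhds (I := 𝓡 n) x),
      ((continuous_fst.comp continuous_snd).continuousAt (x := (x, y, t))).preimage_mem_nhds
      (extChartAt_source_mem_nhds (I := 𝓡 n) y)] with p h3 h4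
    exact ((paramEquiv x y).right_inv (show pair (n := n) p.1 p.2.1 p.2.2 ∈ paramTarget x y from
      ⟨h3, h4⟩)).symm
  let Φ : PartialDiffeomorph ((𝓡 n).prod ((𝓡 n).prod (𝓡∂ 1)))
      (slabModel (EuclideanSpace ℝ (Fin n))) (M × M × unitIoc) (TangentGroupoid n M) ∞ :=
    { toFun := fun p => pair p.1 p.2.1 p.2.2
      invFun := fun a => ((range a).1, (source a).1, T a)
      source := Set.univ
      target := {a | (range a).2 ∈ unitIoc}
      map_source' := fun p _ => p.2.2.2
      map_target' := fun _ _ => trivial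
      left_inv' := fun p _ => by
        have : T (pair p.1 p.2.1 p.2.2) = p.2.2 := dif_pos p.2.2.2
        rw [this]
        rfl
      right_inv' := by
        rintro (⟨x, y, t⟩ | ⟨x, w⟩) h
        · have : T (pair x y t) = t := dif_pos t.2
          rw [this]
          rfl
        · exact absurd h (lt_irrefl (0 : ℝ))
      open_source := isOpen_univ
      open_target := hopen
      contMDiffOn_toFun := hsmooth.contMDiffOn
      contMDiffOn_invFun := fun a ha =>
        ((contMDiff_fst.comp contMDiff_range).contMDiffAt.prodMk
          ((contMDiff_fst.comp contMDiff_source).contMDiffAt.prodMk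
            (hT a ha))).contMDiffWithinAt }
  exact fun p => ⟨Φ, trivial, fun _ _ => rfl⟩

end TangentGroupoid

/-! ### The groupoid structure -/

namespace TangentGroupoid

section Algebra

variable {n : ℕ} {M : Type*} [TopologicalSpace M] [ChartedSpace (EuclideanSpace ℝ (Fin n)) M]

theorem unit_of_pos {x : M} {t : Icc (0 : ℝ) 1} (h : 0 < (t : ℝ)) :
    (unit (x, t) : TangentGroupoid n M) = pair x x ⟨t, h⟩ := dif_pos (show t ∈ unitIoc from h)

theorem unit_of_eq_zero {x : M} {t : Icc (0 : ℝ) 1} (h : (t : ℝ) = 0) :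
    (unit (x, t) : TangentGroupoid n M) = tangent x 0 := dif_neg fun h' : 0 < (t : ℝ) => h'.ne' h

theorem chartFrame_congr (p : M) {y y' : EuclideanSpace ℝ (Fin n)} (h : y = y')
    (v : EuclideanSpace ℝ (Fin n)) :
    (chartFrame p y v : EuclideanSpace ℝ (Fin n)) = chartFrame p y' v := by
  subst h
  rfl

theorem mul_tangent {x y : M} {v w : EuclideanSpace ℝ (Fin n)}
    (h : source (tangent x v) = range (tangent y w)) :
    mul ⟨(tangent x v, tangent y w), h⟩ = (tangent x (v + w) : TangentGroupoid n M) := by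
  obtain rfl : x = y := congrArg Prod.fst h
  rfl

variable (n M) in
theorem isGroupoid : (groupoid n M).IsGroupoid := by
  have hr : ∀ x, range (unit (n := n) (M := M) x) = x := by
    rintro ⟨x, t⟩
    rcases eq_zero_or_pos t with h | h
    · rw [unit_of_eq_zero h]
      exact Prod.ext rfl (Subtype.ext h.symm)
    · rw [unit_of_pos h]
      rfl
  have hs : ∀ x, source (unit (n := n) (M := M) x) = x := by
    rintro ⟨x, t⟩
    rcases eq_zero_or_pos t with h | h
    · rw [unit_of_eq_zero h]
      exact Prod.ext rfl (Subtype.ext h.symm)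
    · rw [unit_of_pos h]
      rfl
  have key : ∀ (a b c d : TangentGroupoid n M) (h : source a = range b) (h' : source c = range d),
      a = c → b = d → mul ⟨(a, b), h⟩ = mul ⟨(c, d), h'⟩ := by
    rintro a b c d h h' rfl rfl
    rfl
  have hu : ∀ (x : M) (t : unitIoc), unit (n := n) (x, t.1) = pair x x t :=
    fun x t => unit_of_pos t.2
  have hu0 : ∀ x : M, unit (n := n) (x, 0) = tangent x 0 := fun x => unit_of_eq_zero rfl
  have hrc : ∀ (a b : TangentGroupoid n M) h, range (mul ⟨(a, b), h⟩) = range a := by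
    rintro (⟨x, y, t⟩ | ⟨x, v⟩) (⟨x', y', t'⟩ | ⟨x', v'⟩) h
    · rfl
    · exact (not_composable h).elim
    · exact (not_composable h.symm).elim
    · rfl
  have hsc : ∀ (a b : TangentGroupoid n M) h, source (mul ⟨(a, b), h⟩) = source b := by
    rintro (⟨x, y, t⟩ | ⟨x, v⟩) (⟨x', y', t'⟩ | ⟨x', v'⟩) h
    · obtain rfl : t = t' := Subtype.ext (congrArg Prod.snd h)
      rfl
    · exact (not_composable h).elim
    · exact (not_composable h.symm).elim
    · obtain rfl : x = x' := congrArg Prod.fst h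
      rfl
  refine
    { r_unit := hr
      s_unit := hs
      unit_comp := ?_
      comp_unit := ?_
      r_comp := hrc
      s_comp := hsc
      assoc := ?_
      s_inv := ?_
      r_inv := ?_
      inv_comp := ?_
      comp_inv := ?_ }
  · rintro (⟨x, y, t⟩ | ⟨x, v⟩)
    · exact key _ _ (pair x x t) _ _ rfl (hu x t) rfl
    · refine (key _ _ (tangent x 0) _ _ rfl (hu0 x) rfl).trans ((mul_tangent _).trans ?_)
      exact congrArg (tangent x) (zero_add (v : EuclideanSpace ℝ (Fin n)))
  · rintro (⟨x, y, t⟩ | ⟨x, v⟩)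
    · exact key _ _ _ (pair y y t) _ rfl rfl (hu y t)
    · refine (key _ _ _ (tangent x 0) _ rfl rfl (hu0 x)).trans ((mul_tangent _).trans ?_)
      exact congrArg (tangent x) (add_zero (v : EuclideanSpace ℝ (Fin n)))
  · rintro (⟨x, y, t⟩ | ⟨x, v⟩) (⟨x', y', t'⟩ | ⟨x', v'⟩) (⟨x'', y'', t''⟩ | ⟨x'', v''⟩) h h'
    · rfl
    · exact (not_composable h').elim
    · exact (not_composable h).elim
    · exact (not_composable h).elim
    · exact (not_composable h.symm).elim
    · exact (not_composable h.symm).elim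
    · exact (not_composable h'.symm).elim
    · obtain rfl : x = x' := congrArg Prod.fst h
      obtain rfl : x = x'' := congrArg Prod.fst h'
      exact congrArg (tangent x) (add_assoc (v : EuclideanSpace ℝ (Fin n)) v' v'')
  · rintro (⟨x, y, t⟩ | ⟨x, v⟩) <;> rfl
  · rintro (⟨x, y, t⟩ | ⟨x, v⟩) <;> rfl
  · rintro (⟨x, y, t⟩ | ⟨x, v⟩)
    · exact (hu y t).symm
    · refine ((mul_tangent (x := x) (y := x) (v := -(v : EuclideanSpace ℝ (Fin n))) (w := v)
        rfl).trans ?_).trans (hu0 x).symm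
      exact congrArg (tangent x) (neg_add_cancel (v : EuclideanSpace ℝ (Fin n)))
  · rintro (⟨x, y, t⟩ | ⟨x, v⟩)
    · exact (hu x t).symm
    · refine ((mul_tangent (x := x) (y := x) (v := v) (w := -(v : EuclideanSpace ℝ (Fin n)))
        rfl).trans ?_).trans (hu0 x).symm
      exact congrArg (tangent x) (add_neg_cancel (v : EuclideanSpace ℝ (Fin n)))

theorem inv_inv (a : TangentGroupoid n M) : inv (inv a) = a := by
  rcases a with ⟨x, y, t⟩ | ⟨x, v⟩
  · rfl
  · exact congrArg (tangent x) (neg_neg (v : EuclideanSpace ℝ (Fin n)))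

theorem range_inv (a : TangentGroupoid n M) : range (inv a) = source a := by
  rcases a with ⟨x, y, t⟩ | ⟨x, v⟩ <;> rfl

/-- In coordinates, the inversion is `(x, v, t) ↦ (x - t v, -v, t)`. -/
theorem inv_param {p q : M} {z : Slab n} (hz : z ∈ paramSource p q) :
    inv (param p q z) = param q p ((z.1.1 - (z.2 : ℝ) • z.1.2, -z.1.2), z.2) := by
  rcases eq_zero_or_pos z.2 with h | h
  · obtain rfl := hz.2.2.resolve_left (by simp [h])
    rw [param_of_eq_zero p p h,
      param_of_eq_zero p p (z := ((z.1.1 - (z.2 : ℝ) • z.1.2, -z.1.2), z.2)) h]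
    have h0 : z.1.1 - (z.2 : ℝ) • z.1.2 = z.1.1 := by simp [h]
    refine tangent_congr (by simp only [h0]) ?_
    exact (map_neg (chartFrame p z.1.1) z.1.2).symm.trans (chartFrame_congr p h0.symm _)
  · rw [param_of_pos p q h,
      param_of_pos q p (z := ((z.1.1 - (z.2 : ℝ) • z.1.2, -z.1.2), z.2)) h]
    simp only [smul_neg, sub_neg_eq_add, sub_add_cancel]
    rfl

theorem inv_param_mem {p q : M} {z : Slab n} (hz : z ∈ paramSource p q) :
    ((z.1.1 - (z.2 : ℝ) • z.1.2, -z.1.2), z.2) ∈ paramSource q p :=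
  ⟨hz.2.1, by simpa using hz.1, hz.2.2.imp_right Eq.symm⟩

/-- In coordinates, the units are `(x, t) ↦ (x, 0, t)`. -/
theorem unit_eq_param {p x : M} (hx : x ∈ (extChartAt (𝓡 n) p).source) (t : Icc (0 : ℝ) 1) :
    unit (x, t) = param p p ((extChartAt (𝓡 n) p x, 0), t) := by
  rcases eq_zero_or_pos t with h | h
  · rw [unit_of_eq_zero h, param_of_eq_zero p p h]
    refine tangent_congr ((extChartAt (𝓡 n) p).left_inv hx).symm ?_
    exact (map_zero (chartFrame p (extChartAt (𝓡 n) p x))).symm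
  · rw [unit_of_pos h, param_of_pos p p h]
    simp only [smul_zero, sub_zero]
    rw [(extChartAt (𝓡 n) p).left_inv hx]

end Algebra

variable {n : ℕ} {M : Type*} [TopologicalSpace M] [ChartedSpace (EuclideanSpace ℝ (Fin n)) M]
  [IsManifold (𝓡 n) ∞ M]

theorem contMDiff_unit : ContMDiff ((𝓡 n).prod (𝓡∂ 1)) (slabModel (EuclideanSpace ℝ (Fin n))) ∞
    (unit : M × Icc (0 : ℝ) 1 → TangentGroupoid n M) := by
  rintro ⟨x, t⟩
  have h1 : ContMDiffAt ((𝓡 n).prod (𝓡∂ 1)) 𝓘(ℝ, EuclideanSpace ℝ (Fin n)) ∞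
      (fun y : M × Icc (0 : ℝ) 1 => extChartAt (𝓡 n) x y.1) (x, t) :=
    ContMDiffAt.comp (x, t) contMDiffAt_extChartAt contMDiffAt_fst
  have h2 : ContMDiffAt ((𝓡 n).prod (𝓡∂ 1)) (slabModel (EuclideanSpace ℝ (Fin n))) ∞
      (fun y : M × Icc (0 : ℝ) 1 => (((extChartAt (𝓡 n) x y.1, 0), y.2) : Slab n)) (x, t) :=
    ContMDiffAt.slab_mk (h1.prodMk_space contMDiffAt_const) contMDiffAt_snd
  have hz : ((extChartAt (𝓡 n) x x, 0), t) ∈ paramSource x x :=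
    ⟨mem_extChartAt_target x, by simp, Or.inr rfl⟩
  refine ((isLocalDiffeomorphAt_param hz).contMDiffAt.comp (x, t) h2).congr_of_eventuallyEq ?_
  filter_upwards [(continuous_fst.continuousAt (x := (x, t))).preimage_mem_nhds
    (extChartAt_source_mem_nhds (I := 𝓡 n) x)] with y hy
  exact unit_eq_param hy y.2

theorem contMDiff_inv : ContMDiff (slabModel (EuclideanSpace ℝ (Fin n)))
    (slabModel (EuclideanSpace ℝ (Fin n))) ∞
    (inv : TangentGroupoid n M → TangentGroupoid n M) := by
  intro a
  obtain ⟨p, q, z, hz, rfl⟩ := exists_param a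
  refine (isLocalDiffeomorphAt_param hz).contMDiffAt_of_comp ?_
  have h1 : ContMDiffAt (slabModel (EuclideanSpace ℝ (Fin n)))
      (slabModel (EuclideanSpace ℝ (Fin n))) ∞
      (fun z : Slab n => (((z.1.1 - (z.2 : ℝ) • z.1.2, -z.1.2), z.2) : Slab n)) z := by
    refine ContMDiffAt.slab_mk ?_ contMDiffAt_snd
    exact ContDiffAt.contMDiffAt_slab
      (f := fun p₁ : (EuclideanSpace ℝ (Fin n) × EuclideanSpace ℝ (Fin n)) × ℝ =>
        (p₁.1.1 - p₁.2 • p₁.1.2, -p₁.1.2)) (by fun_prop)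
  refine ((isLocalDiffeomorphAt_param (inv_param_mem hz)).contMDiffAt.comp z
    h1).congr_of_eventuallyEq ?_
  filter_upwards [paramSource_mem_nhds hz] with y hy
  exact inv_param hy

end TangentGroupoid

/-! ### Adapted charts -/

section Charts

variable {E₁ H₁ : Type*} [NormedAddCommGroup E₁] [NormedSpace ℝ E₁] [TopologicalSpace H₁]
  {I₁ : ModelWithCorners ℝ E₁ H₁}
  {N X : Type*} [TopologicalSpace N] [ChartedSpace H₁ N] [IsManifold I₁ ∞ N]
  [TopologicalSpace X] [ChartedSpace H₁ X] [IsManifold I₁ ∞ X]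

/-- A chart of `N` transported to `X` by a diffeomorphism between open subsets. -/
theorem PartialDiffeomorph.symm_trans_chartAt_mem_maximalAtlas
    (Φ : PartialDiffeomorph I₁ I₁ N X ∞) (z : N) :
    Φ.toOpenPartialHomeomorph.symm.trans (chartAt H₁ z) ∈ IsManifold.maximalAtlas I₁ ∞ X := by
  refine OpenPartialHomeomorph.mem_maximalAtlas_of_contMDiffOn _ ?_ ?_
  · exact (contMDiffOn_chart (I := I₁) (n := ∞)).comp' Φ.contMDiffOn_invFun
  · exact (Φ.contMDiffOn_toFun).comp' (contMDiffOn_chart_symm (I := I₁) (n := ∞))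

/-- The expression of a map in charts can be computed on the points of the manifold. -/
theorem eqOn_writtenInExtend {E₁ H₁ E₂ H₂ M₁ M₂ : Type*}
    [NormedAddCommGroup E₁] [NormedSpace ℝ E₁] [TopologicalSpace H₁]
    [NormedAddCommGroup E₂] [NormedSpace ℝ E₂] [TopologicalSpace H₂]
    {I₁ : ModelWithCorners ℝ E₁ H₁} {I₂ : ModelWithCorners ℝ E₂ H₂}
    [TopologicalSpace M₁] [TopologicalSpace M₂] {c : OpenPartialHomeomorph M₁ H₁}
    {d : OpenPartialHomeomorph M₂ H₂} {f : M₁ → M₂} {g : E₁ → E₂}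
    (h : ∀ y ∈ c.source, d.extend I₂ (f y) = g (c.extend I₁ y)) :
    Set.EqOn (d.extend I₂ ∘ f ∘ (c.extend I₁).symm) g (c.extend I₁).target := by
  intro u hu
  have h1 := h ((c.extend I₁).symm u) (by
    rw [← c.extend_source (I := I₁)]
    exact (c.extend I₁).map_target hu)
  rwa [(c.extend I₁).right_inv hu] at h1

end Charts

namespace TangentGroupoid
variable {n : ℕ} {M : Type*} [TopologicalSpace M] [ChartedSpace (EuclideanSpace ℝ (Fin n)) M]
  [IsManifold (𝓡 n) ∞ M]

/-- In the coordinates `(x, v, t)` of an arrow and `(x, t)` of an object, the range is the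
projection `(x, v, t) ↦ (x, t)`. -/
theorem isSubmersionOfComplement_range :
    Manifold.IsSubmersionOfComplement (EuclideanSpace ℝ (Fin n))
    (slabModel (EuclideanSpace ℝ (Fin n))) ((𝓡 n).prod (𝓡∂ 1)) ∞
    (range : TangentGroupoid n M → M × Icc (0 : ℝ) 1) := by
  intro a
  obtain ⟨p, q, z, hz, rfl⟩ := exists_param a
  let e : ((EuclideanSpace ℝ (Fin n) × EuclideanSpace ℝ (Fin n)) × EuclideanSpace ℝ (Fin 1)) ≃L[ℝ]
      ((EuclideanSpace ℝ (Fin n) × EuclideanSpace ℝ (Fin 1)) × EuclideanSpace ℝ (Fin n)) :=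
    ContinuousLinearEquiv.equivOfInverse
      (((ContinuousLinearMap.fst ℝ _ _).comp (ContinuousLinearMap.fst ℝ _ _)).prod
        (ContinuousLinearMap.snd ℝ _ _) |>.prod
        ((ContinuousLinearMap.snd ℝ _ _).comp (ContinuousLinearMap.fst ℝ _ _)))
      (((ContinuousLinearMap.fst ℝ _ _).comp (ContinuousLinearMap.fst ℝ _ _)).prod
        (ContinuousLinearMap.snd ℝ _ _) |>.prod
        ((ContinuousLinearMap.snd ℝ _ _).comp (ContinuousLinearMap.fst ℝ _ _)))
      (fun _ => rfl) (fun _ => rfl)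
  have hp : (extChartAt (𝓡 n) p).symm z.1.1 ∈ (extChartAt (𝓡 n) p).source :=
    (extChartAt (𝓡 n) p).map_target hz.1
  refine Manifold.IsSubmersionAtOfComplement.mk_of_continuousAt
    contMDiff_range.continuous.continuousAt e
    ((paramDiffeomorph p q).toOpenPartialHomeomorph.symm.trans (chartAt _ z))
    (chartAt _ (p, z.2)) ?_ ?_
    ((paramDiffeomorph p q).symm_trans_chartAt_mem_maximalAtlas z)
    (IsManifold.chart_mem_maximalAtlas _) ?_
  · have h1 : (paramDiffeomorph p q).toOpenPartialHomeomorph.symm (param p q z) = z :=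
      (paramEquiv p q).left_inv hz
    rw [OpenPartialHomeomorph.trans_source]
    refine ⟨(paramEquiv p q).map_source hz, ?_⟩
    rw [Set.mem_preimage, h1]
    exact mem_chart_source _ z
  · rw [range_param]
    simp at hp ⊢
    exact ⟨by simpa using hp, mem_chart_source _ _⟩
  · refine eqOn_writtenInExtend fun y hy => ?_
    obtain ⟨z', hz', rfl⟩ : ∃ z' ∈ paramSource p q, param p q z' = y :=
      ⟨_, (paramEquiv p q).map_target hy.1, (paramEquiv p q).right_inv hy.1⟩
    have h1 : (paramDiffeomorph p q).toOpenPartialHomeomorph.symm (param p q z') = z' :=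
      (paramEquiv p q).left_inv hz'
    have h2 : (((paramDiffeomorph p q).toOpenPartialHomeomorph.symm.trans
        (chartAt _ z)).extend (slabModel (EuclideanSpace ℝ (Fin n)))) (param p q z') =
        (z'.1, (𝓡∂ 1) (chartAt _ z.2 z'.2)) := by
      change (slabModel (EuclideanSpace ℝ (Fin n))) (chartAt _ z
        ((paramDiffeomorph p q).toOpenPartialHomeomorph.symm (param p q z'))) = _
      rw [h1]
      rfl
    rw [h2, range_param]
    refine Prod.ext ?_ rfl
    exact (extChartAt (𝓡 n) p).right_inv hz'.1

end TangentGroupoid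

/-- Submersions are stable under composition with diffeomorphisms of the domain. -/
theorem Manifold.IsSubmersionOfComplement.comp_diffeomorph {E₁ H₁ E₂ H₂ F M₁ M₂ : Type*}
    [NormedAddCommGroup E₁] [NormedSpace ℝ E₁] [TopologicalSpace H₁]
    [NormedAddCommGroup E₂] [NormedSpace ℝ E₂] [TopologicalSpace H₂]
    [NormedAddCommGroup F] [NormedSpace ℝ F]
    {I₁ : ModelWithCorners ℝ E₁ H₁} {I₂ : ModelWithCorners ℝ E₂ H₂}
    [TopologicalSpace M₁] [ChartedSpace H₁ M₁] [IsManifold I₁ ∞ M₁]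
    [TopologicalSpace M₂] [ChartedSpace H₂ M₂]
    {f : M₁ → M₂} (hf : Manifold.IsSubmersionOfComplement F I₁ I₂ ∞ f) (Φ : M₁ ≃ₘ⟮I₁, I₁⟯ M₁) :
    Manifold.IsSubmersionOfComplement F I₁ I₂ ∞ (f ∘ Φ) := by
  intro x
  have h := hf (Φ x)
  refine Manifold.IsSubmersionAtOfComplement.mk_of_charts h.equiv
    (Φ.toHomeomorph.toOpenPartialHomeomorph.trans h.domChart) h.codChart ?_ h.mem_codChart_source
    ?_ h.codChart_mem_maximalAtlas ?_ ?_
  · rw [OpenPartialHomeomorph.trans_source]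
    exact ⟨trivial, h.mem_domChart_source⟩
  · refine OpenPartialHomeomorph.mem_maximalAtlas_of_contMDiffOn _ ?_ ?_
    · exact (contMDiffOn_of_mem_maximalAtlas h.domChart_mem_maximalAtlas).comp'
        Φ.contMDiff.contMDiffOn
    · exact (Φ.symm.contMDiff.contMDiffOn).comp'
        (contMDiffOn_symm_of_mem_maximalAtlas h.domChart_mem_maximalAtlas)
  · intro y hy
    exact h.source_subset_preimage_source hy.2
  · refine eqOn_writtenInExtend fun y hy => ?_
    have h1 := h.writtenInCharts ((h.domChart.extend I₁).map_source
      (by rw [OpenPartialHomeomorph.extend_source]; exact hy.2))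
    simp only [Function.comp_apply] at h1
    rw [h.domChart.extend_left_inv hy.2] at h1
    exact h1

namespace TangentGroupoid

variable {n : ℕ} {M : Type*} [TopologicalSpace M] [ChartedSpace (EuclideanSpace ℝ (Fin n)) M]
  [IsManifold (𝓡 n) ∞ M]

/-- The source is the composition of the range with the inversion, which is a diffeomorphism. -/
theorem isSubmersionOfComplement_source :
    Manifold.IsSubmersionOfComplement (EuclideanSpace ℝ (Fin n))
      (slabModel (EuclideanSpace ℝ (Fin n))) ((𝓡 n).prod (𝓡∂ 1)) ∞
      (source : TangentGroupoid n M → M × Icc (0 : ℝ) 1) := by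
  have h := isSubmersionOfComplement_range (n := n) (M := M).comp_diffeomorph
    { toFun := inv, invFun := inv, left_inv := inv_inv, right_inv := inv_inv,
      contMDiff_toFun := contMDiff_inv, contMDiff_invFun := contMDiff_inv }
  have h' : range ∘ inv = (source : TangentGroupoid n M → _) := funext range_inv
  exact h' ▸ h

end TangentGroupoid

/-! ### Composable pairs -/

namespace TangentGroupoid

/-- The coordinate space of the composable pairs: the points `((x, v, w), t)`. -/
abbrev CompSlab (n : ℕ) : Type :=
  (EuclideanSpace ℝ (Fin n) × (EuclideanSpace ℝ (Fin n) × EuclideanSpace ℝ (Fin n))) ×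
    Icc (0 : ℝ) 1

variable {n : ℕ} {M : Type*} [TopologicalSpace M] [ChartedSpace (EuclideanSpace ℝ (Fin n)) M]

/-- The coordinates of the first arrow of a composable pair. -/
def firstCoords (z : CompSlab n) : Slab n := ((z.1.1, z.1.2.1), z.2)

/-- The coordinates of the second arrow of a composable pair. Its range is the source of the
first. -/
def secondCoords (z : CompSlab n) : Slab n := ((z.1.1 - (z.2 : ℝ) • z.1.2.1, z.1.2.2), z.2)

/-- The coordinates of the composition of a composable pair. -/
def mulCoords (z : CompSlab n) : Slab n := ((z.1.1, z.1.2.1 + z.1.2.2), z.2)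

/-- The domain of the parametrization of composable pairs by the charts around `p`, `q`, `r`. -/
def compSource (i : M × M × M) : Set (CompSlab n) :=
  {z | firstCoords z ∈ paramSource i.1 i.2.1 ∧ secondCoords z ∈ paramSource i.2.1 i.2.2}

/-- The image of the parametrization of composable pairs by the charts around `p`, `q`, `r`. -/
def compTarget (i : M × M × M) : Set (groupoid n M).Composable :=
  {y | y.1.1 ∈ paramTarget i.1 i.2.1 ∧ y.1.2 ∈ paramTarget i.2.1 i.2.2}

theorem composable_param {i : M × M × M} {z : CompSlab n} (hz : z ∈ compSource i) :
    source (param i.1 i.2.1 (firstCoords z)) = range (param i.2.1 i.2.2 (secondCoords z)) := by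
  rw [source_param hz.1, range_param]
  rfl

open Classical in
/-- The parametrization of composable pairs by the charts around three points; outside of its
domain it takes the value of a unit. -/
def compParam (i : M × M × M) (z : CompSlab n) : (groupoid n M).Composable :=
  if h : z ∈ compSource i then
    ⟨(param i.1 i.2.1 (firstCoords z), param i.2.1 i.2.2 (secondCoords z)), composable_param h⟩
  else ⟨(tangent i.1 0, tangent i.1 0), rfl⟩

theorem val_compParam {i : M × M × M} {z : CompSlab n} (hz : z ∈ compSource i) :
    (compParam i z).1 =
      (param i.1 i.2.1 (firstCoords z), param i.2.1 i.2.2 (secondCoords z)) := by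
  rw [compParam, dif_pos hz]

theorem contMDiffAt_compSlab_mk {H' E' X : Type*} [NormedAddCommGroup E'] [NormedSpace ℝ E']
    [TopologicalSpace H'] {I' : ModelWithCorners ℝ E' H'} [TopologicalSpace X] [ChartedSpace H' X]
    {f g h : X → EuclideanSpace ℝ (Fin n)} {τ : X → Icc (0 : ℝ) 1} {x : X}
    (hf : ContMDiffAt I' 𝓘(ℝ, EuclideanSpace ℝ (Fin n)) ∞ f x)
    (hg : ContMDiffAt I' 𝓘(ℝ, EuclideanSpace ℝ (Fin n)) ∞ g x)
    (hh : ContMDiffAt I' 𝓘(ℝ, EuclideanSpace ℝ (Fin n)) ∞ h x)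
    (hτ : ContMDiffAt I' (𝓡∂ 1) ∞ τ x) :
    ContMDiffAt I' (composableModel n) ∞ (fun y => (((f y, (g y, h y)), τ y) : CompSlab n)) x :=
  (hf.prodMk (hg.prodMk hh)).prodMk hτ

theorem contMDiff_firstCoords : ContMDiff (composableModel n)
    (slabModel (EuclideanSpace ℝ (Fin n))) ∞ (firstCoords (n := n)) :=
  ((contMDiff_fst.comp contMDiff_fst).prodMk
    (contMDiff_fst.comp (contMDiff_snd.comp contMDiff_fst))).prodMk contMDiff_snd

theorem contMDiff_secondCoords : ContMDiff (composableModel n)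
    (slabModel (EuclideanSpace ℝ (Fin n))) ∞ (secondCoords (n := n)) := by
  have hx : ContMDiff (composableModel n) 𝓘(ℝ, EuclideanSpace ℝ (Fin n)) ∞
      (fun z : CompSlab n => z.1.1) := contMDiff_fst.comp contMDiff_fst
  have hv : ContMDiff (composableModel n) 𝓘(ℝ, EuclideanSpace ℝ (Fin n)) ∞
      (fun z : CompSlab n => z.1.2.1) :=
    contMDiff_fst.comp (contMDiff_snd.comp contMDiff_fst)
  have hw : ContMDiff (composableModel n) 𝓘(ℝ, EuclideanSpace ℝ (Fin n)) ∞
      (fun z : CompSlab n => z.1.2.2) :=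
    contMDiff_snd.comp (contMDiff_snd.comp contMDiff_fst)
  have ht : ContMDiff (composableModel n) 𝓘(ℝ, ℝ) ∞
      (fun z : CompSlab n => (z.2 : ℝ)) := contMDiff_subtypeVal_Icc.comp contMDiff_snd
  exact ((hx.sub (ht.smul hv)).prodMk hw).prodMk contMDiff_snd

theorem contMDiff_mulCoords : ContMDiff (composableModel n)
    (slabModel (EuclideanSpace ℝ (Fin n))) ∞ (mulCoords (n := n)) := by
  have hx : ContMDiff (composableModel n) 𝓘(ℝ, EuclideanSpace ℝ (Fin n)) ∞
      (fun z : CompSlab n => z.1.1) := contMDiff_fst.comp contMDiff_fst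
  have hv : ContMDiff (composableModel n) 𝓘(ℝ, EuclideanSpace ℝ (Fin n)) ∞
      (fun z : CompSlab n => z.1.2.1) :=
    contMDiff_fst.comp (contMDiff_snd.comp contMDiff_fst)
  have hw : ContMDiff (composableModel n) 𝓘(ℝ, EuclideanSpace ℝ (Fin n)) ∞
      (fun z : CompSlab n => z.1.2.2) :=
    contMDiff_snd.comp (contMDiff_snd.comp contMDiff_fst)
  exact (hx.prodMk (hv.add hw)).prodMk contMDiff_snd

theorem isOpen_compSource (i : M × M × M) : IsOpen (compSource (n := n) i) :=
  ((isOpen_paramSource i.1 i.2.1).preimage contMDiff_firstCoords.continuous).inter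
    ((isOpen_paramSource i.2.1 i.2.2).preimage contMDiff_secondCoords.continuous)

/-- The centres of the charts used around a composable pair. -/
def compCenters (y : (groupoid n M).Composable) : M × M × M :=
  (y.1.1.centers.1, y.1.1.centers.2, y.1.2.centers.2)

theorem mem_compTarget_centers (y : (groupoid n M).Composable) :
    y ∈ compTarget (compCenters y) := by
  refine ⟨mem_paramTarget_centers _, ?_⟩
  have h : y.1.1.centers.2 = y.1.2.centers.1 := by
    obtain ⟨⟨⟨x, y, t⟩ | ⟨x, v⟩, ⟨x', y', t'⟩ | ⟨x', v'⟩⟩, h⟩ := y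
    · exact congrArg Prod.fst h
    · exact (not_composable h).elim
    · exact (not_composable h.symm).elim
    · exact congrArg Prod.fst h
  change y.1.2 ∈ paramTarget y.1.1.centers.2 y.1.2.centers.2
  rw [h]
  exact mem_paramTarget_centers _

theorem mulCoords_mem {i : M × M × M} {z : CompSlab n} (hz : z ∈ compSource i) :
    mulCoords z ∈ paramSource i.1 i.2.2 := by
  refine ⟨hz.1.1, ?_, ?_⟩
  · have : (mulCoords z).1.1 - ((mulCoords z).2 : ℝ) • (mulCoords z).1.2 =
        (secondCoords z).1.1 - ((secondCoords z).2 : ℝ) • (secondCoords z).1.2 := by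
      simp only [secondCoords, mulCoords, smul_add]
      abel
    rw [this]
    exact hz.2.2.1
  · rcases hz.1.2.2 with h | h
    · exact Or.inl h
    · exact hz.2.2.2.imp_right h.trans

/-- In coordinates, the composition is `((x, v, t), (x - t v, w, t)) ↦ (x, v + w, t)`. -/
theorem mul_compParam {i : M × M × M} {z : CompSlab n} (hz : z ∈ compSource i) :
    mul (compParam i z) = param i.1 i.2.2 (mulCoords z) := by
  have h0 : compParam i z = ⟨(param i.1 i.2.1 (firstCoords z),
      param i.2.1 i.2.2 (secondCoords z)), composable_param hz⟩ := Subtype.ext (val_compParam hz)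
  have key : ∀ (a b c d : TangentGroupoid n M) (h : source a = range b) (h' : source c = range d),
      a = c → b = d → mul ⟨(a, b), h⟩ = mul ⟨(c, d), h'⟩ := by
    rintro a b c d h h' rfl rfl
    rfl
  rw [h0]
  rcases eq_zero_or_pos z.2 with h | h
  · have e1 := param_of_eq_zero i.1 i.2.1 (z := firstCoords z) h
    have e2 := param_of_eq_zero i.2.1 i.2.2 (z := secondCoords z) h
    have hc := composable_param hz
    rw [e1, e2] at hc
    refine (key _ _ _ _ _ hc e1 e2).trans ((mul_tangent hc).trans ?_)
    rw [param_of_eq_zero i.1 i.2.2 (z := mulCoords z) h]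
    refine congrArg (tangent _) ?_
    have hpq : i.1 = i.2.1 := hz.1.2.2.resolve_left (by simp [firstCoords, h])
    have e3 : (chartFrame i.2.1 (secondCoords z).1.1 z.1.2.2 : EuclideanSpace ℝ (Fin n)) =
        chartFrame i.1 z.1.1 z.1.2.2 := by
      rw [← hpq]
      exact chartFrame_congr i.1 (by simp [secondCoords, h]) _
    refine Eq.trans ?_ (map_add (chartFrame i.1 z.1.1) z.1.2.1 z.1.2.2).symm
    have e4 : ∀ a b c : EuclideanSpace ℝ (Fin n), b = c → a + b = a + c := fun a b c h => h ▸ rfl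
    exact e4 _ _ _ e3
  · have e1 := param_of_pos i.1 i.2.1 (z := firstCoords z) h
    have e2 := param_of_pos i.2.1 i.2.2 (z := secondCoords z) h
    have hc := composable_param hz
    rw [e1, e2] at hc
    refine (key _ _ _ _ _ hc e1 e2).trans ?_
    rw [param_of_pos i.1 i.2.2 (z := mulCoords z) h]
    change pair _ _ _ = pair _ _ _
    congr 2
    simp only [secondCoords, mulCoords, smul_add]
    abel

variable [IsManifold (𝓡 n) ∞ M]

/-- The coordinates of a composable pair. -/
def compCoords (i : M × M × M) (y : (groupoid n M).Composable) : CompSlab n :=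
  (((coords i.1 i.2.1 y.1.1).1.1, ((coords i.1 i.2.1 y.1.1).1.2, (coords i.2.1 i.2.2 y.1.2).1.2)),
    (coords i.1 i.2.1 y.1.1).2)

theorem coords_param {p q : M} {z : Slab n} (hz : z ∈ paramSource p q) :
    coords p q (param p q z) = z := (paramEquiv p q).left_inv hz

theorem param_coords {p q : M} {a : TangentGroupoid n M} (ha : a ∈ paramTarget p q) :
    param p q (coords p q a) = a := (paramEquiv p q).right_inv ha

theorem coords_mem {p q : M} {a : TangentGroupoid n M} (ha : a ∈ paramTarget p q) :
    coords p q a ∈ paramSource p q := (paramEquiv p q).map_target ha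

theorem param_mem {p q : M} {z : Slab n} (hz : z ∈ paramSource p q) :
    param p q z ∈ paramTarget p q := (paramEquiv p q).map_source hz

theorem firstCoords_compCoords (i : M × M × M) (y : (groupoid n M).Composable) :
    firstCoords (compCoords i y) = coords i.1 i.2.1 y.1.1 := rfl

theorem secondCoords_compCoords {i : M × M × M} {y : (groupoid n M).Composable}
    (hy : y ∈ compTarget i) : secondCoords (compCoords i y) = coords i.2.1 i.2.2 y.1.2 := by
  have h : source y.1.1 = range y.1.2 := y.2
  rw [← param_coords hy.1, ← param_coords hy.2, source_param (coords_mem hy.1), range_param] at h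
  have h1 := (extChartAt (𝓡 n) i.2.1).symm.injOn (coords_mem hy.1).2.1 (coords_mem hy.2).1
    (congrArg Prod.fst h)
  have h2 := congrArg Prod.snd h
  exact Prod.ext (Prod.ext h1 rfl) h2

/-- The parametrization of composable pairs as a partial equivalence. -/
def compEquiv (i : M × M × M) : PartialEquiv (CompSlab n) (groupoid n M).Composable where
  toFun := compParam i
  invFun := compCoords i
  source := compSource i
  target := compTarget i
  map_source' z hz := by
    change _ ∧ _
    rw [val_compParam hz]
    exact ⟨param_mem hz.1, param_mem hz.2⟩
  map_target' y hy := by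
    refine ⟨coords_mem hy.1, ?_⟩
    rw [secondCoords_compCoords hy]
    exact coords_mem hy.2
  left_inv' z hz := by
    rw [compCoords, val_compParam hz, coords_param hz.1, coords_param hz.2]
    rfl
  right_inv' y hy := by
    refine Subtype.ext ?_
    have hz : compCoords i y ∈ compSource i := by
      refine ⟨coords_mem hy.1, ?_⟩
      rw [secondCoords_compCoords hy]
      exact coords_mem hy.2
    rw [val_compParam hz, secondCoords_compCoords hy, firstCoords_compCoords, param_coords hy.1,
      param_coords hy.2]

theorem isOpen_paramTarget (p q : M) : IsOpen (paramTarget (n := n) p q) :=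
  (paramHomeomorph (p, q)).open_target

theorem isOpen_compTarget (i : M × M × M) : IsOpen (compTarget (n := n) i) :=
  ((isOpen_paramTarget i.1 i.2.1).preimage (continuous_fst.comp continuous_subtype_val)).inter
    ((isOpen_paramTarget i.2.1 i.2.2).preimage (continuous_snd.comp continuous_subtype_val))

theorem contMDiffAt_coords {p q : M} {a : TangentGroupoid n M} (ha : a ∈ paramTarget p q) :
    ContMDiffAt (slabModel (EuclideanSpace ℝ (Fin n))) (slabModel (EuclideanSpace ℝ (Fin n))) ∞
      (coords p q) a :=
  (paramDiffeomorph p q).contMDiffOn_invFun.contMDiffAt ((isOpen_paramTarget p q).mem_nhds ha)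

theorem contMDiffAt_pair_compParam {i : M × M × M} {z : CompSlab n} (hz : z ∈ compSource i) :
    ContMDiffAt (composableModel n) ((slabModel (EuclideanSpace ℝ (Fin n))).prod
      (slabModel (EuclideanSpace ℝ (Fin n)))) ∞
      (fun z => (param i.1 i.2.1 (firstCoords z), param i.2.1 i.2.2 (secondCoords z))) z :=
  ((isLocalDiffeomorphAt_param hz.1).contMDiffAt.comp z contMDiff_firstCoords.contMDiffAt).prodMk
    ((isLocalDiffeomorphAt_param hz.2).contMDiffAt.comp z contMDiff_secondCoords.contMDiffAt)

/-- The parametrizations of the space of composable pairs are homeomorphisms onto open subsets for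
the subspace topology. -/
def compHomeomorph (i : M × M × M) :
    OpenPartialHomeomorph (CompSlab n) (groupoid n M).Composable where
  toPartialEquiv := compEquiv i
  open_source := isOpen_compSource i
  open_target := isOpen_compTarget i
  continuousOn_toFun := by
    have hi : Topology.IsInducing (Subtype.val : (groupoid n M).Composable → _) :=
      Topology.IsInducing.subtypeVal
    refine hi.continuousOn_iff.2 ?_
    intro z hz
    refine (contMDiffAt_pair_compParam hz).continuousAt.continuousWithinAt.congr
      (fun y hy => val_compParam hy) (val_compParam hz)
  continuousOn_invFun := by
    intro y hy
    have h1 : ContinuousAt (fun y : (groupoid n M).Composable => coords i.1 i.2.1 y.1.1) y :=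
      ContinuousAt.comp (g := coords i.1 i.2.1) (contMDiffAt_coords hy.1).continuousAt
        (continuous_fst.comp continuous_subtype_val).continuousAt
    have h2 : ContinuousAt (fun y : (groupoid n M).Composable => coords i.2.1 i.2.2 y.1.2) y :=
      ContinuousAt.comp (g := coords i.2.1 i.2.2) (contMDiffAt_coords hy.2).continuousAt
        (continuous_snd.comp continuous_subtype_val).continuousAt
    exact ((h1.fst.fst.prodMk (h1.fst.snd.prodMk h2.fst.snd)).prodMk h1.snd).continuousWithinAt

/-- The atlas of the space of composable pairs. -/
@[reducible] def compChartedSpace :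
    ChartedSpace (ModelProd (ModelProd (EuclideanSpace ℝ (Fin n))
      (ModelProd (EuclideanSpace ℝ (Fin n)) (EuclideanSpace ℝ (Fin n)))) (EuclideanHalfSpace 1))
      (groupoid n M).Composable :=
  chartedSpaceOfCover compHomeomorph compCenters mem_compTarget_centers

theorem contMDiffOn_compTransition (i j : M × M × M) :
    ContMDiffOn (composableModel n) (composableModel n) ∞
      (fun z => (compHomeomorph (n := n) j).symm (compHomeomorph i z))
      ((compHomeomorph i).source ∩ compHomeomorph i ⁻¹' (compHomeomorph j).target) := by
  rintro z ⟨hz, hz'⟩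
  have hz1 : z ∈ compSource i := hz
  have hz2 : compParam i z ∈ compTarget j := hz'
  have h1 : ContMDiffAt (composableModel n) (slabModel (EuclideanSpace ℝ (Fin n))) ∞
      (fun z => coords j.1 j.2.1 (param i.1 i.2.1 (firstCoords z))) z := by
    have := hz2.1
    rw [val_compParam hz1] at this
    exact (contMDiffAt_coords this).comp z ((isLocalDiffeomorphAt_param hz1.1).contMDiffAt.comp z
      contMDiff_firstCoords.contMDiffAt)
  have h2 : ContMDiffAt (composableModel n) (slabModel (EuclideanSpace ℝ (Fin n))) ∞
      (fun z => coords j.2.1 j.2.2 (param i.2.1 i.2.2 (secondCoords z))) z := by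
    have := hz2.2
    rw [val_compParam hz1] at this
    exact (contMDiffAt_coords this).comp z ((isLocalDiffeomorphAt_param hz1.2).contMDiffAt.comp z
      contMDiff_secondCoords.contMDiffAt)
  have h11 : ContMDiff (slabModel (EuclideanSpace ℝ (Fin n))) 𝓘(ℝ, EuclideanSpace ℝ (Fin n)) ∞
    (fun z : Slab n => z.1.1) := contMDiff_fst.comp contMDiff_fst
  have h12 : ContMDiff (slabModel (EuclideanSpace ℝ (Fin n))) 𝓘(ℝ, EuclideanSpace ℝ (Fin n)) ∞
    (fun z : Slab n => z.1.2) := contMDiff_snd.comp contMDiff_fst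
  have h3 := contMDiffAt_compSlab_mk (h11.contMDiffAt.comp z h1) (h12.contMDiffAt.comp z h1)
    (h12.contMDiffAt.comp z h2) (contMDiffAt_snd.comp z h1)
  refine (h3.congr_of_eventuallyEq ?_).contMDiffWithinAt
  filter_upwards [(isOpen_compSource i).mem_nhds hz1] with y hy
  change compCoords j (compParam i y) = _
  rw [compCoords, val_compParam hy]
  rfl

theorem isManifold_composable :
    letI := compChartedSpace (n := n) (M := M)
    IsManifold (composableModel n) ∞ (groupoid n M).Composable :=
  isManifold_of_cover compHomeomorph compCenters mem_compTarget_centers contMDiffOn_compTransition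

/-- The parametrizations of the space of composable pairs as diffeomorphisms onto open subsets. -/
def compDiffeomorph (i : M × M × M) :
    letI := compChartedSpace (n := n) (M := M)
    PartialDiffeomorph (composableModel n) (composableModel n) (CompSlab n)
      (groupoid n M).Composable ∞ :=
  coverDiffeomorph compHomeomorph compCenters mem_compTarget_centers contMDiffOn_compTransition i

theorem exists_compParam (y : (groupoid n M).Composable) :
    ∃ i, ∃ z ∈ compSource i, compParam i z = y :=
  ⟨_, _, (compEquiv _).map_target (mem_compTarget_centers y),
    (compEquiv _).right_inv (mem_compTarget_centers y)⟩

theorem contMDiff_mul :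
    letI := compChartedSpace (n := n) (M := M)
    ContMDiff (composableModel n) (slabModel (EuclideanSpace ℝ (Fin n))) ∞
      (groupoid n M).m := by
  let _ := compChartedSpace (n := n) (M := M)
  intro y
  obtain ⟨i, z, hz, rfl⟩ := exists_compParam y
  have h : IsLocalDiffeomorphAt (composableModel n) (composableModel n) ∞ (compParam i) z :=
    ⟨compDiffeomorph i, hz, fun _ _ => rfl⟩
  refine h.contMDiffAt_of_comp ?_
  refine ((isLocalDiffeomorphAt_param (mulCoords_mem hz)).contMDiffAt.comp z
    contMDiff_mulCoords.contMDiffAt).congr_of_eventuallyEq ?_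
  filter_upwards [(isOpen_compSource i).mem_nhds hz] with y hy
  exact mul_compParam hy

end TangentGroupoid

/-! ### The space of composable pairs as an embedded submanifold -/

namespace TangentGroupoid

variable {n : ℕ} {M : Type*} [TopologicalSpace M] [ChartedSpace (EuclideanSpace ℝ (Fin n)) M]
  [IsManifold (𝓡 n) ∞ M]

/-- The coordinates of the range of the second arrow, relative to the source of the first. -/
def shear (w : Slab n × Slab n) : Slab n :=
  ((w.2.1.1 + (w.1.1.1 - (w.1.2 : ℝ) • w.1.1.2), w.2.1.2), w.2.2)

/-- The inverse of `shear`, for a fixed first arrow. -/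
def unshear (w : Slab n × Slab n) : Slab n :=
  ((w.2.1.1 - (w.1.1.1 - (w.1.2 : ℝ) • w.1.1.2), w.2.1.2), w.2.2)

theorem shear_unshear (z z' : Slab n) : shear (z, unshear (z, z')) = z' := by
  simp [shear, unshear]

theorem unshear_shear (z z' : Slab n) : unshear (z, shear (z, z')) = z' := by
  simp [shear, unshear]

theorem contMDiff_source_coord :
    ContMDiff ((slabModel (EuclideanSpace ℝ (Fin n))).prod (slabModel (EuclideanSpace ℝ (Fin n))))
      𝓘(ℝ, EuclideanSpace ℝ (Fin n)) ∞
      (fun w : Slab n × Slab n => w.1.1.1 - (w.1.2 : ℝ) • w.1.1.2) := by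
  have h : ContMDiff (slabModel (EuclideanSpace ℝ (Fin n))) 𝓘(ℝ, EuclideanSpace ℝ (Fin n)) ∞
      (fun w : Slab n => w.1.1 - (w.2 : ℝ) • w.1.2) := by
    have h1 : ContMDiff (slabModel (EuclideanSpace ℝ (Fin n))) 𝓘(ℝ, EuclideanSpace ℝ (Fin n)) ∞
      (fun z : Slab n => z.1.1) := contMDiff_fst.comp contMDiff_fst
    have h2 : ContMDiff (slabModel (EuclideanSpace ℝ (Fin n))) 𝓘(ℝ, EuclideanSpace ℝ (Fin n)) ∞
      (fun z : Slab n => z.1.2) := contMDiff_snd.comp contMDiff_fst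
    have ht : ContMDiff (slabModel (EuclideanSpace ℝ (Fin n))) 𝓘(ℝ, ℝ) ∞
      (fun z : Slab n => (z.2 : ℝ)) := contMDiff_subtypeVal_Icc.comp contMDiff_snd
    exact h1.sub (ht.smul h2)
  exact h.comp contMDiff_fst

theorem contMDiff_shear :
    ContMDiff ((slabModel (EuclideanSpace ℝ (Fin n))).prod (slabModel (EuclideanSpace ℝ (Fin n))))
      (slabModel (EuclideanSpace ℝ (Fin n))) ∞ (shear (n := n)) := by
  have h1 : ContMDiff (slabModel (EuclideanSpace ℝ (Fin n))) 𝓘(ℝ, EuclideanSpace ℝ (Fin n)) ∞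
    (fun z : Slab n => z.1.1) := contMDiff_fst.comp contMDiff_fst
  have h2 : ContMDiff (slabModel (EuclideanSpace ℝ (Fin n))) 𝓘(ℝ, EuclideanSpace ℝ (Fin n)) ∞
    (fun z : Slab n => z.1.2) := contMDiff_snd.comp contMDiff_fst
  exact (((h1.comp contMDiff_snd).add contMDiff_source_coord).prodMk
    (h2.comp contMDiff_snd)).prodMk (contMDiff_snd.comp contMDiff_snd)

theorem contMDiff_unshear :
    ContMDiff ((slabModel (EuclideanSpace ℝ (Fin n))).prod (slabModel (EuclideanSpace ℝ (Fin n))))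
      (slabModel (EuclideanSpace ℝ (Fin n))) ∞ (unshear (n := n)) := by
  have h1 : ContMDiff (slabModel (EuclideanSpace ℝ (Fin n))) 𝓘(ℝ, EuclideanSpace ℝ (Fin n)) ∞
    (fun z : Slab n => z.1.1) := contMDiff_fst.comp contMDiff_fst
  have h2 : ContMDiff (slabModel (EuclideanSpace ℝ (Fin n))) 𝓘(ℝ, EuclideanSpace ℝ (Fin n)) ∞
    (fun z : Slab n => z.1.2) := contMDiff_snd.comp contMDiff_fst
  exact (((h1.comp contMDiff_snd).sub contMDiff_source_coord).prodMk
    (h2.comp contMDiff_snd)).prodMk (contMDiff_snd.comp contMDiff_snd)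

/-- A parametrization of pairs of arrows in which the composable pairs are the points
`(((x, v), t), ((0, w), t))`. -/
def pairDiffeomorph (i : M × M × M) :
    PartialDiffeomorph ((slabModel (EuclideanSpace ℝ (Fin n))).prod
      (slabModel (EuclideanSpace ℝ (Fin n)))) ((slabModel (EuclideanSpace ℝ (Fin n))).prod
      (slabModel (EuclideanSpace ℝ (Fin n)))) (Slab n × Slab n)
      (TangentGroupoid n M × TangentGroupoid n M) ∞ where
  toFun w := (param i.1 i.2.1 w.1, param i.2.1 i.2.2 (shear w))
  invFun a := (coords i.1 i.2.1 a.1, unshear (coords i.1 i.2.1 a.1, coords i.2.1 i.2.2 a.2))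
  source := {w | w.1 ∈ paramSource i.1 i.2.1 ∧ shear w ∈ paramSource i.2.1 i.2.2}
  target := paramTarget i.1 i.2.1 ×ˢ paramTarget i.2.1 i.2.2
  map_source' w hw := ⟨param_mem hw.1, param_mem hw.2⟩
  map_target' a ha := by
    refine ⟨coords_mem ha.1, ?_⟩
    rw [shear_unshear]
    exact coords_mem ha.2
  left_inv' w hw := by
    rw [coords_param hw.1, coords_param hw.2]
    exact Prod.ext rfl (unshear_shear w.1 w.2)
  right_inv' a ha := by
    rw [shear_unshear, param_coords ha.1, param_coords ha.2]
  open_source := ((isOpen_paramSource i.1 i.2.1).preimage continuous_fst).inter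
    ((isOpen_paramSource i.2.1 i.2.2).preimage contMDiff_shear.continuous)
  open_target := (isOpen_paramTarget i.1 i.2.1).prod (isOpen_paramTarget i.2.1 i.2.2)
  contMDiffOn_toFun w hw :=
    (((isLocalDiffeomorphAt_param hw.1).contMDiffAt.comp w contMDiffAt_fst).prodMk
      ((isLocalDiffeomorphAt_param hw.2).contMDiffAt.comp w
        contMDiff_shear.contMDiffAt)).contMDiffWithinAt
  contMDiffOn_invFun a ha := by
    have h1 : ContMDiffAt ((slabModel (EuclideanSpace ℝ (Fin n))).prod
        (slabModel (EuclideanSpace ℝ (Fin n)))) (slabModel (EuclideanSpace ℝ (Fin n))) ∞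
        (fun a : TangentGroupoid n M × TangentGroupoid n M => coords i.1 i.2.1 a.1) a :=
      (contMDiffAt_coords ha.1).comp a contMDiffAt_fst
    have h2 : ContMDiffAt ((slabModel (EuclideanSpace ℝ (Fin n))).prod
        (slabModel (EuclideanSpace ℝ (Fin n)))) (slabModel (EuclideanSpace ℝ (Fin n))) ∞
        (fun a : TangentGroupoid n M × TangentGroupoid n M => coords i.2.1 i.2.2 a.2) a :=
      (contMDiffAt_coords ha.2).comp a contMDiffAt_snd
    exact (h1.prodMk (contMDiff_unshear.contMDiffAt.comp a (h1.prodMk h2))).contMDiffWithinAt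

theorem shear_compSource (z : CompSlab n) :
    shear (firstCoords z, (((0 : EuclideanSpace ℝ (Fin n)), z.1.2.2), z.2)) = secondCoords z := by
  simp [shear, firstCoords, secondCoords]

/-- In the charts given by `compDiffeomorph` and `pairDiffeomorph`, the inclusion of the space of
composable pairs is `((x, v, w), t) ↦ (((x, v), t), ((0, w), t))`. -/
theorem isSmoothEmbedding_composable :
    letI := compChartedSpace (n := n) (M := M)
    IsSmoothEmbedding (composableModel n) ((slabModel (EuclideanSpace ℝ (Fin n))).prod
      (slabModel (EuclideanSpace ℝ (Fin n)))) ∞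
      (Subtype.val : (groupoid n M).Composable → TangentGroupoid n M × TangentGroupoid n M) := by
  let _ := compChartedSpace (n := n) (M := M)
  have _ := isManifold_composable (n := n) (M := M)
  refine ⟨Manifold.IsImmersionOfComplement.isImmersion
    (F := EuclideanSpace ℝ (Fin n) × EuclideanSpace ℝ (Fin 1)) fun y => ?_,
    Topology.IsEmbedding.subtypeVal⟩
  obtain ⟨i, z, hz, rfl⟩ := exists_compParam y
  -- the normal directions are the first and the last coordinate of the second arrow
  let e : (((EuclideanSpace ℝ (Fin n) × EuclideanSpace ℝ (Fin n) × EuclideanSpace ℝ (Fin n)) ×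
      EuclideanSpace ℝ (Fin 1)) × (EuclideanSpace ℝ (Fin n) × EuclideanSpace ℝ (Fin 1))) ≃L[ℝ]
      (((EuclideanSpace ℝ (Fin n) × EuclideanSpace ℝ (Fin n)) × EuclideanSpace ℝ (Fin 1)) ×
      ((EuclideanSpace ℝ (Fin n) × EuclideanSpace ℝ (Fin n)) × EuclideanSpace ℝ (Fin 1))) :=
    LinearEquiv.toContinuousLinearEquiv
      { toFun := fun a => (((a.1.1.1, a.1.1.2.1), a.1.2), ((a.2.1, a.1.1.2.2), a.1.2 + a.2.2))
        invFun := fun b => (((b.1.1.1, b.1.1.2, b.2.1.2), b.1.2), (b.2.1.1, b.2.2 - b.1.2))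
        map_add' := fun a b => by
          refine Prod.ext rfl (Prod.ext rfl ?_)
          exact add_add_add_comm _ _ _ _
        map_smul' := fun c a => Prod.ext rfl (Prod.ext rfl (smul_add c _ _).symm)
        left_inv := fun a => by simp
        right_inv := fun b => by simp }
  have hmem : ∀ y ∈ compTarget i, ∃ z ∈ compSource (n := n) i, compParam i z = y := fun y hy =>
    ⟨_, (compEquiv i).map_target hy, (compEquiv i).right_inv hy⟩
  have hcomp : ∀ z ∈ compSource (n := n) i,
      (compDiffeomorph i).toOpenPartialHomeomorph.symm (compParam (M := M) i z) = z :=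
    fun z hz => (compEquiv i).left_inv hz
  have hpair : ∀ z ∈ compSource (n := n) i,
      (firstCoords z, (((0 : EuclideanSpace ℝ (Fin n)), z.1.2.2), z.2)) ∈
        (pairDiffeomorph i).source ∧ (pairDiffeomorph i).toOpenPartialHomeomorph
        (firstCoords z, (((0 : EuclideanSpace ℝ (Fin n)), z.1.2.2), z.2)) =
        (compParam (M := M) i z).1 := fun z hz => by
    refine ⟨⟨hz.1, ?_⟩, ?_⟩
    · rw [shear_compSource]
      exact hz.2
    · rw [val_compParam hz, ← shear_compSource z]
      rfl
  have hpair' : ∀ z ∈ compSource (n := n) i,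
      (pairDiffeomorph i).toOpenPartialHomeomorph.symm (compParam (M := M) i z).1 =
        (firstCoords z, (((0 : EuclideanSpace ℝ (Fin n)), z.1.2.2), z.2)) := fun z hz => by
    rw [← (hpair z hz).2]
    exact (pairDiffeomorph i).toOpenPartialHomeomorph.left_inv (hpair z hz).1
  refine Manifold.IsImmersionAtOfComplement.mk_of_continuousAt continuous_subtype_val.continuousAt
    e ((compDiffeomorph i).toOpenPartialHomeomorph.symm.trans (chartAt _ z))
    ((pairDiffeomorph i).toOpenPartialHomeomorph.symm.trans (chartAt _
      (firstCoords z, (((0 : EuclideanSpace ℝ (Fin n)), z.1.2.2), z.2)))) ?_ ?_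
    ((compDiffeomorph i).symm_trans_chartAt_mem_maximalAtlas z)
    ((pairDiffeomorph i).symm_trans_chartAt_mem_maximalAtlas _) ?_
  · rw [OpenPartialHomeomorph.trans_source]
    refine ⟨(compEquiv i).map_source hz, ?_⟩
    rw [Set.mem_preimage, hcomp z hz]
    exact mem_chart_source _ z
  · rw [OpenPartialHomeomorph.trans_source]
    refine ⟨?_, ?_⟩
    · rw [← (hpair z hz).2]
      exact (pairDiffeomorph i).map_source' (hpair z hz).1
    rw [Set.mem_preimage, hpair' z hz]
    exact mem_chart_source _ _
  · refine eqOn_writtenInExtend fun y hy => ?_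
    obtain ⟨z', hz', rfl⟩ := hmem y hy.1
    have h1 : (((compDiffeomorph i).toOpenPartialHomeomorph.symm.trans
        (chartAt _ z)).extend (composableModel n)) (compParam i z') =
        (z'.1, (𝓡∂ 1) (chartAt _ z.2 z'.2)) := by
      change (composableModel n) (chartAt _ z
        ((compDiffeomorph i).toOpenPartialHomeomorph.symm (compParam i z'))) = _
      rw [hcomp z' hz']
      rfl
    have h2 : (((pairDiffeomorph i).toOpenPartialHomeomorph.symm.trans (chartAt _
        (firstCoords z, (((0 : EuclideanSpace ℝ (Fin n)), z.1.2.2), z.2)))).extend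
        ((slabModel (EuclideanSpace ℝ (Fin n))).prod (slabModel (EuclideanSpace ℝ (Fin n)))))
        (compParam (M := M) i z').1 =
        (((z'.1.1, z'.1.2.1), (𝓡∂ 1) (chartAt _ z.2 z'.2)),
          ((0, z'.1.2.2), (𝓡∂ 1) (chartAt _ z.2 z'.2))) := by
      change ((slabModel (EuclideanSpace ℝ (Fin n))).prod (slabModel (EuclideanSpace ℝ (Fin n))))
        (chartAt _ (firstCoords z, (((0 : EuclideanSpace ℝ (Fin n)), z.1.2.2), z.2))
        ((pairDiffeomorph i).toOpenPartialHomeomorph.symm (compParam (M := M) i z').1)) = _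
      rw [hpair' z' hz']
      rfl
    rw [h1, h2]
    exact Prod.ext rfl (Prod.ext rfl (add_zero _).symm)

/-- The tangent groupoid is a Lie groupoid for the smooth structure given by the
parametrizations. -/
theorem isLieGroupoid (n : ℕ) (M : Type*) [TopologicalSpace M] [T2Space M] [CompactSpace M]
    [ChartedSpace (EuclideanSpace ℝ (Fin n)) M] [IsManifold (𝓡 n) ∞ M] :
    (groupoid n M).IsLieGroupoid ((𝓡 n).prod (𝓡∂ 1)) (slabModel (EuclideanSpace ℝ (Fin n)))
      (composableModel n) where
  isGroupoid := isGroupoid n M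
  isManifold_obj := inferInstance
  isManifold_arr := inferInstance
  secondCountable_obj := by
    have : SecondCountableTopology M :=
      ChartedSpace.secondCountable_of_sigmaCompact (EuclideanSpace ℝ (Fin n)) M
    infer_instance
  secondCountable_arr := secondCountableTopology n M
  smooth_r := contMDiff_range
  smooth_s := contMDiff_source
  smooth_u := contMDiff_unit
  smooth_i := contMDiff_inv
  submersion_r := isSubmersionOfComplement_range.isSubmersion
  submersion_s := isSubmersionOfComplement_source.isSubmersion
  smooth_m := ⟨compChartedSpace, isManifold_composable, isSmoothEmbedding_composable,
    contMDiff_mul⟩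

end TangentGroupoid

/-! ### Christoffel symbols and the geodesic equation in a chart -/

section Christoffel

-- instances on spaces of bilinear and trilinear forms are nested deeply
set_option maxSynthPendingDepth 3

variable {E : Type*} [NormedAddCommGroup E] [NormedSpace ℝ E]

/-- The Christoffel symbols of the first kind of a family `G` of bilinear forms. -/
def christoffel (G : E → E →L[ℝ] E →L[ℝ] ℝ) (y a b c : E) : ℝ :=
  (fderiv ℝ G y a b c + fderiv ℝ G y b a c - fderiv ℝ G y c a b) / 2

/-- The linear form `c ↦ Γ(v, v, c)`. -/
def christoffelForm (G : E → E →L[ℝ] E →L[ℝ] ℝ) (q : E × E) : E →L[ℝ] ℝ :=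
  fderiv ℝ G q.1 q.2 q.2 - (2 : ℝ)⁻¹ • ((fderiv ℝ G q.1).flip q.2).flip q.2

theorem christoffelForm_apply (G : E → E →L[ℝ] E →L[ℝ] ℝ) (y v c : E) :
    christoffelForm G (y, v) c = christoffel G y v v c := by
  simp [christoffelForm, christoffel]
  ring

/-- The acceleration `u'' = A(u, u')` prescribed by the geodesic equation of the metric `G`.
(The inverse is zero where `G` is degenerate.) -/
def geodesicAcceleration (G : E → E →L[ℝ] E →L[ℝ] ℝ) (q : E × E) : E :=
  -(G q.1).inverse (christoffelForm G q)

/-- `G` is a smooth family of scalar products on `s`. -/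
structure IsMetricOn (G : E → E →L[ℝ] E →L[ℝ] ℝ) (s : Set E) : Prop where
  contDiffOn : ContDiffOn ℝ ∞ G s
  symm : ∀ y ∈ s, ∀ a b, G y a b = G y b a
  pos : ∀ y ∈ s, ∀ a, a ≠ 0 → 0 < G y a a

theorem geodesicAcceleration_smul (G : E → E →L[ℝ] E →L[ℝ] ℝ) (y v : E) (t : ℝ) :
    geodesicAcceleration G (y, t • v) = t ^ 2 • geodesicAcceleration G (y, v) := by
  have : christoffelForm G (y, t • v) = t ^ 2 • christoffelForm G (y, v) := by
    ext c
    simp [christoffelForm]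
    ring
  simp only [geodesicAcceleration]
  rw [this, map_smul, smul_neg]

variable [FiniteDimensional ℝ E] {G : E → E →L[ℝ] E →L[ℝ] ℝ} {s : Set E}

theorem IsMetricOn.exists_equiv (hG : IsMetricOn G s) {y : E} (hy : y ∈ s) :
    ∃ e : E ≃L[ℝ] (E →L[ℝ] ℝ), (e : E →L[ℝ] (E →L[ℝ] ℝ)) = G y := by
  have hinj : Function.Injective (G y) := by
    rw [injective_iff_map_eq_zero]
    intro a ha
    by_contra h
    have := hG.pos y hy a h
    rw [ha] at this
    simp at this
  have hdim : Module.finrank ℝ E = Module.finrank ℝ (E →L[ℝ] ℝ) := by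
    rw [← (LinearMap.toContinuousLinearMap (𝕜 := ℝ) (E := E) (F' := ℝ)).finrank_eq]
    exact (Subspace.dual_finrank_eq).symm
  refine ⟨(LinearEquiv.ofInjectiveOfFinrankEq (G y : E →ₗ[ℝ] (E →L[ℝ] ℝ)) hinj
    hdim).toContinuousLinearEquiv, ?_⟩
  ext a b
  rfl

/-- A metric is nondegenerate, so that the geodesic equation can be solved for the second
derivative. -/
theorem IsMetricOn.geodesicEquation_iff (hG : IsMetricOn G s) {y : E} (hy : y ∈ s) (v a : E) :
    (∀ c, G y a c + christoffel G y v v c = 0) ↔ a = geodesicAcceleration G (y, v) := by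
  obtain ⟨e, he⟩ := hG.exists_equiv hy
  have h1 : (∀ c, G y a c + christoffel G y v v c = 0) ↔ G y a = -christoffelForm G (y, v) := by
    rw [ContinuousLinearMap.ext_iff]
    refine forall_congr' fun c => ?_
    rw [neg_apply, christoffelForm_apply, eq_neg_iff_add_eq_zero]
  rw [h1, geodesicAcceleration, ← he, ContinuousLinearMap.inverse_equiv]
  simp only [ContinuousLinearEquiv.coe_coe]
  rw [← map_neg, ContinuousLinearEquiv.eq_symm_apply]

theorem IsMetricOn.contDiffAt_geodesicAcceleration (hG : IsMetricOn G s) (hs : IsOpen s) {y : E}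
    (hy : y ∈ s) (v : E) : ContDiffAt ℝ ∞ (geodesicAcceleration G) (y, v) := by
  obtain ⟨e, he⟩ := hG.exists_equiv hy
  have hG0 : ContDiffAt ℝ ∞ G y := hG.contDiffOn.contDiffAt (hs.mem_nhds hy)
  have h1 : ContDiffAt ℝ ∞ (fun q : E × E => G q.1) (y, v) := hG0.comp (y, v) contDiffAt_fst
  have h2 : ContDiffAt ℝ ∞ (fun q : E × E => fderiv ℝ G q.1) (y, v) :=
    (hG0.fderiv_right (m := ∞) (by simp)).comp (y, v) contDiffAt_fst
  have h3 : ContDiffAt ℝ ∞ (fun q : E × E => (G q.1).inverse) (y, v) := by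
    have h4 : ContDiffAt ℝ ∞ (ContinuousLinearMap.inverse (R := ℝ) (M := E) (M₂ := E →L[ℝ] ℝ))
        (G y) := he ▸ contDiffAt_map_inverse e
    exact h4.comp (y, v) h1
  have h5 : ContDiffAt ℝ ∞ (christoffelForm G) (y, v) := by
    have h6 : ContDiffAt ℝ ∞ (fun q : E × E => (fderiv ℝ G q.1).flip) (y, v) :=
      (ContinuousLinearMap.flipₗᵢ ℝ E E (E →L[ℝ] ℝ)).contDiff.contDiffAt.comp _ h2
    have h7 : ContDiffAt ℝ ∞ (fun q : E × E => (fderiv ℝ G q.1).flip q.2) (y, v) :=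
      h6.clm_apply contDiffAt_snd
    have h8 : ContDiffAt ℝ ∞ (fun q : E × E => ((fderiv ℝ G q.1).flip q.2).flip) (y, v) :=
      (ContinuousLinearMap.flipₗᵢ ℝ E E ℝ).contDiff.contDiffAt.comp _ h7
    exact ((h2.clm_apply contDiffAt_snd).clm_apply contDiffAt_snd).sub
      ((h8.clm_apply contDiffAt_snd).const_smul _)
  exact (h3.clm_apply h5).neg

/-- The acceleration is quadratic in the velocity, hence vanishes to second order at velocity
zero. -/
theorem IsMetricOn.fderiv_geodesicAcceleration (hG : IsMetricOn G s) (hs : IsOpen s) {y : E}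
    (hy : y ∈ s) : HasFDerivAt (geodesicAcceleration G) (0 : E × E →L[ℝ] E) (y, 0) := by
  have hd := ((hG.contDiffAt_geodesicAcceleration hs hy 0).differentiableAt (by simp)).hasFDerivAt
  have hz : ∀ x, geodesicAcceleration G (x, 0) = 0 := fun x => by
    simpa using geodesicAcceleration_smul G x 0 0
  suffices h : fderiv ℝ (geodesicAcceleration G) (y, 0) = 0 by rwa [h] at hd
  refine ContinuousLinearMap.prod_ext (ContinuousLinearMap.ext fun a => ?_)
    (ContinuousLinearMap.ext fun a => ?_)
  · have h1 : HasDerivAt (fun t : ℝ => ((y + t • a, 0) : E × E)) (a, 0) 0 := by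
      have := (((hasDerivAt_id (0 : ℝ)).smul_const a).const_add y).prodMk
        (hasDerivAt_const (0 : ℝ) (0 : E))
      simpa using this
    have h2 := HasFDerivAt.comp_hasDerivAt (0 : ℝ) (by simpa using hd) h1
    have h3 := h2.unique ((hasDerivAt_const (0 : ℝ) (0 : E)).congr_of_eventuallyEq
      (Filter.Eventually.of_forall fun t => hz _))
    simpa using h3
  · have h1 : HasDerivAt (fun t : ℝ => ((y, t • a) : E × E)) (0, a) 0 := by
      have := (hasDerivAt_const (0 : ℝ) y).prodMk ((hasDerivAt_id (0 : ℝ)).smul_const a)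
      simpa using this
    have h2 := HasFDerivAt.comp_hasDerivAt (0 : ℝ) (by simpa using hd) h1
    have h4 : HasDerivAt (fun t : ℝ => t ^ 2 • geodesicAcceleration G (y, a)) 0 0 := by
      have := (hasDerivAt_pow 2 (0 : ℝ)).smul_const (geodesicAcceleration G (y, a))
      simpa using this
    have h3 := h2.unique (h4.congr_of_eventuallyEq
      (Filter.Eventually.of_forall fun t => geodesicAcceleration_smul G y a t))
    simpa using h3

end Christoffel

section Transformation

set_option maxSynthPendingDepth 3

variable {E : Type*} [NormedAddCommGroup E] [NormedSpace ℝ E]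

/-- The derivative of the pullback of a family of bilinear forms. -/
theorem fderiv_pullback_apply {G₁ G₂ : E → E →L[ℝ] E →L[ℝ] ℝ} {ψ : E → E} {y : E}
    (hψ : ContDiffAt ℝ 2 ψ y) (hG₁ : DifferentiableAt ℝ G₁ y) (hG₂ : DifferentiableAt ℝ G₂ (ψ y))
    (h : ∀ᶠ z in 𝓝 y, ∀ a b, G₁ z a b = G₂ (ψ z) (fderiv ℝ ψ z a) (fderiv ℝ ψ z b)) (a b c : E) :
    fderiv ℝ G₁ y a b c =
      fderiv ℝ G₂ (ψ y) (fderiv ℝ ψ y a) (fderiv ℝ ψ y b) (fderiv ℝ ψ y c) +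
      G₂ (ψ y) (fderiv ℝ (fderiv ℝ ψ) y a b) (fderiv ℝ ψ y c) +
      G₂ (ψ y) (fderiv ℝ ψ y b) (fderiv ℝ (fderiv ℝ ψ) y a c) := by
  have h1 : HasFDerivAt ψ (fderiv ℝ ψ y) y := (hψ.differentiableAt (by simp)).hasFDerivAt
  have h2 : HasFDerivAt (fderiv ℝ ψ) (fderiv ℝ (fderiv ℝ ψ) y) y :=
    ((hψ.fderiv_right (m := 1) (by norm_num)).differentiableAt (by simp)).hasFDerivAt
  have h3 : HasFDerivAt (fun z => G₂ (ψ z)) ((fderiv ℝ G₂ (ψ y)).comp (fderiv ℝ ψ y)) y :=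
    hG₂.hasFDerivAt.comp (f := ψ) y h1
  have hb := h2.clm_apply (hasFDerivAt_const b y)
  have hc := h2.clm_apply (hasFDerivAt_const c y)
  have h4 := (h3.clm_apply hb).clm_apply hc
  have h5 : HasFDerivAt (fun z => G₁ z b c) _ y :=
    (hG₁.hasFDerivAt.clm_apply (hasFDerivAt_const b y)).clm_apply (hasFDerivAt_const c y)
  have h6 := h5.unique (h4.congr_of_eventuallyEq (h.mono fun z hz => hz b c))
  have h7 := DFunLike.congr_fun h6 a
  simp at h7
  rw [h7]
  ring

/-- The transformation law of the Christoffel symbols under a change of coordinates. -/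
theorem christoffel_pullback {G₁ G₂ : E → E →L[ℝ] E →L[ℝ] ℝ} {ψ : E → E} {y : E}
    (hψ : ContDiffAt ℝ 2 ψ y) (hG₁ : DifferentiableAt ℝ G₁ y) (hG₂ : DifferentiableAt ℝ G₂ (ψ y))
    (hsymm : ∀ a b, G₂ (ψ y) a b = G₂ (ψ y) b a)
    (h : ∀ᶠ z in 𝓝 y, ∀ a b, G₁ z a b = G₂ (ψ z) (fderiv ℝ ψ z a) (fderiv ℝ ψ z b)) (a c : E) :
    christoffel G₁ y a a c =
      christoffel G₂ (ψ y) (fderiv ℝ ψ y a) (fderiv ℝ ψ y a) (fderiv ℝ ψ y c) +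
      G₂ (ψ y) (fderiv ℝ (fderiv ℝ ψ) y a a) (fderiv ℝ ψ y c) := by
  have hs : fderiv ℝ (fderiv ℝ ψ) y a c = fderiv ℝ (fderiv ℝ ψ) y c a :=
    (hψ.isSymmSndFDerivAt (by simp)) a c
  simp only [christoffel, fderiv_pullback_apply hψ hG₁ hG₂ h, hs]
  rw [hsymm (fderiv ℝ (fderiv ℝ ψ) y c a)]
  ring

/-- The second derivative of a curve under a change of coordinates. -/
theorem deriv_deriv_comp {ψ : E → E} {u : ℝ → E} {τ : ℝ} (hψ : ContDiffAt ℝ 2 ψ (u τ))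
    (hu : ContDiffAt ℝ 2 u τ) :
    deriv (ψ ∘ u) τ = fderiv ℝ ψ (u τ) (deriv u τ) ∧
    deriv (deriv (ψ ∘ u)) τ = fderiv ℝ (fderiv ℝ ψ) (u τ) (deriv u τ) (deriv u τ) +
      fderiv ℝ ψ (u τ) (deriv (deriv u) τ) := by
  have h1 : ∀ᶠ σ in 𝓝 τ, deriv (ψ ∘ u) σ = fderiv ℝ ψ (u σ) (deriv u σ) := by
    filter_upwards [hu.eventually (by simp), hu.continuousAt.eventually (hψ.eventually (by simp))]
      with σ hσ hσ'
    exact fderiv_comp_deriv σ (hσ'.differentiableAt (by simp)) (hσ.differentiableAt (by simp))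
  refine ⟨h1.self_of_nhds, ?_⟩
  rw [Filter.EventuallyEq.deriv_eq h1]
  have h2 : HasFDerivAt (fderiv ℝ ψ) (fderiv ℝ (fderiv ℝ ψ) (u τ)) (u τ) :=
    ((hψ.fderiv_right (m := 1) (by norm_num)).differentiableAt (by simp)).hasFDerivAt
  have h3 : HasDerivAt u (deriv u τ) τ := (hu.differentiableAt (by simp)).hasDerivAt
  have h4 : HasDerivAt (deriv u) (deriv (deriv u) τ) τ :=
    ((hu.derivWithin (m := 1) (by norm_num)).differentiableAt (by simp)).hasDerivAt
  exact ((h2.comp_hasDerivAt τ h3).clm_apply h4).deriv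

end Transformation

/-! ### The metric and the tangent bundle in a chart -/

section Metric

set_option maxSynthPendingDepth 3

variable {n : ℕ} {M : Type*} [TopologicalSpace M] [ChartedSpace (EuclideanSpace ℝ (Fin n)) M]
  [IsManifold (𝓡 n) ∞ M]

/-- The metric in a chart, as a family of bilinear forms. -/
def chartForm (g : SmoothMetric n M) (p : M) (y : EuclideanSpace ℝ (Fin n)) :
    EuclideanSpace ℝ (Fin n) →L[ℝ] EuclideanSpace ℝ (Fin n) →L[ℝ] ℝ :=
  ContinuousLinearMap.bilinearComp (E := EuclideanSpace ℝ (Fin n)) (F := EuclideanSpace ℝ (Fin n))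
    (g.inner ((extChartAt (𝓡 n) p).symm y)) (chartFrame p y) (chartFrame p y)

theorem chartForm_apply (g : SmoothMetric n M) (p : M) (y a b : EuclideanSpace ℝ (Fin n)) :
    chartForm g p y a b = chartMetric g p y a b := rfl

theorem contMDiff_tangentBundle_mk (E : Type*) [NormedAddCommGroup E] [NormedSpace ℝ E] :
    ContMDiff (𝓘(ℝ, E).prod 𝓘(ℝ, E)) 𝓘(ℝ, E).tangent ∞
      (fun q : E × E => (⟨q.1, q.2⟩ : TangentBundle 𝓘(ℝ, E) E)) := by
  have h := contMDiff_tangentBundleModelSpaceHomeomorph_symm (I := 𝓘(ℝ, E)) (n := ∞)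
  rw [show chartedSpaceSelf (ModelProd E E) = prodChartedSpace E E E E from
    chartedSpaceSelf_prod.symm] at h
  exact h

theorem contMDiff_tangentBundle_pair (E : Type*) [NormedAddCommGroup E] [NormedSpace ℝ E] :
    ContMDiff 𝓘(ℝ, E).tangent (𝓘(ℝ, E).prod 𝓘(ℝ, E)) ∞
      (fun w : TangentBundle 𝓘(ℝ, E) E => ((w.1, w.2) : E × E)) := by
  have h := contMDiff_tangentBundleModelSpaceHomeomorph (I := 𝓘(ℝ, E)) (n := ∞)
  rw [show chartedSpaceSelf (ModelProd E E) = prodChartedSpace E E E E from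
    chartedSpaceSelf_prod.symm] at h
  exact h

/-- The coordinates `(x, v)` on the tangent bundle given by the chart around `p` and its frame. -/
def tangentCoords (p : M) : PartialDiffeomorph
    (𝓘(ℝ, EuclideanSpace ℝ (Fin n)).prod 𝓘(ℝ, EuclideanSpace ℝ (Fin n))) (𝓡 n).tangent
    (EuclideanSpace ℝ (Fin n) × EuclideanSpace ℝ (Fin n)) (TangentBundle (𝓡 n) M) ∞ where
  toFun q := ⟨(extChartAt (𝓡 n) p).symm q.1, chartFrame p q.1 q.2⟩
  invFun w := (extChartAt (𝓡 n) p w.1, chartCoframe p w.1 w.2)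
  source := {q | q.1 ∈ (extChartAt (𝓡 n) p).target}
  target := {w | w.1 ∈ (extChartAt (𝓡 n) p).source}
  map_source' q hq := (extChartAt (𝓡 n) p).map_target hq
  map_target' w hw := (extChartAt (𝓡 n) p).map_source hw
  left_inv' q hq := Prod.ext ((extChartAt (𝓡 n) p).right_inv hq)
    (chartCoframe_chartFrame_self hq q.2)
  right_inv' w hw := by
    have key : ∀ (x : M) (h : x = w.1) (v : TangentSpace (𝓡 n) x),
        (v : EuclideanSpace ℝ (Fin n)) = w.2 → (⟨x, v⟩ : TangentBundle (𝓡 n) M) = w := by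
      rintro _ rfl v rfl
      rfl
    exact key _ ((extChartAt (𝓡 n) p).left_inv hw) _ (chartFrame_chartCoframe_self hw w.2)
  open_source := (isOpen_extChartAt_target p).preimage continuous_fst
  open_target := (isOpen_extChartAt_source p).preimage (FiberBundle.continuous_proj _ _)
  contMDiffOn_toFun := by
    have ho := isOpen_extChartAt_target (I := 𝓡 n) p
    have h := (contMDiffOn_extChartAt_symm (I := 𝓡 n) (n := ∞) p).contMDiffOn_tangentMapWithin
      (m := ∞) (by simp) ho.uniqueMDiffOn
    have h' := h.comp (s := {q : EuclideanSpace ℝ (Fin n) × EuclideanSpace ℝ (Fin n) |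
      q.1 ∈ (extChartAt (𝓡 n) p).target})
      (contMDiff_tangentBundle_mk (EuclideanSpace ℝ (Fin n))).contMDiffOn (fun q hq => hq)
    refine h'.congr fun q hq => ?_
    exact congrArg (fun L : EuclideanSpace ℝ (Fin n) →L[ℝ] EuclideanSpace ℝ (Fin n) =>
      (⟨(extChartAt (𝓡 n) p).symm q.1, L q.2⟩ : TangentBundle (𝓡 n) M))
      (mfderivWithin_of_isOpen ho hq).symm
  contMDiffOn_invFun := by
    have ho := isOpen_extChartAt_source (I := 𝓡 n) p
    have h0 : ContMDiffOn (𝓡 n) 𝓘(ℝ, EuclideanSpace ℝ (Fin n)) ∞ (extChartAt (𝓡 n) p)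
        (extChartAt (𝓡 n) p).source := by
      rw [extChartAt_source]
      exact contMDiffOn_extChartAt
    have h := h0.contMDiffOn_tangentMapWithin (m := ∞) (by simp) ho.uniqueMDiffOn
    have h' := (contMDiff_tangentBundle_pair (EuclideanSpace ℝ (Fin n))).comp_contMDiffOn h
    refine h'.congr fun w hw => ?_
    exact congrArg (fun L : EuclideanSpace ℝ (Fin n) →L[ℝ] EuclideanSpace ℝ (Fin n) =>
      (extChartAt (𝓡 n) p w.1, L w.2)) (mfderivWithin_of_isOpen ho hw).symm

theorem contMDiffOn_chartFrame (p : M) (a : EuclideanSpace ℝ (Fin n)) :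
    ContMDiffOn 𝓘(ℝ, EuclideanSpace ℝ (Fin n)) (𝓡 n).tangent ∞
      (fun y => (⟨(extChartAt (𝓡 n) p).symm y, chartFrame p y a⟩ : TangentBundle (𝓡 n) M))
      (extChartAt (𝓡 n) p).target :=
  (tangentCoords p).contMDiffOn_toFun.comp
    (contMDiff_id.prodMk contMDiff_const).contMDiffOn (fun _ hy => hy)

theorem isMetricOn_chartForm (g : SmoothMetric n M) (p : M) :
    IsMetricOn (chartForm g p) (extChartAt (𝓡 n) p).target where
  contDiffOn := by
    rw [contDiffOn_clm_apply]
    intro a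
    rw [contDiffOn_clm_apply]
    intro b
    rw [← contMDiffOn_iff_contDiffOn]
    have h : ContMDiffOn 𝓘(ℝ, EuclideanSpace ℝ (Fin n)) ((𝓡 n).prod 𝓘(ℝ, ℝ)) ∞
      (fun y => Bundle.TotalSpace.mk' ℝ (E := Bundle.Trivial M ℝ) ((extChartAt (𝓡 n) p).symm y)
        (g.inner ((extChartAt (𝓡 n) p).symm y) (chartFrame p y a) (chartFrame p y b)))
        (extChartAt (𝓡 n) p).target := by
      intro y hy
      apply ContMDiffWithinAt.clm_bundle_apply₂ (F₁ := EuclideanSpace ℝ (Fin n))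
        (F₂ := EuclideanSpace ℝ (Fin n))
      · exact ContMDiffAt.comp_contMDiffWithinAt y g.contMDiff.contMDiffAt
          (contMDiffOn_extChartAt_symm p y hy)
      · exact contMDiffOn_chartFrame p a y hy
      · exact contMDiffOn_chartFrame p b y hy
    intro y hy
    have h1 := h y hy
    rw [Bundle.contMDiffWithinAt_totalSpace] at h1
    exact h1.2
  symm y _ a b := g.symm ((extChartAt (𝓡 n) p).symm y) (chartFrame p y a) (chartFrame p y b)
  pos y hy a ha := by
    have h : chartFrame p y a ≠ 0 := fun h => ha ((chartCoframe_chartFrame_self hy a).symm.trans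
      ((congrArg (chartCoframe p _) h).trans (map_zero _)))
    exact g.pos ((extChartAt (𝓡 n) p).symm y) (chartFrame p y a) h

theorem chartChristoffel_eq (g : SmoothMetric n M) {p : M} {y : EuclideanSpace ℝ (Fin n)}
    (hy : y ∈ (extChartAt (𝓡 n) p).target) (a b c : EuclideanSpace ℝ (Fin n)) :
    chartChristoffel g p y a b c = christoffel (chartForm g p) y a b c := by
  have h : HasFDerivAt (chartForm g p) (fderiv ℝ (chartForm g p) y) y :=
    (((isMetricOn_chartForm g p).contDiffOn.contDiffAt
      ((isOpen_extChartAt_target p).mem_nhds hy)).differentiableAt (by simp)).hasFDerivAt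
  have h1 : ∀ a b c, fderiv ℝ (fun z => chartMetric g p z b c) y a =
      fderiv ℝ (chartForm g p) y a b c := fun a b c => by
    have h2 := ((h.clm_apply (hasFDerivAt_const b y)).clm_apply (hasFDerivAt_const c y)).fderiv
    have h3 := DFunLike.congr_fun h2 a
    simp at h3
    exact h3
  simp only [chartChristoffel, christoffel, h1]

theorem chartForm_coordChange (g : SmoothMetric n M) {p q : M} {y : EuclideanSpace ℝ (Fin n)}
    (hy : y ∈ overlap n p q) (a b : EuclideanSpace ℝ (Fin n)) :
    chartForm g p y a b = chartForm g q (coordChange n p q y)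
      (fderiv ℝ (coordChange n p q) y a) (fderiv ℝ (coordChange n p q) y b) := by
  have key : ∀ (x x' : M) (h : x = x') (v w v' w' : EuclideanSpace ℝ (Fin n)), v = v' → w = w' →
      (g.inner x : EuclideanSpace ℝ (Fin n) →L[ℝ] EuclideanSpace ℝ (Fin n) →L[ℝ] ℝ) v w =
      (g.inner x' : EuclideanSpace ℝ (Fin n) →L[ℝ] EuclideanSpace ℝ (Fin n) →L[ℝ] ℝ) v' w' := by
    rintro x _ rfl v w _ _ rfl rfl
    rfl
  exact key _ _ (symm_coordChange hy).symm _ _ _ _ (chartFrame_coordChange hy a).symm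
    (chartFrame_coordChange hy b).symm

end Metric

/-! ### Smooth dependence on the initial values near an equilibrium -/

section LocalFlow

variable {E : Type} [NormedAddCommGroup E] [NormedSpace ℝ E]

theorem neg_one_le_two : (-1 : ℝ) ≤ 2 := by norm_num

/-- The primitive vanishing at `0` of a continuous path on `[-1, 2]`, extended to `ℝ`. -/
def primitive (a : C(Icc (-1 : ℝ) 2, E)) (τ : ℝ) : E :=
  ∫ σ in (0 : ℝ)..τ, Set.IccExtend neg_one_le_two a σ

theorem primitive_zero (a : C(Icc (-1 : ℝ) 2, E)) : primitive a 0 = 0 :=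
  intervalIntegral.integral_same

theorem continuous_IccExtend {E : Type} [NormedAddCommGroup E] (a : C(Icc (-1 : ℝ) 2, E)) :
    Continuous (Set.IccExtend neg_one_le_two a) := a.continuous.Icc_extend'

theorem hasDerivAt_primitive [CompleteSpace E] (a : C(Icc (-1 : ℝ) 2, E)) (τ : ℝ) :
    HasDerivAt (primitive a) (Set.IccExtend neg_one_le_two a τ) τ :=
  intervalIntegral.integral_hasDerivAt_right ((continuous_IccExtend a).intervalIntegrable _ _)
    ((continuous_IccExtend a).stronglyMeasurableAtFilter _ _) (continuous_IccExtend a).continuousAt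

theorem continuous_primitive [CompleteSpace E] (a : C(Icc (-1 : ℝ) 2, E)) :
    Continuous (primitive a) :=
  continuous_iff_continuousAt.2 fun τ => (hasDerivAt_primitive a τ).continuousAt

variable [CompleteSpace E]

variable (E) in
/-- Taking primitives, as a bounded operator on continuous paths. -/
def primitiveCLM : C(Icc (-1 : ℝ) 2, E) →L[ℝ] C(Icc (-1 : ℝ) 2, E) :=
  LinearMap.mkContinuous
    { toFun := fun a => ⟨fun τ => primitive a τ, (continuous_primitive a).comp
        continuous_subtype_val⟩
      map_add' := fun a b => by
        ext τ
        exact intervalIntegral.integral_add ((continuous_IccExtend a).intervalIntegrable _ _)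
          ((continuous_IccExtend b).intervalIntegrable _ _)
      map_smul' := fun c a => by
        ext τ
        exact intervalIntegral.integral_smul c _ } 2
    (fun a => by
      refine (ContinuousMap.norm_le _ (by positivity)).2 fun τ => ?_
      refine (intervalIntegral.norm_integral_le_of_norm_le_const (C := ‖a‖)
        fun σ _ => a.norm_coe_le_norm _).trans ?_
      rw [mul_comm, sub_zero]
      exact mul_le_mul_of_nonneg_right (abs_le.2 ⟨by linarith [τ.2.1], τ.2.2⟩) (norm_nonneg _))

theorem primitiveCLM_apply (a : C(Icc (-1 : ℝ) 2, E)) (τ : Icc (-1 : ℝ) 2) :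
    primitiveCLM E a τ = primitive a τ := rfl

variable (E) in
/-- The path with initial value `z.1.1`, initial velocity `z.1.2` and acceleration `z.2`, together
with its velocity. -/
def pathOfAcceleration : (E × E) × C(Icc (-1 : ℝ) 2, E) →L[ℝ] C(Icc (-1 : ℝ) 2, E × E) :=
  LinearMap.mkContinuous
    { toFun := fun z => ⟨fun τ => (z.1.1 + (τ : ℝ) • z.1.2 + primitiveCLM E (primitiveCLM E z.2) τ,
        z.1.2 + primitiveCLM E z.2 τ), by fun_prop⟩
      map_add' := fun z w => by
        ext τ
        · simp only [Prod.fst_add, Prod.snd_add, map_add, smul_add, ContinuousMap.coe_mk,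
            ContinuousMap.add_apply]
          abel
        · simp only [Prod.fst_add, Prod.snd_add, map_add, ContinuousMap.coe_mk,
            ContinuousMap.add_apply]
          abel
      map_smul' := fun c z => by
        ext τ
        · simp [smul_add, smul_comm c (τ : ℝ)]
        · simp [smul_add] } (1 + 2 + ‖primitiveCLM E‖ * ‖primitiveCLM E‖ + ‖primitiveCLM E‖)
    (fun z => by
      refine (ContinuousMap.norm_le _ (by positivity)).2 fun τ => ?_
      have h1 : ‖z.1.1‖ ≤ ‖z‖ := (norm_fst_le z.1).trans (norm_fst_le z)
      have h2 : ‖z.1.2‖ ≤ ‖z‖ := (norm_snd_le z.1).trans (norm_fst_le z)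
      have h3 : ‖z.2‖ ≤ ‖z‖ := norm_snd_le z
      have h4 : ‖primitiveCLM E z.2‖ ≤ ‖primitiveCLM E‖ * ‖z‖ :=
        ((primitiveCLM E).le_opNorm _).trans (by gcongr)
      have h5 : ‖primitiveCLM E (primitiveCLM E z.2)‖ ≤
          ‖primitiveCLM E‖ * ‖primitiveCLM E‖ * ‖z‖ :=
        ((primitiveCLM E).le_opNorm _).trans (by rw [mul_assoc]; gcongr)
      have h6 := (ContinuousMap.norm_coe_le_norm (primitiveCLM E z.2) τ).trans h4
      have h7 := (ContinuousMap.norm_coe_le_norm (primitiveCLM E (primitiveCLM E z.2)) τ).trans h5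
      have h8 : ‖(τ : ℝ) • z.1.2‖ ≤ 2 * ‖z‖ := by
        rw [norm_smul]
        have : ‖(τ : ℝ)‖ ≤ 2 := abs_le.2 ⟨by linarith [τ.2.1], τ.2.2⟩
        gcongr
      have hn : 0 ≤ ‖z‖ := norm_nonneg z
      have hp : 0 ≤ ‖primitiveCLM E‖ * ‖z‖ := by positivity
      have hpp : 0 ≤ ‖primitiveCLM E‖ * ‖primitiveCLM E‖ * ‖z‖ := by positivity
      refine max_le ?_ ?_
      · refine (norm_add₃_le).trans ?_
        simp only [add_mul, one_mul]
        linarith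
      · refine (norm_add_le _ _).trans ?_
        simp only [add_mul, one_mul]
        linarith)

theorem pathOfAcceleration_apply (z : (E × E) × C(Icc (-1 : ℝ) 2, E)) {τ : ℝ}
    (hτ : τ ∈ Icc (-1 : ℝ) 2) :
    pathOfAcceleration E z ⟨τ, hτ⟩ = (z.1.1 + τ • z.1.2 + primitive (primitiveCLM E z.2) τ,
      z.1.2 + primitive z.2 τ) := rfl

theorem hasDerivAt_fst_path (z : (E × E) × C(Icc (-1 : ℝ) 2, E)) {τ : ℝ}
    (hτ : τ ∈ Icc (-1 : ℝ) 2) :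
    HasDerivAt (fun τ => z.1.1 + τ • z.1.2 + primitive (primitiveCLM E z.2) τ)
      (z.1.2 + primitive z.2 τ) τ := by
  have h1 : HasDerivAt (fun τ : ℝ => z.1.1 + τ • z.1.2) z.1.2 τ := by
    simpa using ((hasDerivAt_id τ).smul_const z.1.2).const_add z.1.1
  have h2 := hasDerivAt_primitive (primitiveCLM E z.2) τ
  rw [Set.IccExtend_of_mem _ _ hτ] at h2
  exact h1.add h2

theorem hasDerivAt_snd_path (z : (E × E) × C(Icc (-1 : ℝ) 2, E)) {τ : ℝ}
    (hτ : τ ∈ Icc (-1 : ℝ) 2) :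
    HasDerivAt (fun τ => z.1.2 + primitive z.2 τ) (z.2 ⟨τ, hτ⟩) τ := by
  have h2 := hasDerivAt_primitive z.2 τ
  rw [Set.IccExtend_of_mem _ _ hτ] at h2
  exact h2.const_add _

/-- Near an equilibrium at which the linearization of `u'' = A(u, u')` is `u'' = 0`, the solutions
exist on `(-1, 2)` and their values at time `1` depend smoothly on the initial values, with the
derivative `(x, v) ↦ x + v`. The acceleration is obtained as a continuous path from the inverse
function theorem, applied to `(x, v, a) ↦ (x, v, a - A(u, u'))`, where `u` is the path with initial
values `x`, `v` and acceleration `a`. -/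
theorem exists_local_flow [FiniteDimensional ℝ E] {A : E × E → E} {s : Set (E × E)} (hs : IsOpen s)
    (hA : ContDiffOn ℝ ∞ A s) {x₀ : E} (hx : (x₀, 0) ∈ s) (h0 : A (x₀, 0) = 0)
    (hA' : HasFDerivAt A (0 : E × E →L[ℝ] E) (x₀, 0)) :
    ∃ U U' : E × E → ℝ → E,
      (∀ᶠ q in 𝓝 (x₀, (0 : E)), U q 0 = q.1 ∧ U' q 0 = q.2 ∧ ∀ τ ∈ Ioo (-1 : ℝ) 2,
        (U q τ, U' q τ) ∈ s ∧ HasDerivAt (U q) (U' q τ) τ ∧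
        HasDerivAt (U' q) (A (U q τ, U' q τ)) τ) ∧
      (∀ᶠ q in 𝓝 (x₀, (0 : E)), ContDiffAt ℝ ∞ (fun q => U q 1) q) ∧
      HasFDerivAt (fun q => U q 1) (ContinuousLinearMap.fst ℝ E E + ContinuousLinearMap.snd ℝ E E)
        (x₀, 0) ∧ U (x₀, 0) 1 = x₀ := by
  -- a global function is needed for the superposition operator
  obtain ⟨g, hg, hgA⟩ := exists_contDiff_eventuallyEq (hs.mem_nhds hx) hA
  let N : C(Icc (-1 : ℝ) 2, E × E) → C(Icc (-1 : ℝ) 2, E) := fun η =>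
    (⟨g, hg.continuous⟩ : C(E × E, E)).comp η
  have hN : ContDiff ℝ ∞ N := contDiff_postcomp hg
  let z₀ : (E × E) × C(Icc (-1 : ℝ) 2, E) := ((x₀, 0), 0)
  let L := pathOfAcceleration E
  have hL₀ : ∀ τ, L z₀ τ = (x₀, 0) := fun τ => by
    have := pathOfAcceleration_apply z₀ τ.2
    rw [show (⟨τ, τ.2⟩ : Icc (-1 : ℝ) 2) = τ from rfl] at this
    rw [this, ← primitiveCLM_apply, ← primitiveCLM_apply]
    simp [z₀]
  let Ψ : (E × E) × C(Icc (-1 : ℝ) 2, E) → (E × E) × C(Icc (-1 : ℝ) 2, E) :=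
    fun z => (z.1, z.2 - N (L z))
  have hΨ : ContDiff ℝ ∞ Ψ := contDiff_fst.prodMk (contDiff_snd.sub (hN.comp L.contDiff))
  have hΨ₀ : Ψ z₀ = z₀ := by
    refine Prod.ext rfl ?_
    ext τ
    have : N (L z₀) τ = 0 := by
      change g (L z₀ τ) = 0
      rw [hL₀, hgA.self_of_nhds, h0]
    simp [Ψ, this]
  -- `A` vanishes to second order at the equilibrium, hence `Ψ` is tangent to the identity at `z₀`
  have hdN : HasFDerivAt N (0 : C(Icc (-1 : ℝ) 2, E × E) →L[ℝ] C(Icc (-1 : ℝ) 2, E)) (L z₀) := by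
    have h := hasFDerivAt_postcomp (hg.differentiable (by simp)) (hg.continuous_fderiv (by simp))
      (L z₀)
    convert h using 1
    ext η τ
    rw [pointwiseApply_apply]
    change 0 = fderiv ℝ g (L z₀ τ) (η τ)
    rw [hL₀, hgA.fderiv_eq, hA'.fderiv]
    rfl
  have hdΨ : HasFDerivAt Ψ
      ((ContinuousLinearEquiv.refl ℝ ((E × E) × C(Icc (-1 : ℝ) 2, E)) :
        (E × E) × C(Icc (-1 : ℝ) 2, E) →L[ℝ] (E × E) × C(Icc (-1 : ℝ) 2, E))) z₀ := by
    have h := (hasFDerivAt_fst (𝕜 := ℝ) (p := z₀)).prodMk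
      ((hasFDerivAt_snd (𝕜 := ℝ) (p := z₀)).sub (hdN.comp z₀ L.hasFDerivAt))
    have he : ((ContinuousLinearMap.fst ℝ (E × E) C(Icc (-1 : ℝ) 2, E)).prod
        (ContinuousLinearMap.snd ℝ (E × E) C(Icc (-1 : ℝ) 2, E) -
          (0 : C(Icc (-1 : ℝ) 2, E × E) →L[ℝ] C(Icc (-1 : ℝ) 2, E)).comp L)) =
        ContinuousLinearEquiv.refl ℝ ((E × E) × C(Icc (-1 : ℝ) 2, E)) := by
      ext z <;> simp
    rw [he] at h
    exact h
  have hstrict := hΨ.contDiffAt.hasStrictFDerivAt' hdΨ (by simp)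
  let Z : E × E → (E × E) × C(Icc (-1 : ℝ) 2, E) := fun q =>
    hΨ.contDiffAt.localInverse hdΨ (by simp) (q, 0)
  have hι : HasFDerivAt (fun q : E × E => ((q, 0) : (E × E) × C(Icc (-1 : ℝ) 2, E)))
      (ContinuousLinearMap.inl ℝ (E × E) C(Icc (-1 : ℝ) 2, E)) (x₀, 0) :=
    (ContinuousLinearMap.inl ℝ (E × E) C(Icc (-1 : ℝ) 2, E)).hasFDerivAt
  have hZ₀ : Z (x₀, 0) = z₀ := by
    have := hΨ.contDiffAt.localInverse_apply_image hdΨ (by simp)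
    rwa [hΨ₀] at this
  let Θ := hΨ.contDiffAt.toOpenPartialHomeomorph Ψ hdΨ (by simp)
  have hZ : ∀ᶠ q in 𝓝 (x₀, (0 : E)), ContDiffAt ℝ ∞ Z q := by
    have ht : z₀ ∈ Θ.target := by
      have h := hΨ.contDiffAt.image_mem_toOpenPartialHomeomorph_target hdΨ (by simp)
      rwa [hΨ₀] at h
    have hs : Θ.symm z₀ = z₀ := hZ₀
    -- the derivative of `Ψ` stays invertible in a neighbourhood of `z₀`
    have hinv : ∀ᶠ y in 𝓝 z₀, fderiv ℝ Ψ (Θ.symm y) ∈ Set.range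
        ((↑) : (((E × E) × C(Icc (-1 : ℝ) 2, E)) ≃L[ℝ] ((E × E) × C(Icc (-1 : ℝ) 2, E))) →
          ((E × E) × C(Icc (-1 : ℝ) 2, E) →L[ℝ] (E × E) × C(Icc (-1 : ℝ) 2, E))) := by
      have hc : ContinuousAt (fun y => fderiv ℝ Ψ (Θ.symm y)) z₀ :=
        (hΨ.continuous_fderiv (by simp)).continuousAt.comp (Θ.continuousAt_symm ht)
      refine hc.eventually ?_
      dsimp only
      rw [hs, hdΨ.fderiv]
      exact ContinuousLinearEquiv.nhds _
    have hy : ∀ᶠ y in 𝓝 z₀, ContDiffAt ℝ ∞ Θ.symm y := by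
      filter_upwards [hinv, Θ.open_target.mem_nhds ht] with y ⟨B, hB⟩ hy
      refine Θ.contDiffAt_symm (f₀' := B) hy ?_ hΨ.contDiffAt
      rw [hB]
      exact (hΨ.differentiable (by simp) _).hasFDerivAt
    filter_upwards [hι.continuousAt.eventually hy] with q hq
    exact hq.comp q (contDiffAt_id.prodMk contDiffAt_const)
  have hdZ : HasFDerivAt Z (ContinuousLinearMap.inl ℝ (E × E) C(Icc (-1 : ℝ) 2, E)) (x₀, 0) := by
    have h := hstrict.to_localInverse.hasFDerivAt
    rw [hΨ₀] at h
    exact h.comp (x₀, 0) hι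
  have hZeq : ∀ᶠ q in 𝓝 (x₀, (0 : E)), Ψ (Z q) = (q, 0) := by
    have h := hstrict.eventually_right_inverse
    rw [hΨ₀] at h
    exact hι.continuousAt.eventually h
  -- near `z₀` the paths stay in the region where `g` and `A` agree
  have hW : ∀ᶠ q in 𝓝 (x₀, (0 : E)), ∀ τ, L (Z q) τ ∈ s ∧ g (L (Z q) τ) = A (L (Z q) τ) := by
    obtain ⟨W, hW, hWo, hxW⟩ := eventually_nhds_iff.1 ((hs.eventually_mem hx).and hgA)
    have ho : IsOpen {c : C(Icc (-1 : ℝ) 2, E × E) | Set.MapsTo c Set.univ W} :=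
      ContinuousMap.isOpen_setOfPred_mapsTo isCompact_univ hWo
    have hc : ContinuousAt (fun q => L (Z q)) (x₀, 0) :=
      L.continuous.continuousAt.comp hZ.self_of_nhds.continuousAt
    filter_upwards [hc.eventually (ho.mem_nhds (by
      intro τ _
      change L (Z (x₀, 0)) τ ∈ W
      rw [hZ₀]
      rw [hL₀]
      exact hxW))] with q hq τ
    exact hW _ (hq (Set.mem_univ τ))
  have h1 : (1 : ℝ) ∈ Icc (-1 : ℝ) 2 := by constructor <;> norm_num
  let ev : C(Icc (-1 : ℝ) 2, E × E) →L[ℝ] E :=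
    (ContinuousLinearMap.fst ℝ E E).comp (ContinuousMap.evalCLM ℝ ⟨1, h1⟩)
  refine ⟨fun q τ => (Z q).1.1 + τ • (Z q).1.2 + primitive (primitiveCLM E (Z q).2) τ,
    fun q τ => (Z q).1.2 + primitive (Z q).2 τ, ?_, ?_, ?_, ?_⟩
  · filter_upwards [hZeq, hW] with q hq hq'
    have h1 : (Z q).1 = q := congrArg Prod.fst hq
    have h2 : (Z q).2 = N (L (Z q)) := sub_eq_zero.1 (congrArg Prod.snd hq)
    refine ⟨by simp [primitive_zero, h1], by simp [primitive_zero, h1], fun τ hτ => ?_⟩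
    have hτ' : τ ∈ Icc (-1 : ℝ) 2 := Set.Ioo_subset_Icc_self hτ
    refine ⟨(hq' ⟨τ, hτ'⟩).1, hasDerivAt_fst_path (Z q) hτ', ?_⟩
    have h3 : (Z q).2 ⟨τ, hτ'⟩ = A (L (Z q) ⟨τ, hτ'⟩) := by
      rw [← (hq' _).2]
      exact DFunLike.congr_fun h2 _
    have h4 := hasDerivAt_snd_path (Z q) hτ'
    rw [h3] at h4
    exact h4
  · filter_upwards [hZ] with q hq
    exact ev.contDiff.contDiffAt.comp _ (L.contDiff.contDiffAt.comp _ hq)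
  · have h := (ev.comp L).hasFDerivAt.comp (x₀, (0 : E)) hdZ
    have he : (ev.comp L).comp (ContinuousLinearMap.inl ℝ (E × E) C(Icc (-1 : ℝ) 2, E)) =
        ContinuousLinearMap.fst ℝ E E + ContinuousLinearMap.snd ℝ E E := by
      refine ContinuousLinearMap.ext fun q => ?_
      change q.1 + (1 : ℝ) • q.2 + primitiveCLM E (primitiveCLM E 0) ⟨1, h1⟩ = q.1 + q.2
      simp
    rw [he] at h
    exact h
  · change ev (L (Z (x₀, 0))) = x₀
    rw [hZ₀]
    exact congrArg Prod.fst (hL₀ _)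

end LocalFlow

/-! ### Geodesics and the exponential map in a chart -/

section Geodesics

variable {n : ℕ} {M : Type*} [TopologicalSpace M] [ChartedSpace (EuclideanSpace ℝ (Fin n)) M]

theorem coordChange_mem_overlap {p q : M} {y : EuclideanSpace ℝ (Fin n)}
    (hy : y ∈ overlap n p q) : coordChange n p q y ∈ overlap n q p := by
  refine ⟨coordChange_mem_target hy, ?_⟩
  rw [Set.mem_preimage, symm_coordChange hy]
  exact (extChartAt (𝓡 n) p).map_target hy.1

theorem coordChange_coordChange {p q : M} {y : EuclideanSpace ℝ (Fin n)}
    (hy : y ∈ overlap n p q) : coordChange n q p (coordChange n p q y) = y := by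
  rw [coordChange, symm_coordChange hy, (extChartAt (𝓡 n) p).right_inv hy.1]

variable [IsManifold (𝓡 n) ∞ M] {g : SmoothMetric n M}

theorem IsGeodesicOn.mono {γ : ℝ → M} {J J' : Set ℝ} (h : IsGeodesicOn g γ J) (hJ : J' ⊆ J) :
    IsGeodesicOn g γ J' :=
  ⟨h.1.mono hJ, fun p τ hτ => h.2 p τ (hJ hτ)⟩

/-- In a chart, a geodesic is a solution of `u'' = A(u, u')`. -/
theorem IsGeodesicOn.chart {γ : ℝ → M} {J : Set ℝ} (h : IsGeodesicOn g γ J) (hJ : IsOpen J)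
    {p : M} {τ : ℝ} (hτ : τ ∈ J) (hp : γ τ ∈ (extChartAt (𝓡 n) p).source) :
    ContDiffAt ℝ 2 (fun σ => extChartAt (𝓡 n) p (γ σ)) τ ∧
    deriv (deriv fun σ => extChartAt (𝓡 n) p (γ σ)) τ = geodesicAcceleration (chartForm g p)
      (extChartAt (𝓡 n) p (γ τ), deriv (fun σ => extChartAt (𝓡 n) p (γ σ)) τ) := by
  have hy := (extChartAt (𝓡 n) p).map_source hp
  constructor
  · rw [← contMDiffAt_iff_contDiffAt]
    exact ContMDiffAt.comp (I' := 𝓡 n) τ (contMDiffAt_extChartAt' (by simpa using hp))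
      (h.1.contMDiffAt (hJ.mem_nhds hτ))
  · rw [← (isMetricOn_chartForm g p).geodesicEquation_iff hy]
    intro c
    rw [chartForm_apply, ← chartChristoffel_eq g hy]
    exact h.2 p τ hτ hp c

theorem deriv_chart_comp {γ : ℝ → M} {p : M} {τ : ℝ} (hγ : MDifferentiableAt 𝓘(ℝ, ℝ) (𝓡 n) γ τ)
    (hp : γ τ ∈ (extChartAt (𝓡 n) p).source) :
    deriv (fun σ => extChartAt (𝓡 n) p (γ σ)) τ =
      chartCoframe p (γ τ) (mfderiv 𝓘(ℝ, ℝ) (𝓡 n) γ τ (1 : ℝ)) := by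
  have h := mfderiv_comp τ (mdifferentiableAt_extChartAt' hp) hγ
  rw [mfderiv_eq_fderiv] at h
  exact DFunLike.congr_fun h (1 : ℝ)

theorem ContDiffAt.hasDerivAt_prodMk_deriv {E : Type*} [NormedAddCommGroup E] [NormedSpace ℝ E]
    {u : ℝ → E} {τ : ℝ} (hu : ContDiffAt ℝ 2 u τ) :
    HasDerivAt (fun σ => (u σ, deriv u σ)) (deriv u τ, deriv (deriv u) τ) τ :=
  (hu.differentiableAt (by simp)).hasDerivAt.prodMk
    (((hu.derivWithin (m := 1) (by norm_num)).differentiableAt (by simp)).hasDerivAt)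

/-- A geodesic contained in the domain of a chart agrees with every geodesic that has the same
position and velocity at one time. -/
theorem IsGeodesicOn.eqOn [T2Space M] {γ₁ γ₂ : ℝ → M} {J : Set ℝ} (h₁ : IsGeodesicOn g γ₁ J)
    (h₂ : IsGeodesicOn g γ₂ J) (hJ : IsOpen J) (hJc : IsPreconnected J) {p : M}
    (hp : ∀ τ ∈ J, γ₁ τ ∈ (extChartAt (𝓡 n) p).source) {τ₀ : ℝ} (hτ₀ : τ₀ ∈ J)
    (h0 : γ₁ τ₀ = γ₂ τ₀) (h0' : deriv (fun σ => extChartAt (𝓡 n) p (γ₁ σ)) τ₀ =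
      deriv (fun σ => extChartAt (𝓡 n) p (γ₂ σ)) τ₀) : Set.EqOn γ₁ γ₂ J := by
  let S : Set ℝ := {τ | τ ∈ J ∧ γ₁ τ = γ₂ τ ∧ deriv (fun σ => extChartAt (𝓡 n) p (γ₁ σ)) τ =
    deriv (fun σ => extChartAt (𝓡 n) p (γ₂ σ)) τ}
  have hcont : ∀ {γ : ℝ → M}, IsGeodesicOn g γ J → ∀ {τ}, τ ∈ J → ContinuousAt γ τ :=
    fun h τ hτ => (h.1.contMDiffAt (hJ.mem_nhds hτ)).continuousAt
  suffices J ⊆ S from fun τ hτ => (this hτ).2.1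
  refine hJc.subset_of_closure_inter_subset ?_ ⟨τ₀, hτ₀, hτ₀, h0, h0'⟩ ?_
  · -- the set of agreement is open by local uniqueness of solutions of the geodesic equation
    rw [isOpen_iff_mem_nhds]
    rintro τ ⟨hτ, hτ1, hτ2⟩
    let F : EuclideanSpace ℝ (Fin n) × EuclideanSpace ℝ (Fin n) →
        EuclideanSpace ℝ (Fin n) × EuclideanSpace ℝ (Fin n) :=
      fun q => (q.2, geodesicAcceleration (chartForm g p) q)
    let w : (ℝ → M) → ℝ → EuclideanSpace ℝ (Fin n) × EuclideanSpace ℝ (Fin n) := fun γ σ =>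
      (extChartAt (𝓡 n) p (γ σ), deriv (fun σ => extChartAt (𝓡 n) p (γ σ)) σ)
    have hF : ContDiffAt ℝ 1 F (w γ₁ τ) :=
      (contDiff_snd.contDiffAt.prodMk ((isMetricOn_chartForm g p).contDiffAt_geodesicAcceleration
        (isOpen_extChartAt_target p) ((extChartAt (𝓡 n) p).map_source (hp τ hτ)) _)).of_le
        (by exact_mod_cast le_top)
    obtain ⟨K, t, ht, hK⟩ := hF.exists_lipschitzOnWith
    have hw : ∀ {γ : ℝ → M}, IsGeodesicOn g γ J → γ τ = γ₁ τ → w γ τ = w γ₁ τ →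
        ∀ᶠ σ in 𝓝 τ, (HasDerivAt (w γ) (F (w γ σ)) σ ∧ w γ σ ∈ t) ∧
          γ σ ∈ (extChartAt (𝓡 n) p).source := by
      intro γ h hγ hγ'
      have hs : ∀ᶠ σ in 𝓝 τ, γ σ ∈ (extChartAt (𝓡 n) p).source :=
        (hcont h hτ).eventually ((isOpen_extChartAt_source p).mem_nhds (hγ ▸ hp τ hτ))
      have hd : ∀ {σ}, σ ∈ J → γ σ ∈ (extChartAt (𝓡 n) p).source →
          HasDerivAt (w γ) (F (w γ σ)) σ := fun hσ hσ' => by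
        have h3 := (h.chart hJ hσ hσ').1.hasDerivAt_prodMk_deriv
        rw [(h.chart hJ hσ hσ').2] at h3
        exact h3
      have hc : ContinuousAt (w γ) τ := (hd hτ hs.self_of_nhds).continuousAt
      filter_upwards [hs, hJ.mem_nhds hτ, hc.eventually (by rw [hγ']; exact ht)] with σ h1 h2 h3
      exact ⟨⟨hd h2 h1, h3⟩, h1⟩
    have hww : w γ₂ τ = w γ₁ τ := Prod.ext (congrArg (extChartAt (𝓡 n) p) hτ1.symm) hτ2.symm
    have hw1 := hw h₁ rfl rfl
    have hw2 := hw h₂ hτ1.symm hww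
    have heq := ODE_solution_unique_of_eventually (v := fun _ => F) (s := fun _ => t)
      (Filter.Eventually.of_forall fun _ => hK) (hw1.mono fun _ h => h.1)
      (hw2.mono fun _ h => h.1) hww.symm
    filter_upwards [heq, hw1, hw2, hJ.mem_nhds hτ] with σ h1 h2 h3 h4
    exact ⟨h4, (extChartAt (𝓡 n) p).injOn h2.2 h3.2 (congrArg Prod.fst h1), congrArg Prod.snd h1⟩
  · rintro τ ⟨hτ, hτJ⟩
    rw [mem_closure_iff_frequently] at hτ
    have h1 : γ₁ τ = γ₂ τ := by
      by_contra hne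
      exact hτ ((((hcont h₁ hτJ).prodMk (hcont h₂ hτJ)).eventually
        (isClosed_diagonal.isOpen_compl.mem_nhds hne)).mono fun σ h h' => h h'.2.1)
    refine ⟨hτJ, h1, ?_⟩
    by_contra hne
    have c1 := (h₁.chart hJ hτJ (hp τ hτJ)).1.hasDerivAt_prodMk_deriv.continuousAt.snd
    have c2 := (h₂.chart hJ hτJ (h1 ▸ hp τ hτJ)).1.hasDerivAt_prodMk_deriv.continuousAt.snd
    exact hτ (((c1.prodMk c2).eventually
      (isClosed_diagonal.isOpen_compl.mem_nhds hne)).mono fun σ h h' => h h'.2.2)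

theorem differentiableAt_coordChange {p q : M} {y : EuclideanSpace ℝ (Fin n)}
    (hy : y ∈ overlap n p q) : DifferentiableAt ℝ (coordChange n p q) y :=
  ((contDiffOn_coordChange p q).contDiffAt ((isOpen_overlap p q).mem_nhds hy)).differentiableAt
    (by simp)

theorem fderiv_coordChange_fderiv_coordChange {p q : M} {y : EuclideanSpace ℝ (Fin n)}
    (hy : y ∈ overlap n p q) (c : EuclideanSpace ℝ (Fin n)) :
    fderiv ℝ (coordChange n p q) y (fderiv ℝ (coordChange n q p) (coordChange n p q y) c) = c := by
  have hy' := coordChange_mem_overlap hy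
  have h1 : HasFDerivAt (coordChange n p q) (fderiv ℝ (coordChange n p q) y)
      (coordChange n q p (coordChange n p q y)) := by
    rw [coordChange_coordChange hy]
    exact (differentiableAt_coordChange hy).hasFDerivAt
  have h2 := h1.comp _ (differentiableAt_coordChange hy').hasFDerivAt
  have h3 := h2.unique ((hasFDerivAt_id (𝕜 := ℝ) _).congr_of_eventuallyEq (by
    filter_upwards [(isOpen_overlap q p).mem_nhds hy'] with z hz
    exact coordChange_coordChange hz))
  exact DFunLike.congr_fun h3 c

/-- The solutions of the geodesic equation in one chart are geodesics. -/
theorem isGeodesicOn_of_chart (g : SmoothMetric n M) {p : M} {u u' : ℝ → EuclideanSpace ℝ (Fin n)}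
    {J : Set ℝ} (hJ : IsOpen J) (hu : ∀ τ ∈ J, u τ ∈ (extChartAt (𝓡 n) p).target)
    (h1 : ∀ τ ∈ J, HasDerivAt u (u' τ) τ)
    (h2 : ∀ τ ∈ J, HasDerivAt u' (geodesicAcceleration (chartForm g p) (u τ, u' τ)) τ) :
    IsGeodesicOn g (fun τ => (extChartAt (𝓡 n) p).symm (u τ)) J := by
  have ho := isOpen_extChartAt_target (I := 𝓡 n) p
  have hd : ∀ τ ∈ J, deriv u =ᶠ[𝓝 τ] u' := fun τ hτ => by
    filter_upwards [hJ.mem_nhds hτ] with σ hσ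
    exact (h1 σ hσ).deriv
  have hu2 : ContDiffOn ℝ 2 u J := by
    have h3 : ContDiffOn ℝ 1 (deriv u) J := by
      rw [show (1 : WithTop ℕ∞) = 0 + 1 by norm_num, contDiffOn_succ_iff_deriv_of_isOpen hJ]
      refine ⟨fun τ hτ => (((h2 τ hτ).congr_of_eventuallyEq
        (hd τ hτ)).differentiableAt).differentiableWithinAt, by simp, ?_⟩
      rw [contDiffOn_zero]
      intro τ hτ
      have h4 : deriv (deriv u) =ᶠ[𝓝 τ]
          fun σ => geodesicAcceleration (chartForm g p) (u σ, u' σ) := by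
        filter_upwards [hJ.mem_nhds hτ] with σ hσ
        rw [(hd σ hσ).deriv_eq, (h2 σ hσ).deriv]
      have h5 := ((isMetricOn_chartForm g p).contDiffAt_geodesicAcceleration ho (hu τ hτ)
        (u' τ)).continuousAt
      have h6 : ContinuousAt (fun σ => (u σ, u' σ)) τ :=
        (h1 τ hτ).continuousAt.prodMk (h2 τ hτ).continuousAt
      exact ((ContinuousAt.comp (f := fun σ => (u σ, u' σ)) h5 h6).congr
        h4.symm).continuousWithinAt
    rw [show (2 : WithTop ℕ∞) = 1 + 1 by norm_num, contDiffOn_succ_iff_deriv_of_isOpen hJ]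
    exact ⟨fun τ hτ => (h1 τ hτ).differentiableAt.differentiableWithinAt, by simp, h3⟩
  refine ⟨(contMDiffOn_extChartAt_symm p).comp (contMDiffOn_iff_contDiffOn.2 hu2) hu, ?_⟩
  intro q τ hτ hq
  dsimp only
  intro c
  have hy : u τ ∈ overlap n p q := ⟨hu τ hτ, hq⟩
  have hy' := coordChange_mem_target hy
  have hψ : ContDiffAt ℝ 2 (coordChange n p q) (u τ) :=
    ((contDiffOn_coordChange p q).contDiffAt ((isOpen_overlap p q).mem_nhds hy)).of_le
      ENat.LEInfty.out
  have huτ : ContDiffAt ℝ 2 u τ := hu2.contDiffAt (hJ.mem_nhds hτ)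
  have hψu : (fun σ => extChartAt (𝓡 n) q ((extChartAt (𝓡 n) p).symm (u σ))) =
    coordChange n p q ∘ u := rfl
  obtain ⟨e1, e2⟩ := deriv_deriv_comp hψ huτ
  rw [(hd τ hτ).deriv_eq, (h2 τ hτ).deriv, (h1 τ hτ).deriv] at e2
  rw [(h1 τ hτ).deriv] at e1
  have hc := fderiv_coordChange_fderiv_coordChange hy c
  set c' := fderiv ℝ (coordChange n q p) (coordChange n p q (u τ)) c
  have hdG : ∀ {p : M} {y}, y ∈ (extChartAt (𝓡 n) p).target →
      DifferentiableAt ℝ (chartForm g p) y := fun {p y} hy =>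
    ((isMetricOn_chartForm g p).contDiffOn.contDiffAt
      ((isOpen_extChartAt_target p).mem_nhds hy)).differentiableAt (by simp)
  have h3 := christoffel_pullback hψ (hdG hy.1) (hdG hy') ((isMetricOn_chartForm g q).symm _ hy')
    (by filter_upwards [(isOpen_overlap p q).mem_nhds hy] with z hz a b
        exact chartForm_coordChange g hz a b) (u' τ) c'
  have h4 := ((isMetricOn_chartForm g p).geodesicEquation_iff hy.1 (u' τ) _).2 rfl c'
  rw [chartForm_coordChange g hy, h3, hc] at h4
  rw [hψu, e1, e2]
  change chartMetric g q (coordChange n p q (u τ)) _ c +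
    chartChristoffel g q (coordChange n p q (u τ)) _ _ c = 0
  rw [chartChristoffel_eq g hy', ← chartForm_apply, map_add, add_apply]
  rw [← h4]
  ring

end Geodesics

section Exponential

variable {n : ℕ} {M : Type*} [TopologicalSpace M] [ChartedSpace (EuclideanSpace ℝ (Fin n)) M]
  [IsManifold (𝓡 n) ∞ M]

theorem IsGeodesicFrom.chart_zero {g : SmoothMetric n M} {w : TangentBundle (𝓡 n) M} {γ : ℝ → M}
    (h : IsGeodesicFrom g w γ) {p : M} (hw : w.1 ∈ (extChartAt (𝓡 n) p).source) :
    γ 0 = w.1 ∧ deriv (fun σ => extChartAt (𝓡 n) p (γ σ)) 0 = chartCoframe p w.1 w.2 := by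
  obtain ⟨⟨ε, hε, hγ⟩, rfl⟩ := h
  refine ⟨rfl, deriv_chart_comp ?_ hw⟩
  exact (hγ.1.contMDiffAt (isOpen_Ioo.mem_nhds ⟨by linarith, by linarith⟩)).mdifferentiableAt
    (by simp)

/-- The exponential map does not depend on the choice of a geodesic, if there is one which stays in
the domain of a chart. -/
theorem riemannianExp_eq [T2Space M] {g : SmoothMetric n M} {w : TangentBundle (𝓡 n) M}
    {γ : ℝ → M} (h : IsGeodesicFrom g w γ) {p : M} {ε : ℝ} (hε : 0 < ε)
    (hγ : IsGeodesicOn g γ (Ioo (-ε) (1 + ε)))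
    (hp : ∀ τ ∈ Ioo (-ε) (1 + ε), γ τ ∈ (extChartAt (𝓡 n) p).source) :
    riemannianExp g w = γ 1 := by
  have hex : ∃ γ, IsGeodesicFrom g w γ := ⟨γ, h⟩
  rw [riemannianExp, dif_pos hex]
  have h' := hex.choose_spec
  obtain ⟨ε', hε', hγ'⟩ := h'.1
  have hm : 0 < min ε ε' := lt_min hε hε'
  have hs : Ioo (-min ε ε') (1 + min ε ε') ⊆ Ioo (-ε) (1 + ε) :=
    Set.Ioo_subset_Ioo (neg_le_neg (min_le_left _ _)) (by gcongr; exact min_le_left _ _)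
  have hs' : Ioo (-min ε ε') (1 + min ε ε') ⊆ Ioo (-ε') (1 + ε') :=
    Set.Ioo_subset_Ioo (neg_le_neg (min_le_right _ _)) (by gcongr; exact min_le_right _ _)
  have h0 : (0 : ℝ) ∈ Ioo (-min ε ε') (1 + min ε ε') := ⟨by linarith, by linarith⟩
  have hw : w.1 ∈ (extChartAt (𝓡 n) p).source := by
    rw [← congrArg Bundle.TotalSpace.proj h.2]
    exact hp 0 (hs h0)
  have c1 := h.chart_zero hw
  have c2 := h'.chart_zero hw
  exact ((hγ.mono hs).eqOn (hγ'.mono hs') isOpen_Ioo isPreconnected_Ioo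
    (fun τ hτ => hp τ (hs hτ)) h0 (c1.1.trans c2.1.symm) (c1.2.trans c2.2.symm)
    ⟨by linarith, by linarith⟩).symm

/-- The exponential map in the chart around `p`. -/
def expChart (g : SmoothMetric n M) (p : M)
    (q : EuclideanSpace ℝ (Fin n) × EuclideanSpace ℝ (Fin n)) : EuclideanSpace ℝ (Fin n) :=
  extChartAt (𝓡 n) p (riemannianExp g (tangentCoords p q))

/-- Near the zero vectors, the exponential map is defined by the geodesics in a chart, which exist
on `(-1, 2)` by `exists_local_flow`. -/
theorem exists_exp_eq [T2Space M] (g : SmoothMetric n M) {p : M} {x₀ : EuclideanSpace ℝ (Fin n)}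
    (hx : x₀ ∈ (extChartAt (𝓡 n) p).target) :
    ∃ e : EuclideanSpace ℝ (Fin n) × EuclideanSpace ℝ (Fin n) → EuclideanSpace ℝ (Fin n),
      (∀ᶠ q in 𝓝 (x₀, (0 : EuclideanSpace ℝ (Fin n))), e q ∈ (extChartAt (𝓡 n) p).target ∧
        riemannianExp g (tangentCoords p q) = (extChartAt (𝓡 n) p).symm (e q)) ∧
      (∀ᶠ q in 𝓝 (x₀, (0 : EuclideanSpace ℝ (Fin n))), ContDiffAt ℝ ∞ e q) ∧
      HasFDerivAt e (ContinuousLinearMap.fst ℝ _ _ + ContinuousLinearMap.snd ℝ _ _) (x₀, 0) ∧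
      e (x₀, 0) = x₀ := by
  have ho := isOpen_extChartAt_target (I := 𝓡 n) p
  have hG := isMetricOn_chartForm g p
  obtain ⟨U, U', hU, hU1, hU2, hU3⟩ := exists_local_flow (ho.preimage continuous_fst)
    (fun q hq => (hG.contDiffAt_geodesicAcceleration ho hq q.2).contDiffWithinAt) hx
    (by simpa using geodesicAcceleration_smul (chartForm g p) x₀ 0 0)
    (hG.fderiv_geodesicAcceleration ho hx)
  refine ⟨fun q => U q 1, ?_, hU1, hU2, hU3⟩
  filter_upwards [hU] with q hq
  obtain ⟨hq0, hq0', hq⟩ := hq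
  have h0 : (0 : ℝ) ∈ Ioo (-1 : ℝ) 2 := by constructor <;> norm_num
  have h1 : (1 : ℝ) ∈ Ioo (-1 : ℝ) 2 := by constructor <;> norm_num
  refine ⟨(hq 1 h1).1, ?_⟩
  have hγ : IsGeodesicOn g (fun τ => (extChartAt (𝓡 n) p).symm (U q τ)) (Ioo (-1) (1 + 1)) := by
    rw [one_add_one_eq_two]
    exact isGeodesicOn_of_chart g isOpen_Ioo (fun τ hτ => (hq τ hτ).1) (fun τ hτ => (hq τ hτ).2.1)
      (fun τ hτ => (hq τ hτ).2.2)
  refine riemannianExp_eq ⟨⟨1, one_pos, hγ⟩, ?_⟩ one_pos hγ fun τ hτ =>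
    (extChartAt (𝓡 n) p).map_target (hq τ (by rwa [one_add_one_eq_two] at hτ)).1
  have h2 : mfderiv 𝓘(ℝ, ℝ) (𝓡 n) (fun τ => (extChartAt (𝓡 n) p).symm (U q τ)) 0 =
      (chartFrame p (U q 0)).comp (mfderiv 𝓘(ℝ, ℝ) 𝓘(ℝ, EuclideanSpace ℝ (Fin n)) (U q) 0) :=
    mfderiv_comp (0 : ℝ) (mdifferentiableAt_extChartAt_symm' (hq 0 h0).1)
      (hq 0 h0).2.1.differentiableAt.mdifferentiableAt
  have h3 : tangentCoords p q = tangentCoords p (U q 0, U' q 0) := by rw [hq0, hq0']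
  rw [h3, h2]
  rw [mfderiv_eq_fderiv]
  have h4 : fderiv ℝ (U q) 0 1 = U' q 0 := (hq 0 h0).2.1.deriv
  exact congrArg (fun v => (⟨(extChartAt (𝓡 n) p).symm (U q 0), chartFrame p (U q 0) v⟩ :
    TangentBundle (𝓡 n) M)) h4

variable [T2Space M] (g : SmoothMetric n M) {p : M} {x : EuclideanSpace ℝ (Fin n)}

theorem eventually_exp_mem (hx : x ∈ (extChartAt (𝓡 n) p).target) :
    ∀ᶠ q in 𝓝 (x, (0 : EuclideanSpace ℝ (Fin n))),
      riemannianExp g (tangentCoords p q) ∈ (extChartAt (𝓡 n) p).source := by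
  obtain ⟨e, he, -⟩ := exists_exp_eq g hx
  filter_upwards [he] with q hq
  rw [hq.2]
  exact (extChartAt (𝓡 n) p).map_target hq.1

/-- In a chart, the exponential map is smooth near the zero vectors, where its derivative is
`(x, v) ↦ x + v`. -/
theorem expChart_properties (hx : x ∈ (extChartAt (𝓡 n) p).target) :
    (∀ᶠ q in 𝓝 (x, (0 : EuclideanSpace ℝ (Fin n))), ContDiffAt ℝ ∞ (expChart g p) q) ∧
    HasFDerivAt (expChart g p) (ContinuousLinearMap.fst ℝ _ _ + ContinuousLinearMap.snd ℝ _ _)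
      (x, 0) ∧ expChart g p (x, 0) = x := by
  obtain ⟨e, he, h1, h2, h3⟩ := exists_exp_eq g hx
  have heq : expChart g p =ᶠ[𝓝 (x, 0)] e := by
    filter_upwards [he] with q hq
    rw [expChart, hq.2, (extChartAt (𝓡 n) p).right_inv hq.1]
  exact ⟨heq.eventuallyEq_nhds.mp (h1.mono fun q h h' => h.congr_of_eventuallyEq h'),
    h2.congr_of_eventuallyEq heq, heq.self_of_nhds.trans h3⟩

theorem eventually_contDiffAt_expChart (hx : x ∈ (extChartAt (𝓡 n) p).target) :
    ∀ᶠ q in 𝓝 (x, (0 : EuclideanSpace ℝ (Fin n))), ContDiffAt ℝ ∞ (expChart g p) q :=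
  (expChart_properties g hx).1

theorem hasFDerivAt_expChart (hx : x ∈ (extChartAt (𝓡 n) p).target) :
    HasFDerivAt (expChart g p) (ContinuousLinearMap.fst ℝ _ _ + ContinuousLinearMap.snd ℝ _ _)
      (x, 0) := (expChart_properties g hx).2.1

theorem expChart_zero (hx : x ∈ (extChartAt (𝓡 n) p).target) : expChart g p (x, 0) = x :=
  (expChart_properties g hx).2.2

end Exponential

/-! ### The gluing map in coordinates -/

section GlueCoords

variable {E : Type} [NormedAddCommGroup E] [NormedSpace ℝ E]

/-- The map `(x, v) ↦ (e(x, v/2), e(x, v/2) - e(x, -v/2))`, for a coordinate expression `e` of the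
exponential map. -/
def symExp (e : E × E → E) (q : E × E) : E × E :=
  (e (q.1, (2⁻¹ : ℝ) • q.2), e (q.1, (2⁻¹ : ℝ) • q.2) - e (q.1, -((2⁻¹ : ℝ) • q.2)))

/-- The map `(x, v, t) ↦ (e(x, tv/2), (e(x, tv/2) - e(x, -tv/2)) / t)`, extended smoothly to
`t = 0`: the gluing map in coordinates. The quotient is written as a difference of two difference
quotients of `e` at `(x, 0)`. -/
def glueCoords (e : E × E → E) (q : (E × E) × ℝ) : E × E :=
  (e (q.1.1, (q.2 / 2) • q.1.2),
    diffQuot e (q.1.1, 0) (0, (2⁻¹ : ℝ) • q.1.2) q.2 -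
      diffQuot e (q.1.1, 0) (0, -((2⁻¹ : ℝ) • q.1.2)) q.2)

theorem glueCoords_of_ne (e : E × E → E) (x v : E) {t : ℝ} (ht : t ≠ 0) :
    glueCoords e ((x, v), t) = ((symExp e (x, t • v)).1, t⁻¹ • (symExp e (x, t • v)).2) := by
  have h1 : (t / 2) • v = (2⁻¹ : ℝ) • t • v := by rw [smul_smul]; congr 1; ring
  have h2 : ((x, 0) : E × E) + t • (0, (2⁻¹ : ℝ) • v) = (x, (2⁻¹ : ℝ) • t • v) := by
    simp [smul_comm t]
  have h3 : ((x, 0) : E × E) + t • (0, -((2⁻¹ : ℝ) • v)) = (x, -((2⁻¹ : ℝ) • t • v)) := by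
    simp [smul_comm t]
  simp only [glueCoords, symExp, diffQuot_of_ne _ _ _ ht, h1, h2, h3, ← smul_sub]
  congr 2
  abel

theorem glueCoords_zero {e : E × E → E} {x : E} (v : E) (h : e (x, 0) = x)
    (hd : HasFDerivAt e (ContinuousLinearMap.fst ℝ E E + ContinuousLinearMap.snd ℝ E E) (x, 0)) :
    glueCoords e ((x, v), 0) = (x, v) := by
  simp only [glueCoords, diffQuot_zero, hd.fderiv, zero_div, zero_smul, h]
  simp [← two_smul ℝ, smul_smul]

/-- The derivative `(x, v) ↦ (x + v / 2, v)` of `symExp e` at zero vectors. -/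
def symExpDeriv : (E × E) ≃L[ℝ] (E × E) :=
  ContinuousLinearEquiv.equivOfInverse
    ((ContinuousLinearMap.fst ℝ E E + (2⁻¹ : ℝ) • ContinuousLinearMap.snd ℝ E E).prod
      (ContinuousLinearMap.snd ℝ E E))
    ((ContinuousLinearMap.fst ℝ E E - (2⁻¹ : ℝ) • ContinuousLinearMap.snd ℝ E E).prod
      (ContinuousLinearMap.snd ℝ E E))
    (fun q => by simp) (fun q => by simp)

theorem hasFDerivAt_symExp {e : E × E → E} {x : E}
    (hd : HasFDerivAt e (ContinuousLinearMap.fst ℝ E E + ContinuousLinearMap.snd ℝ E E) (x, 0)) :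
    HasFDerivAt (symExp e) ((symExpDeriv : (E × E) ≃L[ℝ] (E × E)) : (E × E) →L[ℝ] (E × E))
      (x, 0) := by
  let L : ℝ → E × E →L[ℝ] E × E := fun c =>
    (ContinuousLinearMap.fst ℝ E E).prod (c • ContinuousLinearMap.snd ℝ E E)
  have hL : ∀ c : ℝ, HasFDerivAt (fun q => e (L c q))
      ((ContinuousLinearMap.fst ℝ E E + ContinuousLinearMap.snd ℝ E E).comp (L c)) (x, 0) :=
    fun c => HasFDerivAt.comp (g := e) _ (by simpa [L] using hd) (L c).hasFDerivAt
  have h := (hL 2⁻¹).prodMk ((hL 2⁻¹).sub (hL (-2⁻¹)))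
  have hD : ((ContinuousLinearMap.fst ℝ E E + ContinuousLinearMap.snd ℝ E E).comp (L 2⁻¹)).prod
      ((ContinuousLinearMap.fst ℝ E E + ContinuousLinearMap.snd ℝ E E).comp (L 2⁻¹) -
      (ContinuousLinearMap.fst ℝ E E + ContinuousLinearMap.snd ℝ E E).comp (L (-2⁻¹))) =
      ((symExpDeriv : (E × E) ≃L[ℝ] (E × E)) : (E × E) →L[ℝ] (E × E)) := by
    refine ContinuousLinearMap.ext fun q => Prod.ext ?_ ?_
    · simp [L, symExpDeriv]
    · simp [L, symExpDeriv]
      rw [← add_smul]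
      norm_num
  rw [hD] at h
  refine h.congr_of_eventuallyEq (Filter.Eventually.of_forall fun q => ?_)
  simp [symExp, L]

theorem contDiffAt_symExp {e : E × E → E} {Ω : Set (E × E)} (hΩ : IsOpen Ω)
    (he : ContDiffOn ℝ ∞ e Ω) {q : E × E} (h1 : (q.1, (2⁻¹ : ℝ) • q.2) ∈ Ω)
    (h2 : (q.1, -((2⁻¹ : ℝ) • q.2)) ∈ Ω) : ContDiffAt ℝ ∞ (symExp e) q := by
  have e1 : ContDiffAt ℝ ∞ (fun q : E × E => e (q.1, (2⁻¹ : ℝ) • q.2)) q :=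
    (he.contDiffAt (hΩ.mem_nhds h1)).comp q (by fun_prop)
  have e2 : ContDiffAt ℝ ∞ (fun q : E × E => e (q.1, -((2⁻¹ : ℝ) • q.2))) q :=
    (he.contDiffAt (hΩ.mem_nhds h2)).comp q (by fun_prop)
  exact e1.prodMk (e1.sub e2)

/-- The domain on which `glueCoords e` is smooth, if `e` is smooth on `Ω`. -/
def glueDomain (Ω : Set (E × E)) : Set ((E × E) × ℝ) :=
  {q | (q.1.1, (0 : E)) ∈ Ω ∧ (q.1.1, (2⁻¹ : ℝ) • q.2 • q.1.2) ∈ Ω ∧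
    (q.1.1, -((2⁻¹ : ℝ) • q.2 • q.1.2)) ∈ Ω}

theorem isOpen_glueDomain {Ω : Set (E × E)} (hΩ : IsOpen Ω) : IsOpen (glueDomain Ω) :=
  (hΩ.preimage (f := fun q : (E × E) × ℝ => (q.1.1, (0 : E))) (by fun_prop)).inter
    ((hΩ.preimage (f := fun q : (E × E) × ℝ => (q.1.1, (2⁻¹ : ℝ) • q.2 • q.1.2))
      (by fun_prop)).inter (hΩ.preimage
        (f := fun q : (E × E) × ℝ => (q.1.1, -((2⁻¹ : ℝ) • q.2 • q.1.2))) (by fun_prop)))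

variable [FiniteDimensional ℝ E]

theorem contDiffOn_glueCoords {e : E × E → E} {Ω : Set (E × E)} (hΩ : IsOpen Ω)
    (he : ContDiffOn ℝ ∞ e Ω) : ContDiffOn ℝ ∞ (glueCoords e) (glueDomain Ω) := by
  rintro ⟨⟨x, v⟩, t⟩ ⟨h0, h1, h2⟩
  have h1' : (t / 2) • v = (2⁻¹ : ℝ) • t • v := by rw [smul_smul]; congr 1; ring
  have e1 : ContDiffAt ℝ ∞ (fun q : (E × E) × ℝ => e (q.1.1, (q.2 / 2) • q.1.2)) ((x, v), t) := by
    refine ContDiffAt.comp (g := e) ((x, v), t) (he.contDiffAt (hΩ.mem_nhds ?_)) (by fun_prop)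
    rw [h1']
    exact h1
  have e2 : ContDiffAt ℝ ∞ (fun q : (E × E) × ℝ =>
      diffQuot e (q.1.1, 0) (0, (2⁻¹ : ℝ) • q.1.2) q.2) ((x, v), t) := by
    have h3 := contDiffAt_diffQuot hΩ he (x := (x, 0)) (v := (0, (2⁻¹ : ℝ) • v)) (t := t) h0
      (by simpa [smul_comm t] using h1)
    exact h3.comp ((x, v), t)
      (f := fun q : (E × E) × ℝ => (((q.1.1, 0), (0, (2⁻¹ : ℝ) • q.1.2)), q.2)) (by fun_prop)
  have e3 : ContDiffAt ℝ ∞ (fun q : (E × E) × ℝ =>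
      diffQuot e (q.1.1, 0) (0, -((2⁻¹ : ℝ) • q.1.2)) q.2) ((x, v), t) := by
    have h3 := contDiffAt_diffQuot hΩ he (x := (x, 0)) (v := (0, -((2⁻¹ : ℝ) • v))) (t := t) h0
      (by simpa [smul_comm t] using h2)
    exact h3.comp ((x, v), t)
      (f := fun q : (E × E) × ℝ => (((q.1.1, 0), (0, -((2⁻¹ : ℝ) • q.1.2))), q.2)) (by fun_prop)
  exact (e1.prodMk (e2.sub e3)).contDiffWithinAt

/-- The gluing map in coordinates is a local diffeomorphism: at `t = 0` it is the identity in
`(x, v)`, and at `t ≠ 0` it is conjugate to `symExp e` by the rescaling of `v`. -/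
theorem isLocalDiffeomorphAt_glueCoords {e : E × E → E} {Ω : Set (E × E)} (hΩ : IsOpen Ω)
    (he : ContDiffOn ℝ ∞ e Ω) {T : Set E} (hT : IsOpen T)
    (hTe : ∀ x ∈ T, e (x, 0) = x ∧
      HasFDerivAt e (ContinuousLinearMap.fst ℝ E E + ContinuousLinearMap.snd ℝ E E) (x, 0))
    {q : (E × E) × Icc (0 : ℝ) 1} (hx : q.1.1 ∈ T) (hq : slabIncl q ∈ glueDomain Ω)
    {A : (E × E) ≃L[ℝ] (E × E)}
    (hA : HasFDerivAt (symExp e) (A : (E × E) →L[ℝ] (E × E)) (q.1.1, (q.2 : ℝ) • q.1.2)) :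
    IsLocalDiffeomorphAt (slabModel E) (slabModel E) ∞
      (fun q : (E × E) × Icc (0 : ℝ) 1 => (glueCoords e (slabIncl q), q.2)) q := by
  by_cases ht : (q.2 : ℝ) = 0
  · refine isLocalDiffeomorphAt_slab (isOpen_glueDomain hΩ) (contDiffOn_glueCoords hΩ he) hq
      (ContinuousLinearEquiv.refl ℝ (E × E)) ?_
    refine (hasFDerivAt_id q.1).congr_of_eventuallyEq ?_
    filter_upwards [(hT.preimage continuous_fst).mem_nhds hx] with z hz
    rw [ht]
    exact glueCoords_zero z.2 (hTe z.1 hz).1 (hTe z.1 hz).2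
  · let D : (E × E) ≃L[ℝ] (E × E) := (ContinuousLinearEquiv.refl ℝ E).prodCongr
      (ContinuousLinearEquiv.smulLeft (Units.mk0 (q.2 : ℝ) ht))
    refine isLocalDiffeomorphAt_slab (isOpen_glueDomain hΩ) (contDiffOn_glueCoords hΩ he) hq
      ((D.trans A).trans D.symm) ?_
    have hD : ∀ z : E × E, D z = (z.1, (q.2 : ℝ) • z.2) := fun z => rfl
    have hD' : ∀ z : E × E, D.symm z = (z.1, (q.2 : ℝ)⁻¹ • z.2) := fun z => by
      rw [ContinuousLinearEquiv.symm_apply_eq, hD]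
      simp [smul_smul, ht]
    have h1 : HasFDerivAt (fun z => D.symm (symExp e (D z)))
        (((D.trans A).trans D.symm : (E × E) ≃L[ℝ] (E × E)) : (E × E) →L[ℝ] (E × E)) q.1 :=
      (D.symm : (E × E) →L[ℝ] (E × E)).hasFDerivAt.comp q.1
        (HasFDerivAt.comp (g := symExp e) (f := D) q.1 hA D.hasFDerivAt)
    refine h1.congr_of_eventuallyEq (Filter.Eventually.of_forall fun z => ?_)
    change glueCoords e ((z.1, z.2), (q.2 : ℝ)) = D.symm (symExp e (D z))
    rw [glueCoords_of_ne e z.1 z.2 ht, hD', hD]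

end GlueCoords

/-! ### The gluing map -/

namespace TangentGroupoid

variable {n : ℕ} {M : Type*} [TopologicalSpace M] [ChartedSpace (EuclideanSpace ℝ (Fin n)) M]

/-- Multiplication of tangent vectors by scalars. -/
def scale (t : ℝ) (w : TangentBundle (𝓡 n) M) : TangentBundle (𝓡 n) M := ⟨w.1, t • w.2⟩

theorem scale_scale (s t : ℝ) (w : TangentBundle (𝓡 n) M) :
    scale s (scale t w) = scale (s * t) w :=
  congrArg (fun v => (⟨w.1, v⟩ : TangentBundle (𝓡 n) M)) (smul_smul s t w.2)

theorem scale_one (w : TangentBundle (𝓡 n) M) : scale 1 w = w :=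
  congrArg (fun v => (⟨w.1, v⟩ : TangentBundle (𝓡 n) M)) (one_smul ℝ w.2)

theorem scale_injective {t : ℝ} (ht : t ≠ 0) : Function.Injective (scale (n := n) (M := M) t) :=
  Function.LeftInverse.injective (g := scale t⁻¹) fun w => by
    rw [scale_scale, inv_mul_cancel₀ ht, scale_one]

variable [IsManifold (𝓡 n) ∞ M]

theorem scale_tangentCoords (p : M) (q : EuclideanSpace ℝ (Fin n) × EuclideanSpace ℝ (Fin n))
    (t : ℝ) : scale t (tangentCoords p q) = tangentCoords p (q.1, t • q.2) :=
  congrArg (fun v => (⟨(extChartAt (𝓡 n) p).symm q.1, v⟩ : TangentBundle (𝓡 n) M))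
    (map_smul (chartFrame p q.1) t q.2).symm

theorem tangentCoords_symm_apply {p : M} {w : TangentBundle (𝓡 n) M}
    (hw : w.1 ∈ (extChartAt (𝓡 n) p).source) :
    ∃ q, q.1 ∈ (extChartAt (𝓡 n) p).target ∧ tangentCoords p q = w :=
  ⟨(tangentCoords p).symm w, (tangentCoords p).map_target' hw, (tangentCoords p).right_inv' hw⟩

/-- The coordinates of `TM × [0, 1]` given by a chart of `M`. -/
def tangentSlabCoords (p : M) : PartialDiffeomorph (slabModel (EuclideanSpace ℝ (Fin n)))
    ((𝓡 n).tangent.prod (𝓡∂ 1)) (Slab n) (TangentBundle (𝓡 n) M × Icc (0 : ℝ) 1) ∞ where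
  toFun q := (tangentCoords p q.1, q.2)
  invFun w := ((tangentCoords p).symm w.1, w.2)
  source := {q | q.1.1 ∈ (extChartAt (𝓡 n) p).target}
  target := {w | w.1.1 ∈ (extChartAt (𝓡 n) p).source}
  map_source' _ hq := (tangentCoords p).map_source' hq
  map_target' _ hw := (tangentCoords p).map_target' hw
  left_inv' _ hq := Prod.ext ((tangentCoords p).left_inv' hq) rfl
  right_inv' _ hw := Prod.ext ((tangentCoords p).right_inv' hw) rfl
  open_source := (tangentCoords p).open_source.preimage continuous_fst
  open_target := (tangentCoords p).open_target.preimage continuous_fst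
  contMDiffOn_toFun := ((tangentCoords p).contMDiffOn_toFun.comp contMDiffOn_fst
    (fun _ hq => hq)).prodMk contMDiffOn_snd
  contMDiffOn_invFun := ((tangentCoords p).contMDiffOn_invFun.comp contMDiffOn_fst
    (fun _ hq => hq)).prodMk contMDiffOn_snd

theorem continuousAt_iff_tangentCoords {X : Type*} [TopologicalSpace X]
    {f : TangentBundle (𝓡 n) M → X} {p : M}
    {q : EuclideanSpace ℝ (Fin n) × EuclideanSpace ℝ (Fin n)}
    (hq : q.1 ∈ (extChartAt (𝓡 n) p).target) :
    ContinuousAt f (tangentCoords p q) ↔ ContinuousAt (fun q => f (tangentCoords p q)) q := by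
  have h := (tangentCoords p).toOpenPartialHomeomorph.map_nhds_eq (x := q) hq
  change Filter.map (tangentCoords p) (𝓝 q) = 𝓝 (tangentCoords p q) at h
  rw [ContinuousAt, ← h, Filter.tendsto_map'_iff]
  rfl

theorem continuous_scale :
    Continuous (fun w : TangentBundle (𝓡 n) M × Icc (0 : ℝ) 1 => scale (w.2 : ℝ) w.1) := by
  rw [continuous_iff_continuousAt]
  rintro ⟨w, t⟩
  obtain ⟨p, q, hq, rfl⟩ : ∃ p, ∃ q, q.1 ∈ (extChartAt (𝓡 n) p).target ∧ tangentCoords p q = w :=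
    ⟨w.1, tangentCoords_symm_apply (mem_extChartAt_source (I := 𝓡 n) w.1)⟩
  have h := (tangentSlabCoords p).toOpenPartialHomeomorph.map_nhds_eq (x := (q, t)) hq
  change Filter.map (tangentSlabCoords p) (𝓝 (q, t)) = 𝓝 (tangentCoords p q, t) at h
  rw [ContinuousAt, ← h, Filter.tendsto_map'_iff]
  have h1 : ContinuousAt (fun z : Slab n => tangentCoords p (z.1.1, (z.2 : ℝ) • z.1.2)) (q, t) :=
    ContinuousAt.comp (g := tangentCoords p)
      ((tangentCoords p).contMDiffOn_toFun.continuousOn.continuousAt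
        ((tangentCoords p).open_source.mem_nhds hq)) (by fun_prop)
  have h2 : (fun w : TangentBundle (𝓡 n) M × Icc (0 : ℝ) 1 => scale (w.2 : ℝ) w.1) ∘
      tangentSlabCoords p = fun z : Slab n => tangentCoords p (z.1.1, (z.2 : ℝ) • z.1.2) := by
    funext z
    exact scale_tangentCoords p z.1 z.2
  rw [h2]
  change Filter.Tendsto _ _ (𝓝 (scale (t : ℝ) (tangentCoords p q)))
  rw [scale_tangentCoords]
  exact h1

/-- A neighbourhood of the zero vectors, in the coordinates around `p`, on which the exponential
map is smooth and takes values in the domain of the chart. -/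
def expDomain (g : SmoothMetric n M) (p : M) :
    Set (EuclideanSpace ℝ (Fin n) × EuclideanSpace ℝ (Fin n)) :=
  interior {q | q.1 ∈ (extChartAt (𝓡 n) p).target ∧
    riemannianExp g (tangentCoords p q) ∈ (extChartAt (𝓡 n) p).source ∧
    ContDiffAt ℝ ∞ (expChart g p) q}

/-- A neighbourhood of the zero vectors, in the coordinates around `p`, on which
`v ↦ (exp(v / 2), exp(-v / 2))` is a local diffeomorphism. -/
def symDomain (g : SmoothMetric n M) (p : M) :
    Set (EuclideanSpace ℝ (Fin n) × EuclideanSpace ℝ (Fin n)) :=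
  interior {q | (q.1, (2⁻¹ : ℝ) • q.2) ∈ expDomain g p ∧ (q.1, -((2⁻¹ : ℝ) • q.2)) ∈ expDomain g p ∧
    ∃ A : (EuclideanSpace ℝ (Fin n) × EuclideanSpace ℝ (Fin n)) ≃L[ℝ]
      (EuclideanSpace ℝ (Fin n) × EuclideanSpace ℝ (Fin n)), HasFDerivAt (symExp (expChart g p))
      (A : (EuclideanSpace ℝ (Fin n) × EuclideanSpace ℝ (Fin n)) →L[ℝ]
        (EuclideanSpace ℝ (Fin n) × EuclideanSpace ℝ (Fin n))) q}

variable (g : SmoothMetric n M) {p : M}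

theorem isOpen_expDomain : IsOpen (expDomain g p) := isOpen_interior

theorem isOpen_symDomain : IsOpen (symDomain g p) := isOpen_interior

theorem contDiffOn_expDomain : ContDiffOn ℝ ∞ (expChart g p) (expDomain g p) :=
  fun _ hq => (interior_subset hq).2.2.contDiffWithinAt

variable {g}

theorem mem_target_of_mem_symDomain
    {q : EuclideanSpace ℝ (Fin n) × EuclideanSpace ℝ (Fin n)} (hq : q ∈ symDomain g p) :
    q.1 ∈ (extChartAt (𝓡 n) p).target :=
  (interior_subset (interior_subset hq).1).1

theorem exp_tangentCoords {q : EuclideanSpace ℝ (Fin n) × EuclideanSpace ℝ (Fin n)}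
    (hq : q ∈ expDomain g p) : expChart g p q ∈ (extChartAt (𝓡 n) p).target ∧
      riemannianExp g (tangentCoords p q) = (extChartAt (𝓡 n) p).symm (expChart g p q) :=
  ⟨(extChartAt (𝓡 n) p).map_source (interior_subset hq).2.1,
    ((extChartAt (𝓡 n) p).left_inv (interior_subset hq).2.1).symm⟩

/-- The map `w ↦ (exp(w / 2), exp(-w / 2))`. -/
def symExpMap (g : SmoothMetric n M) (w : TangentBundle (𝓡 n) M) : M × M :=
  (riemannianExp g (scale 2⁻¹ w), riemannianExp g (scale (-2⁻¹) w))

theorem symExpMap_tangentCoords {q : EuclideanSpace ℝ (Fin n) × EuclideanSpace ℝ (Fin n)}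
    (hq : q ∈ symDomain g p) : symExpMap g (tangentCoords p q) =
      ((extChartAt (𝓡 n) p).symm (expChart g p (q.1, (2⁻¹ : ℝ) • q.2)),
        (extChartAt (𝓡 n) p).symm (expChart g p (q.1, -((2⁻¹ : ℝ) • q.2)))) := by
  obtain ⟨h1, h2, -⟩ := interior_subset hq
  rw [symExpMap, scale_tangentCoords, scale_tangentCoords, neg_smul, (exp_tangentCoords h1).2,
    (exp_tangentCoords h2).2]

theorem glue_of_pos (g : SmoothMetric n M) {w : TangentBundle (𝓡 n) M} {t : Icc (0 : ℝ) 1}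
    (ht : 0 < (t : ℝ)) : glue g (w, t) =
      pair (symExpMap g (scale t w)).1 (symExpMap g (scale t w)).2 ⟨t, ht⟩ := by
  rw [symExpMap, scale_scale, scale_scale, ← neg_mul_eq_neg_mul, ← div_eq_inv_mul]
  exact dif_pos (show t ∈ unitIoc from ht)

theorem glue_of_eq_zero (g : SmoothMetric n M) {w : TangentBundle (𝓡 n) M} {t : Icc (0 : ℝ) 1}
    (ht : (t : ℝ) = 0) : glue g (w, t) = tangent w.1 w.2 :=
  dif_neg fun h' : 0 < (t : ℝ) => h'.ne' ht

theorem continuousAt_symExpMap {q : EuclideanSpace ℝ (Fin n) × EuclideanSpace ℝ (Fin n)}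
    (hq : q ∈ symDomain g p) : ContinuousAt (symExpMap g) (tangentCoords p q) := by
  rw [continuousAt_iff_tangentCoords (mem_target_of_mem_symDomain hq)]
  obtain ⟨h1, h2, -⟩ := interior_subset hq
  have hs : ∀ c : ℝ, (q.1, c • q.2) ∈ expDomain g p → ContinuousAt
      (fun q => (extChartAt (𝓡 n) p).symm (expChart g p (q.1, c • q.2))) q := fun c hc => by
    have e1 : ContinuousAt (fun q => expChart g p (q.1, c • q.2)) q :=
      ContinuousAt.comp (g := expChart g p) (interior_subset hc).2.2.continuousAt (by fun_prop)
    exact ContinuousAt.comp (g := (extChartAt (𝓡 n) p).symm)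
      (continuousAt_extChartAt_symm'' (exp_tangentCoords hc).1) e1
  have h3 := (hs _ h1).prodMk (hs (-2⁻¹) (by rwa [neg_smul]))
  refine h3.congr ?_
  filter_upwards [(isOpen_symDomain g).mem_nhds hq] with z hz
  rw [symExpMap_tangentCoords hz, neg_smul]

variable [T2Space M]

theorem zero_mem_expDomain {x : EuclideanSpace ℝ (Fin n)} (hx : x ∈ (extChartAt (𝓡 n) p).target) :
    (x, 0) ∈ expDomain g p := by
  rw [expDomain, mem_interior_iff_mem_nhds]
  filter_upwards [eventually_exp_mem g hx, eventually_contDiffAt_expChart g hx,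
    ((isOpen_extChartAt_target (I := 𝓡 n) p).preimage continuous_fst).mem_nhds
      (show ((x, 0) : EuclideanSpace ℝ (Fin n) × EuclideanSpace ℝ (Fin n)) ∈ _ from hx)]
    with q h1 h2 h3
  exact ⟨h3, h1, h2⟩

theorem eventually_mem_expDomain {x : EuclideanSpace ℝ (Fin n)}
    (hx : x ∈ (extChartAt (𝓡 n) p).target) (c : ℝ) :
    ∀ᶠ q in 𝓝 (x, (0 : EuclideanSpace ℝ (Fin n))), (q.1, c • q.2) ∈ expDomain g p := by
  have hc : ContinuousAt (fun q : EuclideanSpace ℝ (Fin n) × EuclideanSpace ℝ (Fin n) =>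
    (q.1, c • q.2)) (x, 0) := by fun_prop
  refine hc.eventually ((isOpen_expDomain g).mem_nhds ?_)
  simpa using zero_mem_expDomain hx

theorem zero_mem_symDomain {x : EuclideanSpace ℝ (Fin n)} (hx : x ∈ (extChartAt (𝓡 n) p).target) :
    (x, 0) ∈ symDomain g p := by
  rw [symDomain, mem_interior_iff_mem_nhds]
  have h0 := zero_mem_expDomain (g := g) hx
  have hs : ContDiffAt ℝ ∞ (symExp (expChart g p)) (x, 0) :=
    contDiffAt_symExp (isOpen_expDomain g) (contDiffOn_expDomain g) (by simpa using h0)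
      (by simpa using h0)
  have hinv : ∀ᶠ q in 𝓝 (x, (0 : EuclideanSpace ℝ (Fin n))),
      fderiv ℝ (symExp (expChart g p)) q ∈ Set.range
        ((↑) : ((EuclideanSpace ℝ (Fin n) × EuclideanSpace ℝ (Fin n)) ≃L[ℝ]
          (EuclideanSpace ℝ (Fin n) × EuclideanSpace ℝ (Fin n))) →
          ((EuclideanSpace ℝ (Fin n) × EuclideanSpace ℝ (Fin n)) →L[ℝ]
          (EuclideanSpace ℝ (Fin n) × EuclideanSpace ℝ (Fin n)))) := by
    refine (hs.continuousAt_fderiv (by simp)).eventually ?_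
    rw [(hasFDerivAt_symExp (hasFDerivAt_expChart g hx)).fderiv]
    exact ContinuousLinearEquiv.nhds _
  filter_upwards [hinv, eventually_mem_expDomain hx 2⁻¹, eventually_mem_expDomain hx (-2⁻¹)]
    with q ⟨A, hA⟩ h1 h2
  rw [neg_smul] at h2
  refine ⟨h1, h2, A, ?_⟩
  rw [hA]
  exact ((contDiffAt_symExp (isOpen_expDomain g) (contDiffOn_expDomain g) h1 h2).differentiableAt
    (by simp)).hasFDerivAt

/-- In coordinates, the gluing map is `glueCoords`. -/
theorem glue_tangentCoords {q : Slab n} (hq : (q.1.1, (q.2 : ℝ) • q.1.2) ∈ symDomain g p) :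
    (glueCoords (expChart g p) (slabIncl q), q.2) ∈ paramSource p p ∧
    glue g (tangentCoords p q.1, q.2) =
      param p p (glueCoords (expChart g p) (slabIncl q), q.2) := by
  have hx := mem_target_of_mem_symDomain hq
  obtain ⟨h1, h2, -⟩ := interior_subset hq
  rcases eq_zero_or_pos q.2 with ht | ht
  · have h3 : glueCoords (expChart g p) (slabIncl q) = q.1 := by
      rw [slabIncl, ht]
      exact glueCoords_zero q.1.2 (expChart_zero g hx) (hasFDerivAt_expChart g hx)
    rw [h3]
    refine ⟨⟨hx, ?_, Or.inr rfl⟩, ?_⟩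
    · change q.1.1 - (q.2 : ℝ) • q.1.2 ∈ _
      rw [ht, zero_smul, sub_zero]
      exact hx
    · rw [param_of_eq_zero p p ht]
      exact dif_neg fun h' : 0 < (q.2 : ℝ) => h'.ne' ht
  · have h3 : glueCoords (expChart g p) (slabIncl q) = _ :=
      glueCoords_of_ne (expChart g p) q.1.1 q.1.2 ht.ne'
    have h4 : (glueCoords (expChart g p) (slabIncl q)).1 - (q.2 : ℝ) •
        (glueCoords (expChart g p) (slabIncl q)).2 =
        expChart g p (q.1.1, -((2⁻¹ : ℝ) • (q.2 : ℝ) • q.1.2)) := by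
      rw [h3]
      simp [smul_smul, ht.ne', symExp]
    have h5 : (glueCoords (expChart g p) (slabIncl q)).1 =
        expChart g p (q.1.1, (2⁻¹ : ℝ) • (q.2 : ℝ) • q.1.2) := by
      rw [h3]
      rfl
    refine ⟨⟨?_, ?_, Or.inl ht⟩, ?_⟩
    · change (glueCoords (expChart g p) (slabIncl q)).1 ∈ _
      rw [h5]
      exact (exp_tangentCoords h1).1
    · change (glueCoords (expChart g p) (slabIncl q)).1 - (q.2 : ℝ) •
        (glueCoords (expChart g p) (slabIncl q)).2 ∈ _
      rw [h4]
      exact (exp_tangentCoords h2).1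
    · rw [param_of_pos p p (z := (glueCoords (expChart g p) (slabIncl q), q.2)) ht]
      change _ = pair ((extChartAt (𝓡 n) p).symm (glueCoords (expChart g p) (slabIncl q)).1)
        ((extChartAt (𝓡 n) p).symm ((glueCoords (expChart g p) (slabIncl q)).1 - (q.2 : ℝ) •
        (glueCoords (expChart g p) (slabIncl q)).2)) _
      rw [h4, h5, ← (exp_tangentCoords h1).2, ← (exp_tangentCoords h2).2]
      have e1 : tangentCoords p (q.1.1, (2⁻¹ : ℝ) • (q.2 : ℝ) • q.1.2) =
          scale ((q.2 : ℝ) / 2) (tangentCoords p q.1) := by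
        rw [scale_tangentCoords, smul_smul, div_eq_inv_mul]
      have e2 : tangentCoords p (q.1.1, -((2⁻¹ : ℝ) • (q.2 : ℝ) • q.1.2)) =
          scale (-((q.2 : ℝ) / 2)) (tangentCoords p q.1) := by
        rw [scale_tangentCoords, smul_smul, div_eq_inv_mul, neg_smul]
      rw [e1, e2]
      exact dif_pos (show q.2 ∈ unitIoc from ht)

theorem isLocalDiffeomorphAt_glue {q : Slab n}
    (hq : (q.1.1, (q.2 : ℝ) • q.1.2) ∈ symDomain g p) :
    IsLocalDiffeomorphAt ((𝓡 n).tangent.prod (𝓡∂ 1)) (slabModel (EuclideanSpace ℝ (Fin n))) ∞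
      (glue g) (tangentCoords p q.1, q.2) := by
  have hx := mem_target_of_mem_symDomain hq
  obtain ⟨h1, h2, A, hA⟩ := interior_subset hq
  have hT : IsLocalDiffeomorphAt (slabModel (EuclideanSpace ℝ (Fin n)))
      ((𝓡 n).tangent.prod (𝓡∂ 1)) ∞ (tangentSlabCoords p) q :=
    ⟨tangentSlabCoords p, hx, fun _ _ => rfl⟩
  refine IsLocalDiffeomorphAt.of_comp (f := tangentSlabCoords p) (g := glue g) hT ?_
  have hk := isLocalDiffeomorphAt_glueCoords (e := expChart g p) (Ω := expDomain g p)
    (isOpen_expDomain g) (contDiffOn_expDomain g) (isOpen_extChartAt_target (I := 𝓡 n) p)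
    (fun x hx => ⟨expChart_zero g hx, hasFDerivAt_expChart g hx⟩) (q := q) hx
    ⟨zero_mem_expDomain hx, h1, h2⟩ hA
  refine (IsLocalDiffeomorphAt.comp (slabModel (EuclideanSpace ℝ (Fin n))) _ hk
    (isLocalDiffeomorphAt_param (glue_tangentCoords hq).1)).congr_of_eventuallyEq ?_
  have hc : ContinuousAt (fun z : Slab n => (z.1.1, (z.2 : ℝ) • z.1.2)) q := by fun_prop
  filter_upwards [hc.eventually ((isOpen_symDomain g).mem_nhds hq)] with z hz
  exact (glue_tangentCoords hz).2

theorem symExpMap_zero (x : M) : symExpMap g ⟨x, 0⟩ = (x, x) := by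
  obtain ⟨q, hq, hqx⟩ := tangentCoords_symm_apply (n := n) (w := ⟨x, 0⟩)
    (mem_extChartAt_source (I := 𝓡 n) x)
  have hs : scale (n := n) (M := M) 0 ⟨x, 0⟩ = ⟨x, 0⟩ :=
    congrArg (fun v => (⟨x, v⟩ : TangentBundle (𝓡 n) M)) (zero_smul ℝ _)
  have h0 : tangentCoords x (q.1, 0) = (⟨x, 0⟩ : TangentBundle (𝓡 n) M) := by
    rw [← hs, ← hqx, scale_tangentCoords, zero_smul]
  have hx : (extChartAt (𝓡 n) x).symm q.1 = x := congrArg Bundle.TotalSpace.proj h0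
  rw [← h0, symExpMap_tangentCoords (zero_mem_symDomain hq)]
  simp only [smul_zero, neg_zero, expChart_zero g hq, hx]

theorem exists_injOn_symExpMap {x : EuclideanSpace ℝ (Fin n)}
    (hx : x ∈ (extChartAt (𝓡 n) p).target) :
    ∃ N ∈ 𝓝 (tangentCoords p (x, 0)), InjOn (symExpMap g) N := by
  have hx0 := zero_mem_symDomain (g := g) hx
  obtain ⟨h1, h2, -⟩ := interior_subset hx0
  have hs := (contDiffAt_symExp (isOpen_expDomain g) (contDiffOn_expDomain g) h1
    h2).hasStrictFDerivAt' (hasFDerivAt_symExp (hasFDerivAt_expChart g hx)) (by simp)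
  let e := hs.toOpenPartialHomeomorph (symExp (expChart g p))
  have he : e.source ∩ symDomain g p ∈ 𝓝 (x, (0 : EuclideanSpace ℝ (Fin n))) :=
    Filter.inter_mem (e.open_source.mem_nhds hs.mem_toOpenPartialHomeomorph_source)
      ((isOpen_symDomain g).mem_nhds hx0)
  have hm := (tangentCoords p).toOpenPartialHomeomorph.map_nhds_eq (x := (x, 0)) hx
  change Filter.map (tangentCoords p) _ = 𝓝 (tangentCoords p (x, 0)) at hm
  refine ⟨_, hm ▸ Filter.image_mem_map he, ?_⟩
  rintro _ ⟨q, ⟨hqe, hq⟩, rfl⟩ _ ⟨q', ⟨hqe', hq'⟩, rfl⟩ h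
  rw [symExpMap_tangentCoords hq, symExpMap_tangentCoords hq'] at h
  have hi := (extChartAt (𝓡 n) p).symm.injOn
  obtain ⟨m1, m2, -⟩ := interior_subset hq
  obtain ⟨m1', m2', -⟩ := interior_subset hq'
  have e1 := hi (exp_tangentCoords m1).1 (exp_tangentCoords m1').1 (congrArg Prod.fst h)
  have e2 := hi (exp_tangentCoords m2).1 (exp_tangentCoords m2').1 (congrArg Prod.snd h)
  have e3 : symExp (expChart g p) q = symExp (expChart g p) q' := by
    simp only [symExp, e1, e2]
  rw [e.injOn hqe hqe' e3]

/-- A neighbourhood of the zero section of `TM` on which `w ↦ (exp(w / 2), exp(-w / 2))` is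
injective and a local diffeomorphism. Injectivity near the zero section follows from its
compactness, since the map is injective on it and locally injective around its points. -/
theorem exists_nhds_zeroSection [CompactSpace M] (g : SmoothMetric n M) :
    ∃ W : Set (TangentBundle (𝓡 n) M), IsOpen W ∧ (∀ x, ⟨x, 0⟩ ∈ W) ∧ InjOn (symExpMap g) W ∧
      ∀ w ∈ W, ∃ p, ∃ q ∈ symDomain g p, tangentCoords p q = w := by
  have hzero : ∀ x : M, ∃ p, ∃ y ∈ (extChartAt (𝓡 n) p).target,
      tangentCoords p (y, 0) = (⟨x, 0⟩ : TangentBundle (𝓡 n) M) := fun x => by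
    obtain ⟨q, hq, hqx⟩ := tangentCoords_symm_apply (n := n) (w := ⟨x, 0⟩)
      (mem_extChartAt_source (I := 𝓡 n) x)
    have hs : scale (n := n) (M := M) 0 ⟨x, 0⟩ = ⟨x, 0⟩ :=
      congrArg (fun v => (⟨x, v⟩ : TangentBundle (𝓡 n) M)) (zero_smul ℝ _)
    refine ⟨x, q.1, hq, ?_⟩
    rw [← hs, ← hqx, scale_tangentCoords, zero_smul]
  let Z : Set (TangentBundle (𝓡 n) M) := Set.range fun x : M => ⟨x, 0⟩
  have hZ : IsCompact Z := isCompact_range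
    (Bundle.contMDiff_zeroSection (n := ∞) (IB := 𝓡 n) ℝ
      (fun x : M => TangentSpace (𝓡 n) x)).continuous
  have hinj : InjOn (symExpMap g) Z := by
    rintro _ ⟨x, rfl⟩ _ ⟨y, rfl⟩ h
    simp only [symExpMap_zero] at h
    have hxy : x = y := congrArg Prod.fst h
    rw [hxy]
  obtain ⟨W, hW, hZW, hWi⟩ := hinj.exists_isOpen_superset hZ
    (by
      rintro _ ⟨x, rfl⟩
      obtain ⟨p, y, hy, h⟩ := hzero x
      exact (congrArg (ContinuousAt (symExpMap g)) h).mp <|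
        continuousAt_symExpMap (zero_mem_symDomain hy))
    (by
      rintro _ ⟨x, rfl⟩
      obtain ⟨p, y, hy, h⟩ := hzero x
      exact (congrArg (fun w => ∃ N ∈ 𝓝 w, InjOn (symExpMap g) N) h).mp <|
        exists_injOn_symExpMap hy)
  refine ⟨W ∩ ⋃ p, tangentCoords p '' symDomain g p, hW.inter (isOpen_iUnion fun p => ?_),
    fun x => ⟨hZW ⟨x, rfl⟩, ?_⟩, hWi.mono Set.inter_subset_left, ?_⟩
  · exact (tangentCoords p).toOpenPartialHomeomorph.isOpen_image_of_subset_source isOpen_interior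
      fun q hq => mem_target_of_mem_symDomain hq
  · obtain ⟨p, y, hy, h⟩ := hzero x
    exact Set.mem_iUnion.2 ⟨p, _, zero_mem_symDomain hy, h⟩
  · rintro w ⟨-, hw⟩
    obtain ⟨p, q, hq, h⟩ := Set.mem_iUnion.1 hw
    exact ⟨p, q, hq, h⟩

/-- The gluing map is an injective local diffeomorphism near `TM × {0}`, namely on the set of all
`(w, t)` for which `t w` belongs to the neighbourhood of `exists_nhds_zeroSection`. -/
theorem exists_glue_domain [CompactSpace M] (g : SmoothMetric n M) :
    ∃ U : Set (TangentBundle (𝓡 n) M × Icc (0 : ℝ) 1), IsOpen U ∧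
      (∀ w : TangentBundle (𝓡 n) M, (w, (0 : Icc (0 : ℝ) 1)) ∈ U) ∧ InjOn (glue g) U ∧
      IsLocalDiffeomorphOn ((𝓡 n).tangent.prod (𝓡∂ 1)) (slabModel (EuclideanSpace ℝ (Fin n))) ∞
        (glue g) U := by
  obtain ⟨W, hWo, hW0, hWi, hW⟩ := exists_nhds_zeroSection g
  refine ⟨{w | scale (w.2 : ℝ) w.1 ∈ W}, hWo.preimage continuous_scale, fun w => ?_, ?_, ?_⟩
  · have : scale 0 w = ⟨w.1, 0⟩ :=
      congrArg (fun v => (⟨w.1, v⟩ : TangentBundle (𝓡 n) M)) (zero_smul ℝ w.2)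
    change scale 0 w ∈ W
    rw [this]
    exact hW0 w.1
  · rintro ⟨w, t⟩ hw ⟨w', t'⟩ hw' h
    rcases eq_zero_or_pos t with ht | ht <;> rcases eq_zero_or_pos t' with ht' | ht'
    · rw [glue_of_eq_zero g ht, glue_of_eq_zero g ht'] at h
      have htt : t = t' := Subtype.ext (ht.trans ht'.symm)
      obtain ⟨x, v⟩ := w
      obtain ⟨x', v'⟩ := w'
      injection h with h1 h2
      subst h1
      have h3 : v = v' := h2
      rw [h3, htt]
    · rw [glue_of_eq_zero g ht, glue_of_pos g ht'] at h
      cases h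
    · rw [glue_of_pos g ht, glue_of_eq_zero g ht'] at h
      cases h
    · rw [glue_of_pos g ht, glue_of_pos g ht'] at h
      injection h with h1 h2 h3
      have htt : t = t' := congrArg Subtype.val h3
      subst htt
      have hww : w = w' := scale_injective ht.ne' (hWi hw hw' (Prod.ext h1 h2))
      rw [hww]
  · rintro ⟨⟨w, t⟩, hw⟩
    obtain ⟨p, q, hq, h⟩ := hW _ hw
    have hx : w.1 ∈ (extChartAt (𝓡 n) p).source := by
      have h1 := congrArg Bundle.TotalSpace.proj h
      change (extChartAt (𝓡 n) p).symm q.1 = w.1 at h1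
      rw [← h1]
      exact (extChartAt (𝓡 n) p).map_target (mem_target_of_mem_symDomain hq)
    obtain ⟨q', hq', rfl⟩ := tangentCoords_symm_apply hx
    refine isLocalDiffeomorphAt_glue (q := (q', t)) ?_
    change tangentCoords p q = scale (t : ℝ) (tangentCoords p q') at h
    rw [scale_tangentCoords] at h
    -- the coordinates of `t w` in the chart around `p` are those of `w`, with `v` multiplied by `t`
    have h2 := (tangentCoords p).injOn (mem_target_of_mem_symDomain hq)
      (show (q'.1, (t : ℝ) • q'.2) ∈ (tangentCoords p).source from hq') h
    exact h2 ▸ hq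

end TangentGroupoid

/-! ### Uniqueness -/

namespace TangentGroupoid

variable {n : ℕ} {M : Type*} [TopologicalSpace M] [ChartedSpace (EuclideanSpace ℝ (Fin n)) M]
  [IsManifold (𝓡 n) ∞ M]

/-- Two glued structures have the same smooth maps: the parametrizations `pair` and `glue g` are
local diffeomorphisms for both of them, and their images cover. -/
theorem IsGlued.contMDiff_id {g : SmoothMetric n M}
    {S T : SmoothStructure (arrowModel n) (TangentGroupoid n M)} (hS : IsGlued g S)
    (hT : IsGlued g T) :
    @ContMDiff ℝ _ _ _ _ _ _ (arrowModel n) _ S.top S.charted _ _ _ _ _ (arrowModel n) _ T.top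
      T.charted ∞ id := by
  obtain ⟨hS1, U, -, hU, -, hU'⟩ := hS
  obtain ⟨hT1, V, -, hV, -, hV'⟩ := hT
  -- the topologies and atlases of `S` and `T` are on the same type and have to be given explicitly
  rintro (⟨x, y, t⟩ | ⟨x, v⟩)
  · exact @IsLocalDiffeomorphAt.contMDiffAt_of_comp _ _ _ _ _ _ _ _ _ _ _ _ _ _ _
      ((𝓡 n).prod ((𝓡 n).prod (𝓡∂ 1))) (arrowModel n) (arrowModel n) (M × M × unitIoc) _ _ _ _
      S.top S.charted T.top T.charted (fun p => pair p.1 p.2.1 p.2.2) id (x, y, t)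
      (hS1 (x, y, t))
      (@IsLocalDiffeomorphAt.contMDiffAt ℝ _ _ _ _ _ _ _ _ _ _ _ _ _ _ _ _ _ T.top T.charted _ _ _
        (hT1 (x, y, t)))
  · have h0 : glue g (⟨x, v⟩, 0) = tangent x v := glue_of_eq_zero g rfl
    rw [← h0]
    exact @IsLocalDiffeomorphAt.contMDiffAt_of_comp _ _ _ _ _ _ _ _ _ _ _ _ _ _ _
      ((𝓡 n).tangent.prod (𝓡∂ 1)) (arrowModel n) (arrowModel n)
      (TangentBundle (𝓡 n) M × Icc (0 : ℝ) 1) _ _ _ _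
      S.top S.charted T.top T.charted (glue g) id
      ((⟨x, v⟩ : TangentBundle (𝓡 n) M), (0 : Icc (0 : ℝ) 1))
      (hU' ⟨_, hU ⟨x, v⟩⟩)
      (@IsLocalDiffeomorphAt.contMDiffAt ℝ _ _ _ _ _ _ _ _ _ _ _ _ _ _ _ _ _ T.top T.charted _ _ _
        (hV' ⟨_, hV ⟨x, v⟩⟩))

end TangentGroupoid

end

/-- The tangent groupoid of a closed manifold `M` is a Lie groupoid over `M × [0, 1]`: for every
Riemannian metric on `M`, gluing `M × M × (0, 1]` and a neighbourhood of `TM × {0}` in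
`TM × [0, 1]` along `(x, v, t) ↦ (exp_x(tv/2), exp_x(-tv/2), t)` defines one and only one smooth
structure on the set of arrows, and for it the groupoid is a Lie groupoid. -/
theorem mainTheorem7 (n : ℕ) (M : Type*) [TopologicalSpace M] [T2Space M] [CompactSpace M]
    [ChartedSpace (EuclideanSpace ℝ (Fin n)) M] [IsManifold (𝓡 n) ∞ M]
    (g : SmoothMetric n M) :
    ∃ S : SmoothStructure (TangentGroupoid.arrowModel n) (TangentGroupoid n M),
      TangentGroupoid.IsGlued g S ∧
      (∀ S' : SmoothStructure (TangentGroupoid.arrowModel n) (TangentGroupoid n M),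
        TangentGroupoid.IsGlued g S' → S'.Same S) ∧
      letI := S.top
      letI := S.charted
      T2Space (TangentGroupoid n M) ∧
      (TangentGroupoid.groupoid n M).IsLieGroupoid ((𝓡 n).prod (𝓡∂ 1))
        (TangentGroupoid.arrowModel n) (TangentGroupoid.composableModel n) := by
  let S : SmoothStructure (TangentGroupoid.arrowModel n) (TangentGroupoid n M) :=
    { top := inferInstance
      charted := TangentGroupoid.instChartedSpace
      isManifold := TangentGroupoid.instIsManifold }
  have hS : TangentGroupoid.IsGlued g S :=
    ⟨TangentGroupoid.isLocalDiffeomorph_pair, TangentGroupoid.exists_glue_domain g⟩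
  exact ⟨S, hS, fun S' hS' => ⟨hS'.contMDiff_id hS, hS.contMDiff_id hS'⟩,
    TangentGroupoid.instT2Space, TangentGroupoid.isLieGroupoid n M⟩
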